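/- Let $k$ be a field, let $P$ be a poset all of whose closed intervals $[x,y]=\{z: x\le z\le y\}$ ($x\le y$) are finite, and let $\sim$ be an equivalence relation on the set $\mathrm{Int}(P)$ of closed intervals; write $\widetilde{[x,y]}$ for the class of $[x,y]$. Assume: 1. if $[x,y]\sim[x',y']$ and $[y,z]\sim[y',z']$, then $[x,z]\sim[x',z']$; 2. if $[x,y]\sim[x',y']$, there is exactly one map $\tau:[x,y]\to[x',y']$ with $[x,z]\sim[x',\tau(z)]$ and $[z,y]\sim[\tau(z),y']$ for all $z\in[x,y]$; 3. the relation $x\sim y :\Leftrightarrow [x,x]\sim[y,y]$ on $P$ has only finitely many classes $\tilde x\in P/\!\sim$; 4. if $x\le y_1$, $y_2\le z$ and $y_1\sim y_2$, there are $x'\le y'\le z'$ in $P$ with $[x',y']\sim[x,y_1]$ and $[y',z']\sim[y_2,z]$. For $\alpha=\widetilde{[x,y]}$ put $s(\alpha)=\tilde x$ and $t(\alpha)=\tilde y$ (these are well defined). Let $A=k[P]_{\mathrm{red}}$ be the $k$-algebra with basis $\xi_\alpha$, $\alpha\in \mathrm{Int}(P)/\!\sim$, where $\xi_\alpha\xi_\beta=\xi_\gamma$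 if there are $x\le y\le z$ with $[x,y]\in\alpha$, $[y,z]\in\beta$, $[x,z]\in\gamma$, and $\xi_\alpha\xi_\beta=0$ otherwise. Let $A_0$ be the span of the idempotents $\xi_{\tilde x}:=\xi_{\widetilde{[x,x]}}$ and $I$ the two-sided ideal spanned by the $\xi_{\widetilde{[x,y]}}$ with $x<y$. Let $R=\mathrm{gr}_I A=\bigoplus_{d\ge 0} I^d/I^{d+1}$, regard $A_0=R/\bigoplus_{d>0}R_d$ as an $R$-module concentrated in degree $0$, and put $k_{\tilde y}=A_0\xi_{\tilde y}$. Let $J\subseteq I$ be a right ideal of $A$ generated by a set of monomials $\xi_\alpha$, and let $\mathrm{gr}_I J=\bigoplus_{d\ge0} JI^d/JI^{d+1}$, a graded right $R$-module with a commuting left action of $A_0$. Write $\alpha\in J$ for $\xi_\alpha\in J$. Fix for every class $\alpha$ a representative $[x(\alpha),y(\alpha)]$, and let $\Delta_\alpha$ be the order complex (the simplicial complex of finite chains, including $\varnothing$) of $$(x(\alpha),y(\alpha))|_J=\{z\in P:\ x(\alpha)<z<y(\alpha),\ \widetilde{[x(\alpha),z]}\in J\}.$$ For a simplicial complex $\Delta$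 let $\Delta^{\langle j\rangle}$ be the subcomplex generated by all faces of dimension at least $j$ (with $\dim\varnothing=-1$), and let $\tilde H_*(\Delta,\Gamma;k)$ denote relative reduced simplicial homology; the complex without faces and the complex $\{\varnothing\}$ are distinguished. Then for all $i\ge0$ and $j\in\mathbb Z$ the component of internal degree $j$ of Tor has a decomposition of $A_0$-$A_0$-bimodules $$\mathrm{Tor}_i^R(\mathrm{gr}_I J,A_0)_j\;\cong\bigoplus_{(\tilde x,\tilde y)\in P/\!\sim\,\times\,P/\!\sim}\mathrm{Tor}_i^R(\xi_{\tilde x}\,\mathrm{gr}_I J,\;k_{\tilde y})_j ,$$ and for all $\tilde x,\tilde y\in P/\!\sim$ there is an isomorphism of $k$-vector spaces $$\mathrm{Tor}_i^R(\xi_{\tilde x}\,\mathrm{gr}_I J,\;k_{\tilde y})_j\;\cong\bigoplus_{\substack{\alpha\in J\\ s(\alpha)=\tilde x,\ t(\alpha)=\tilde y}}\tilde H_{i-1}\big(\Delta_\alpha^{\langle j-1\rangle},\Delta_\alpha^{\langle j\rangle};k\big).$$ -/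

import Mathlib

open scoped TensorProduct DirectSum

universe u v w

namespace RedInc

section Poset

variable {P : Type v} [PartialOrder P]

/-- The class of the interval `[x, y]` in `Int(P)/∼`. (`NonemptyInterval P` is the type of
closed intervals `[x, y]` with `x ≤ y`.) -/
def cls (r : Setoid (NonemptyInterval P)) {x y : P} (h : x ≤ y) : Quotient r :=
  Quotient.mk r ⟨(x, y), h⟩

/-- The relation `x ∼ y` on `P`, meaning `[x, x] ∼ [y, y]`. -/
def vtxSetoid (r : Setoid (NonemptyInterval P)) : Setoid P := r.comap NonemptyInterval.pure

/-- The set `P/∼`. -/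
abbrev Vtx (r : Setoid (NonemptyInterval P)) : Type v := Quotient (vtxSetoid r)

/-- The four standing conditions on a pair `(P, ∼)`.

* Order-compatibility: `[x,y] ∼ [x',y']` and `[y,z] ∼ [y',z']` imply `[x,z] ∼ [x',z']`.
* Invariance: if `[x,y] ∼ [x',y']` then there is exactly one map `τ : [x,y] → [x',y']` with
  `[x,z] ∼ [x',τ z]` and `[z,y] ∼ [τ z,y']` for all `z`.
* Finiteness: `P/∼` is finite.
* Concatenation: if `x ≤ y₁`, `y₂ ≤ z` and `y₁ ∼ y₂`, then there are `x' ≤ y' ≤ z'` with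
  `[x',y'] ∼ [x,y₁]` and `[y',z'] ∼ [y₂,z]`. -/
class IncidenceLaws (r : Setoid (NonemptyInterval P)) : Prop where
  order_compatibility : ∀ {x y z x' y' z' : P} (hxy : x ≤ y) (hyz : y ≤ z)
    (hxy' : x' ≤ y') (hyz' : y' ≤ z'), cls r hxy = cls r hxy' → cls r hyz = cls r hyz' →
    cls r (hxy.trans hyz) = cls r (hxy'.trans hyz')
  invariance : ∀ {x y x' y' : P} (h : x ≤ y) (h' : x' ≤ y'), cls r h = cls r h' →
    ∃! τ : Set.Icc x y → Set.Icc x' y', ∀ z : Set.Icc x y,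
      cls r (τ z).2.1 = cls r z.2.1 ∧ cls r (τ z).2.2 = cls r z.2.2
  finiteness : Finite (Vtx r)
  concatenation : ∀ {x y₁ y₂ z : P} (h₁ : x ≤ y₁) (h₂ : y₂ ≤ z),
    (Quotient.mk _ y₁ : Vtx r) = Quotient.mk _ y₂ →
    ∃ (x' y' z' : P) (h₁' : x' ≤ y') (h₂' : y' ≤ z'),
      cls r h₁' = cls r h₁ ∧ cls r h₂' = cls r h₂

variable (r : Setoid (NonemptyInterval P))

/-- `ξ_α ξ_β = ξ_γ`: there are `x ≤ y ≤ z` with `[x, y]` in `α`, `[y, z]` in `β`,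
`[x, z]` in `γ`. -/
def Composes (α β γ : Quotient r) : Prop :=
  ∃ (x y z : P) (hxy : x ≤ y) (hyz : y ≤ z),
    cls r hxy = α ∧ cls r hyz = β ∧ cls r (hxy.trans hyz) = γ

/-- The class `[x, x]` of a vertex class. -/
def idCls : Vtx r → Quotient r :=
  Quotient.lift (fun x => cls r (le_refl x)) fun _ _ h => Quotient.sound h

variable {r}

theorem idCls_injective : Function.Injective (idCls r) := by
  rintro ⟨x⟩ ⟨y⟩ h
  exact Quotient.sound (Quotient.exact h : r _ _)

theorem cls_surj (α : Quotient r) : ∃ (x y : P) (h : x ≤ y), cls r h = α := by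
  obtain ⟨⟨⟨x, y⟩, h⟩⟩ := α
  exact ⟨x, y, h, rfl⟩

variable [IncidenceLaws r]

theorem Composes.unique {α β γ γ' : Quotient r} (h : Composes r α β γ)
    (h' : Composes r α β γ') : γ = γ' := by
  obtain ⟨x, y, z, h1, h2, rfl, rfl, rfl⟩ := h
  obtain ⟨x', y', z', h1', h2', e1, e2, rfl⟩ := h'
  exact IncidenceLaws.order_compatibility _ _ _ _ e1.symm e2.symm

theorem exists_between {x y z x' z' : P} (hxy : x ≤ y) (hyz : y ≤ z) (h' : x' ≤ z')
    (e : cls r (hxy.trans hyz) = cls r h') :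
    ∃ (y' : P) (h1 : x' ≤ y') (h2 : y' ≤ z'), cls r h1 = cls r hxy ∧ cls r h2 = cls r hyz := by
  obtain ⟨τ, hτ, -⟩ := IncidenceLaws.invariance _ _ e
  exact ⟨τ ⟨y, hxy, hyz⟩, _, _, hτ ⟨y, hxy, hyz⟩⟩

theorem cls_left {x y x' y' : P} (h : x ≤ y) (h' : x' ≤ y') (e : cls r h = cls r h') :
    cls r (le_refl x) = cls r (le_refl x') := by
  obtain ⟨w, h1, h2, e1, e2⟩ := exists_between (le_refl x) h h' e
  obtain ⟨t, h3, h4, e3, e4⟩ := exists_between (le_refl x') h1 (le_refl x) e1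
  obtain rfl : x = t := le_antisymm h3 h4
  exact e3

theorem cls_right {x y x' y' : P} (h : x ≤ y) (h' : x' ≤ y') (e : cls r h = cls r h') :
    cls r (le_refl y) = cls r (le_refl y') := by
  obtain ⟨w, h1, h2, e1, e2⟩ := exists_between h (le_refl y) h' e
  obtain ⟨t, h3, h4, e3, e4⟩ := exists_between h2 (le_refl y') (le_refl y) e2
  obtain rfl : y = t := le_antisymm h3 h4
  exact e4

theorem eq_of_cls_eq_refl {x y z : P} (h : x ≤ y) (e : cls r h = cls r (le_refl z)) : x = y := by
  obtain ⟨τ, hτ, -⟩ := IncidenceLaws.invariance _ _ e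
  obtain ⟨σ, hσ, -⟩ := IncidenceLaws.invariance _ _ e.symm
  obtain ⟨ι, -, hι⟩ := IncidenceLaws.invariance (r := r) h h rfl
  have h1 : σ ∘ τ = ι := hι _ fun t =>
    ⟨(hσ (τ t)).1.trans (hτ t).1, (hσ (τ t)).2.trans (hτ t).2⟩
  have h2 : id = ι := hι _ fun t => ⟨rfl, rfl⟩
  have h3 : σ ∘ τ = id := h1.trans h2.symm
  have key : ∀ a b : Set.Icc x y, a = b := fun a b => by
    have hab : τ a = τ b := Subtype.ext
      ((le_antisymm (τ a).2.2 (τ a).2.1).trans (le_antisymm (τ b).2.2 (τ b).2.1).symm)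
    calc a = (σ ∘ τ) a := by rw [h3]; rfl
      _ = (σ ∘ τ) b := by simp [hab]
      _ = b := by rw [h3]; rfl
  exact congrArg Subtype.val (key ⟨x, le_refl x, h⟩ ⟨y, h, le_refl y⟩)

variable (r)

/-- The source `s(α) = x̃` of `α = [x, y]`. -/
def src : Quotient r → Vtx r :=
  Quotient.lift (fun I => Quotient.mk _ I.fst) fun I J h =>
    Quotient.sound (Quotient.exact (cls_left I.fst_le_snd J.fst_le_snd (Quotient.sound h)) : r _ _)

/-- The target `t(α) = ỹ` of `α = [x, y]`. -/
def tgt : Quotient r → Vtx r :=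
  Quotient.lift (fun I => Quotient.mk _ I.snd) fun I J h =>
    Quotient.sound (Quotient.exact (cls_right I.fst_le_snd J.fst_le_snd (Quotient.sound h)) : r _ _)

variable {r}

theorem composes_id_left {a : Vtx r} {β γ : Quotient r} :
    Composes r (idCls r a) β γ ↔ a = src r β ∧ γ = β := by
  obtain ⟨a⟩ := a
  constructor
  · rintro ⟨x, y, z, h1, h2, e1, rfl, rfl⟩
    obtain rfl : x = y := eq_of_cls_eq_refl h1 e1
    exact ⟨idCls_injective e1.symm, rfl⟩
  · rintro ⟨h, rfl⟩
    obtain ⟨x, y, hxy, rfl⟩ := cls_surj γ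
    exact ⟨x, x, y, le_rfl, hxy, (congrArg (idCls r) h).symm, rfl, rfl⟩

theorem composes_id_right {a : Vtx r} {β γ : Quotient r} :
    Composes r β (idCls r a) γ ↔ a = tgt r β ∧ γ = β := by
  obtain ⟨a⟩ := a
  constructor
  · rintro ⟨x, y, z, h1, h2, rfl, e1, rfl⟩
    obtain rfl : y = z := eq_of_cls_eq_refl h2 e1
    exact ⟨idCls_injective e1.symm, rfl⟩
  · rintro ⟨h, rfl⟩
    obtain ⟨x, y, hxy, rfl⟩ := cls_surj γ
    exact ⟨x, y, y, hxy, le_rfl, rfl, (congrArg (idCls r) h).symm, rfl⟩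

theorem composes_assoc {α β γ ε : Quotient r} :
    (∃ δ, Composes r α β δ ∧ Composes r δ γ ε) ↔ ∃ δ, Composes r β γ δ ∧ Composes r α δ ε := by
  constructor
  · rintro ⟨_, ⟨x, y, z, h1, h2, rfl, rfl, rfl⟩, ⟨x', z', w', h3, h4, e, rfl, rfl⟩⟩
    obtain ⟨y', h5, h6, e5, e6⟩ := exists_between h1 h2 h3 e.symm
    exact ⟨_, ⟨y', z', w', h6, h4, e6, rfl, rfl⟩, ⟨x', y', w', h5, h6.trans h4, e5, rfl, rfl⟩⟩
  · rintro ⟨_, ⟨y, z, w, h1, h2, rfl, rfl, rfl⟩, ⟨x', y', w', h3, h4, rfl, e, rfl⟩⟩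
    obtain ⟨z', h5, h6, e5, e6⟩ := exists_between h1 h2 h4 e.symm
    exact ⟨_, ⟨x', y', z', h3, h5, rfl, e5, rfl⟩, ⟨x', z', w', h3.trans h5, h6, rfl, e6, rfl⟩⟩

end Poset

noncomputable section Algebra

variable (k : Type u) [Field k] {P : Type v} [PartialOrder P] (r : Setoid (NonemptyInterval P))

/-- The reduced incidence algebra `k[P]_red`, with `k`-basis the classes of intervals. -/
def RedIncAlg : Type max u v := Quotient r →₀ k

instance : AddCommGroup (RedIncAlg k r) := inferInstanceAs (AddCommGroup (Quotient r →₀ k))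
instance : Module k (RedIncAlg k r) := inferInstanceAs (Module k (Quotient r →₀ k))

variable {r}

/-- The monomial `ξ_α`. -/
def xi (α : Quotient r) : RedIncAlg k r := Finsupp.single α (1 : k)

variable (r)

open Classical in
/-- The product of two monomials: `ξ_γ` if there is a composite class `γ`, zero otherwise. -/
def mulXi (α β : Quotient r) : RedIncAlg k r :=
  if h : ∃ γ, Composes r α β γ then xi k h.choose else 0

/-- The `k`-bilinear multiplication of `k[P]_red`. -/
def mulLin : RedIncAlg k r →ₗ[k] RedIncAlg k r →ₗ[k] RedIncAlg k r :=
  Finsupp.linearCombination k fun α => Finsupp.linearCombination k fun β => mulXi k r α β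

instance : Mul (RedIncAlg k r) := ⟨fun a b => mulLin k r a b⟩

variable {k r}

theorem mul_def (a b : RedIncAlg k r) : a * b = mulLin k r a b := rfl

theorem xi_mul_xi (α β : Quotient r) : xi k α * xi k β = mulXi k r α β := by
  rw [mul_def, mulLin, xi, xi]
  erw [Finsupp.linearCombination_single, one_smul, Finsupp.linearCombination_single, one_smul]

instance : One (RedIncAlg k r) := ⟨∑ᶠ a : Vtx r, xi k (idCls r a)⟩

theorem one_def : (1 : RedIncAlg k r) = ∑ᶠ a : Vtx r, xi k (idCls r a) := rfl

theorem lhom_ext {M : Type*} [AddCommMonoid M] [Module k M] {f g : RedIncAlg k r →ₗ[k] M}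
    (h : ∀ α, f (xi k α) = g (xi k α)) : f = g :=
  Finsupp.lhom_ext' fun α => LinearMap.ext_ring (h α)

theorem mulXi_eq_zero {α β : Quotient r} (h : ¬ ∃ γ, Composes r α β γ) : mulXi k r α β = 0 :=
  dif_neg h

variable [IncidenceLaws r]

theorem mulXi_eq {α β γ : Quotient r} (h : Composes r α β γ) : mulXi k r α β = xi k γ := by
  have h' : ∃ γ, Composes r α β γ := ⟨γ, h⟩
  rw [mulXi, dif_pos h', h'.choose_spec.unique h]

theorem xi_assoc (α β γ : Quotient r) :
    xi k α * xi k β * xi k γ = xi k α * (xi k β * xi k γ) := by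
  have z1 : ∀ a : RedIncAlg k r, a * 0 = 0 := fun a => map_zero (mulLin k r a)
  have z2 : ∀ a : RedIncAlg k r, 0 * a = 0 := fun a => LinearMap.map_zero₂ (mulLin k r) a
  by_cases h : ∃ ε, ∃ δ, Composes r α β δ ∧ Composes r δ γ ε
  · obtain ⟨ε, h⟩ := h
    obtain ⟨δ', h1', h2'⟩ := composes_assoc.1 h
    obtain ⟨δ, h1, h2⟩ := h
    rw [xi_mul_xi, xi_mul_xi, mulXi_eq h1, mulXi_eq h1', xi_mul_xi, xi_mul_xi, mulXi_eq h2,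
      mulXi_eq h2']
  · have hl : xi k α * xi k β * xi k γ = 0 := by
      rw [xi_mul_xi]
      by_cases h1 : ∃ δ, Composes r α β δ
      · obtain ⟨δ, h1⟩ := h1
        rw [mulXi_eq h1, xi_mul_xi, mulXi_eq_zero fun ⟨ε, h2⟩ => h ⟨ε, δ, h1, h2⟩]
      · rw [mulXi_eq_zero h1, z2]
    rw [hl, xi_mul_xi]
    by_cases h1 : ∃ δ, Composes r β γ δ
    · obtain ⟨δ, h1⟩ := h1
      rw [mulXi_eq h1, xi_mul_xi, mulXi_eq_zero fun ⟨ε, h2⟩ => h ⟨ε, composes_assoc.2 ⟨δ, h1, h2⟩⟩]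
    · rw [mulXi_eq_zero h1, z1]

theorem idem_mul_xi (a : Vtx r) (β : Quotient r) [Decidable (a = src r β)] :
    xi k (idCls r a) * xi k β = if a = src r β then xi k β else 0 := by
  rw [xi_mul_xi]
  split_ifs with h
  · exact mulXi_eq (composes_id_left.2 ⟨h, rfl⟩)
  · exact mulXi_eq_zero fun ⟨γ, hγ⟩ => h (composes_id_left.1 hγ).1

theorem xi_mul_idem (a : Vtx r) (β : Quotient r) [Decidable (a = tgt r β)] :
    xi k β * xi k (idCls r a) = if a = tgt r β then xi k β else 0 := by
  rw [xi_mul_xi]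
  split_ifs with h
  · exact mulXi_eq (composes_id_right.2 ⟨h, rfl⟩)
  · exact mulXi_eq_zero fun ⟨γ, hγ⟩ => h (composes_id_right.1 hγ).1

instance : Ring (RedIncAlg k r) where
  __ := (inferInstance : AddCommGroup (RedIncAlg k r))
  left_distrib a b c := map_add (mulLin k r a) b c
  right_distrib a b c := LinearMap.map_add₂ (mulLin k r) a b c
  zero_mul a := LinearMap.map_zero₂ (mulLin k r) a
  mul_zero a := map_zero (mulLin k r a)
  mul_assoc a b c := by
    have : (mulLin k r).compr₂ (mulLin k r) =
        LinearMap.lcomp k _ (mulLin k r) ∘ₗ (LinearMap.llcomp k _ _ _ ∘ₗ mulLin k r) := by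
      refine lhom_ext fun α => lhom_ext fun β => lhom_ext fun γ => ?_
      exact xi_assoc α β γ
    exact congr($this a b c)
  one_mul a := by
    classical
    have := IncidenceLaws.finiteness (r := r)
    cases nonempty_fintype (Vtx r)
    have : mulLin k r 1 = LinearMap.id := by
      refine lhom_ext fun β => ?_
      rw [one_def, finsum_eq_sum_of_fintype, map_sum, LinearMap.sum_apply]
      simp only [← mul_def, idem_mul_xi]
      simp
    exact congr($this a)
  mul_one a := by
    classical
    have := IncidenceLaws.finiteness (r := r)
    cases nonempty_fintype (Vtx r)
    have : (mulLin k r).flip 1 = LinearMap.id := by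
      refine lhom_ext fun β => ?_
      rw [one_def, finsum_eq_sum_of_fintype, map_sum, LinearMap.sum_apply]
      simp only [LinearMap.flip_apply, ← mul_def, xi_mul_idem]
      simp
    exact congr($this a)

instance : Algebra k (RedIncAlg k r) :=
  Algebra.ofModule (fun c a b => LinearMap.map_smul₂ (mulLin k r) c a b)
    (fun c a b => map_smul (mulLin k r a) c b)

end Algebra
noncomputable section Graded

variable {k : Type u} [Field k] {A : Type w} [Ring A] [Algebra k A]

/-- A `k`-subspace closed under right multiplication. -/
class IsRightIdeal (J : Submodule k A) : Prop where
  mul_mem : ∀ x ∈ J, ∀ a : A, x * a ∈ J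

instance : IsRightIdeal (⊤ : Submodule k A) := ⟨fun _ _ _ => trivial⟩

variable (I J : Submodule k A)

/-- The homogeneous component `J I^d / J I^(d+1)`. In Mathlib `I ^ 0 = k · 1` for a subspace `I`,
so `J * I ^ 0 = J`; for `J = ⊤` and a two-sided ideal `I` this is `I^d / I^(d+1)`,
with `I^0 = A`. -/
def GrPiece (d : ℕ) : Type w := ↥(J * I ^ d) ⧸ (J * I ^ (d + 1)).submoduleOf (J * I ^ d)

instance (d : ℕ) : AddCommGroup (GrPiece I J d) :=
  inferInstanceAs (AddCommGroup (↥(J * I ^ d) ⧸ (J * I ^ (d + 1)).submoduleOf (J * I ^ d)))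
instance (d : ℕ) : Module k (GrPiece I J d) :=
  inferInstanceAs (Module k (↥(J * I ^ d) ⧸ (J * I ^ (d + 1)).submoduleOf (J * I ^ d)))

/-- The projection `J I^d → J I^d / J I^(d+1)`. -/
def pieceMk (d : ℕ) : ↥(J * I ^ d) →ₗ[k] GrPiece I J d :=
  Submodule.mkQ ((J * I ^ (d + 1)).submoduleOf (J * I ^ d))

/-- The associated graded module `gr_I J = ⨁ J I^d / J I^(d+1)`. -/
abbrev GrMod : Type w := ⨁ d : ℕ, GrPiece I J d

/-- The class in degree `d` of an element of `J I^d`. -/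
def grMk (d : ℕ) : ↥(J * I ^ d) →ₗ[k] GrMod I J :=
  DirectSum.lof k ℕ (GrPiece I J) d ∘ₗ pieceMk I J d

/-- The homogeneous elements of degree `n` of `gr_I J` (only `0` for negative `n`). -/
def grDeg (n : ℤ) : Submodule k (GrMod I J) :=
  ⨆ (d : ℕ) (_ : (d : ℤ) = n), LinearMap.range (grMk I J d)

variable {I J}

/-- The map out of `J I^d / J I^(d+1)` given by a map on `J I^d` that vanishes on `J I^(d+1)`. -/
def pieceLift {M : Type*} [AddCommGroup M] [Module k M] {d : ℕ} (f : ↥(J * I ^ d) →ₗ[k] M)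
    (h : ∀ x : ↥(J * I ^ d), (x : A) ∈ J * I ^ (d + 1) → f x = 0) : GrPiece I J d →ₗ[k] M :=
  Submodule.liftQ _ f fun x hx => h x hx

theorem pieceLift_mk {M : Type*} [AddCommGroup M] [Module k M] {d : ℕ} (f : ↥(J * I ^ d) →ₗ[k] M)
    (h : ∀ x : ↥(J * I ^ d), (x : A) ∈ J * I ^ (d + 1) → f x = 0) (x : ↥(J * I ^ d)) :
    pieceLift f h (pieceMk I J d x) = f x := rfl

theorem pieceMk_surjective (d : ℕ) : Function.Surjective (pieceMk I J d) :=
  Submodule.mkQ_surjective _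

theorem pieceMk_eq_zero {d : ℕ} (x : ↥(J * I ^ d)) (h : (x : A) ∈ J * I ^ (d + 1)) :
    pieceMk I J d x = 0 :=
  (Submodule.Quotient.mk_eq_zero _).2 h

theorem grHom_ext {M : Type*} [AddCommMonoid M] [Module k M] {f g : GrMod I J →ₗ[k] M}
    (h : ∀ d x, f (grMk I J d x) = g (grMk I J d x)) : f = g := by
  refine DirectSum.linearMap_ext k fun d => LinearMap.ext fun y => ?_
  obtain ⟨x, rfl⟩ := pieceMk_surjective d y
  exact h d x

theorem grMk_eq_zero {d : ℕ} (x : ↥(J * I ^ d)) (h : (x : A) ∈ J * I ^ (d + 1)) :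
    grMk I J d x = 0 := by
  rw [grMk, LinearMap.comp_apply, pieceMk_eq_zero x h, map_zero]

theorem grMk_congr {d e : ℕ} (h : d = e) (x : ↥(J * I ^ d)) (y : ↥(J * I ^ e))
    (hxy : (x : A) = y) : grMk I J d x = grMk I J e y := by
  subst h; rw [Subtype.ext hxy]

theorem grMk_mem (d : ℕ) (x : ↥(J * I ^ d)) : grMk I J d x ∈ grDeg I J d :=
  Submodule.mem_iSup_of_mem d (Submodule.mem_iSup_of_mem rfl ⟨x, rfl⟩)

theorem filt_left {a : A} (ha : ∀ x ∈ J, a * x ∈ J) (d : ℕ) {x : A} (hx : x ∈ J * I ^ d) :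
    a * x ∈ J * I ^ d := by
  induction hx using Submodule.mul_induction_on' with
  | mem_mul_mem m hm n hn => rw [← mul_assoc]; exact Submodule.mul_mem_mul (ha m hm) hn
  | add x _ y _ hx hy => rw [mul_add]; exact add_mem hx hy

/-- Left multiplication on `gr_I J` by an element `a` of `A` with `a J ⊆ J`. -/
def grLeftLin (I : Submodule k A) (a : A) (ha : ∀ x ∈ J, a * x ∈ J) :
    GrMod I J →ₗ[k] GrMod I J :=
  DirectSum.toModule k ℕ _ fun d => pieceLift
    (grMk I J d ∘ₗ (LinearMap.mulLeft k a).restrict fun _ hx => filt_left ha d hx)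
    fun _ hx => grMk_eq_zero _ (filt_left (J := J) ha (d + 1) hx)

theorem grLeftLin_mk (a : A) (ha : ∀ x ∈ J, a * x ∈ J) (d : ℕ) (x : ↥(J * I ^ d)) :
    grLeftLin I a ha (grMk I J d x) = grMk I J d ⟨a * x, filt_left ha d x.2⟩ := by
  rw [grLeftLin, grMk, LinearMap.comp_apply, DirectSum.toModule_lof]
  rfl

variable [IsRightIdeal I] [IsRightIdeal J]

theorem filt_mul_top (d : ℕ) : J * I ^ d * ⊤ ≤ J * I ^ d := by
  have key : ∀ K : Submodule k A, IsRightIdeal K → K * ⊤ ≤ K := fun K hK =>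
    Submodule.mul_le.2 fun x hx a _ => hK.mul_mem x hx a
  cases d with
  | zero => simpa using key J ‹_›
  | succ d =>
    rw [pow_succ, mul_assoc, mul_assoc]
    exact mul_le_mul_right (mul_le_mul_right (key I ‹_›) _) _

theorem filt_mul (d e : ℕ) : J * I ^ d * (⊤ * I ^ e) ≤ J * I ^ (d + e) := by
  rw [← mul_assoc, pow_add, ← mul_assoc]
  exact mul_le_mul_left (filt_mul_top d) _

variable (I J)

/-- The product `J I^d × I^e → J I^(d+e)`, followed by the class in `gr_I J`. -/
def preMul (d e : ℕ) : ↥(J * I ^ d) →ₗ[k] ↥((⊤ : Submodule k A) * I ^ e) →ₗ[k] GrMod I J :=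
  LinearMap.mk₂ k (fun a b =>
      grMk I J (d + e) ⟨(a : A) * b, filt_mul d e (Submodule.mul_mem_mul a.2 b.2)⟩)
    (fun _ _ _ => by rw [← map_add]; congr 1; exact Subtype.ext (add_mul _ _ _))
    (fun _ _ _ => by rw [← map_smul]; congr 1; exact Subtype.ext (smul_mul_assoc _ _ _))
    (fun _ _ _ => by rw [← map_add]; congr 1; exact Subtype.ext (mul_add _ _ _))
    (fun _ _ _ => by rw [← map_smul]; congr 1; exact Subtype.ext (mul_smul_comm _ _ _))

theorem preMul_right (d e : ℕ) (b : ↥((⊤ : Submodule k A) * I ^ e))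
    (hb : (b : A) ∈ (⊤ : Submodule k A) * I ^ (e + 1)) : (preMul I J d e).flip b = 0 := by
  ext1 a
  exact grMk_eq_zero _ (filt_mul (J := J) d (e + 1) (Submodule.mul_mem_mul a.2 hb))

theorem preMul_left (d e : ℕ) (a : ↥(J * I ^ d)) (ha : (a : A) ∈ J * I ^ (d + 1)) :
    preMul I J d e a = 0 := by
  ext1 b
  refine grMk_eq_zero _ ?_
  have := filt_mul (J := J) (d + 1) e (Submodule.mul_mem_mul ha b.2)
  rwa [add_right_comm] at this

/-- The product `(J I^d / J I^(d+1)) × (I^e / I^(e+1)) → J I^(d+e) / J I^(d+e+1)`. -/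
def pieceMul (d e : ℕ) : GrPiece I J d →ₗ[k] GrPiece I (⊤ : Submodule k A) e →ₗ[k] GrMod I J :=
  pieceLift (pieceLift (preMul I J d e).flip (preMul_right I J d e)).flip fun a ha => by
    refine LinearMap.ext fun y => ?_
    obtain ⟨b, rfl⟩ := pieceMk_surjective e y
    exact congr($(preMul_left I J d e a ha) b)

/-- The right multiplication `gr_I J × gr_I A → gr_I J`. -/
def grMul : GrMod I J →ₗ[k] GrMod I (⊤ : Submodule k A) →ₗ[k] GrMod I J :=
  DirectSum.toModule k ℕ _ fun d =>
    (DirectSum.toModule k ℕ _ fun e => (pieceMul I J d e).flip).flip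

variable {I J}

theorem grMul_mk (d e : ℕ) (a : ↥(J * I ^ d)) (b : ↥((⊤ : Submodule k A) * I ^ e)) :
    grMul I J (grMk I J d a) (grMk I ⊤ e b) =
      grMk I J (d + e) ⟨(a : A) * b, filt_mul d e (Submodule.mul_mem_mul a.2 b.2)⟩ := by
  rw [grMul, grMk, LinearMap.comp_apply, DirectSum.toModule_lof, LinearMap.flip_apply, grMk,
    LinearMap.comp_apply, DirectSum.toModule_lof, LinearMap.flip_apply]
  rfl

theorem grMul_assoc (m : GrMod I J) (s t : GrMod I (⊤ : Submodule k A)) :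
    grMul I J (grMul I J m s) t = grMul I J m (grMul I ⊤ s t) := by
  have : (grMul I J).compr₂ (grMul I J) =
      LinearMap.lcomp k _ (grMul I ⊤) ∘ₗ (LinearMap.llcomp k _ _ _ ∘ₗ grMul I J) := by
    refine grHom_ext fun d x => grHom_ext fun e y => grHom_ext fun f z => ?_
    simp only [LinearMap.compr₂_apply, LinearMap.comp_apply, LinearMap.lcomp_apply,
      LinearMap.llcomp_apply]
    rw [grMul_mk, grMul_mk, grMul_mk, grMul_mk]
    exact grMk_congr (add_assoc d e f) _ _ (mul_assoc _ _ _)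
  exact congr($this m s t)

/-- The class in `A / I`, the degree `0` part of `gr_I A`, of an element of `A`. -/
def grOf₀ (I : Submodule k A) (a : A) : GrMod I (⊤ : Submodule k A) := grMk I ⊤ 0 ⟨a, by simp⟩

theorem grMul_one (m : GrMod I J) : grMul I J m (grOf₀ I 1) = m := by
  have : (grMul I J).flip (grOf₀ I 1) = LinearMap.id := by
    refine grHom_ext fun d x => ?_
    rw [LinearMap.flip_apply, grOf₀, grMul_mk]
    exact grMk_congr (add_zero d) _ _ (mul_one _)
  exact congr($this m)

theorem one_grMul (m : GrMod I (⊤ : Submodule k A)) : grMul I ⊤ (grOf₀ I 1) m = m := by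
  have : grMul I ⊤ (grOf₀ I 1) = LinearMap.id := by
    refine grHom_ext fun d x => ?_
    rw [grOf₀, grMul_mk]
    exact grMk_congr (zero_add d) _ _ (one_mul _)
  exact congr($this m)

/-- The associated graded ring `gr_I A = ⨁ I^d / I^(d+1)` of a two-sided ideal `I`. -/
def GrRing (I : Submodule k A) : Type w := GrMod I (⊤ : Submodule k A)

instance : AddCommGroup (GrRing I) := inferInstanceAs (AddCommGroup (GrMod I ⊤))
instance : Module k (GrRing I) := inferInstanceAs (Module k (GrMod I ⊤))

instance : Ring (GrRing I) where
  __ := (inferInstance : AddCommGroup (GrRing I))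
  mul a b := grMul I ⊤ a b
  one := grOf₀ I 1
  left_distrib a b c := map_add (grMul I ⊤ a) b c
  right_distrib a b c := LinearMap.map_add₂ (grMul I ⊤) a b c
  zero_mul a := LinearMap.map_zero₂ (grMul I ⊤) a
  mul_zero a := map_zero (grMul I ⊤ a)
  mul_assoc := grMul_assoc
  one_mul := one_grMul
  mul_one := grMul_one

instance : Algebra k (GrRing I) :=
  Algebra.ofModule (fun c a b => LinearMap.map_smul₂ (grMul I ⊤) c a b)
    (fun c a b => map_smul (grMul I ⊤ a) c b)

/-- The homogeneous elements of degree `n` of `gr_I A`. -/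
def ringDeg (I : Submodule k A) (n : ℤ) : Submodule k (GrRing I) := grDeg I ⊤ n

/-- The class in `A / I`, the degree `0` part of `gr_I A`, of an element of `A`. -/
def grOf (I : Submodule k A) (a : A) : GrRing I := grOf₀ I a

/-- The right `gr_I A`-module structure of `gr_I J`. -/
instance : Module (GrRing I)ᵐᵒᵖ (GrMod I J) where
  smul s m := grMul I J m s.unop
  one_smul := grMul_one
  mul_smul s t m := (grMul_assoc m t.unop s.unop).symm
  smul_zero s := LinearMap.map_zero₂ (grMul I J) s.unop
  smul_add s m m' := LinearMap.map_add₂ (grMul I J) m m' s.unop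
  add_smul s t m := map_add (grMul I J m) s.unop t.unop
  zero_smul m := map_zero (grMul I J m)

instance : IsScalarTower k (GrRing I)ᵐᵒᵖ (GrMod I J) :=
  ⟨fun c s m => map_smul (grMul I J m) c s.unop⟩

/-- Left multiplication on `gr_I J` by an element `a` of `A` with `a J ⊆ J`, as a homomorphism of
right `gr_I A`-modules. -/
def grLeft (I : Submodule k A) [IsRightIdeal I] (a : A) (ha : ∀ x ∈ J, a * x ∈ J) :
    GrMod I J →ₗ[(GrRing I)ᵐᵒᵖ] GrMod I J where
  toFun := grLeftLin I a ha
  map_add' := map_add _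
  map_smul' s m := by
    have : (grMul I J).compr₂ (grLeftLin I a ha) = grMul I J ∘ₗ grLeftLin I a ha := by
      refine grHom_ext fun d x => grHom_ext fun e y => ?_
      rw [LinearMap.compr₂_apply, LinearMap.comp_apply, grLeftLin_mk, grMul_mk, grMul_mk,
        grLeftLin_mk]
      exact grMk_congr rfl _ _ (mul_assoc _ _ _).symm
    exact congr($this m s.unop)

end Graded

noncomputable section Tor

variable (k : Type u) [Field k] (R : Type w) [Ring R] [Algebra k R]

section Tensor

variable (M : Type*) [AddCommGroup M] [Module k M] [Module Rᵐᵒᵖ M]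
  (N : Type*) [AddCommGroup N] [Module k N] [Module R N]

/-- The relations `m r ⊗ n = m ⊗ r n`. -/
def balRel : Submodule k (M ⊗[k] N) :=
  Submodule.span k {t | ∃ (m : M) (s : R) (n : N),
    t = (MulOpposite.op s • m) ⊗ₜ[k] n - m ⊗ₜ[k] (s • n)}

/-- The tensor product `M ⊗_R N` of a right module `M` and a left module `N` over a
(noncommutative) `k`-algebra `R`. -/
abbrev BalTensor := (M ⊗[k] N) ⧸ balRel k R M N

variable {M N} {M' : Type*} [AddCommGroup M'] [Module k M'] [Module Rᵐᵒᵖ M']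
  {N' : Type*} [AddCommGroup N'] [Module k N'] [Module R N']
  [IsScalarTower k Rᵐᵒᵖ M] [IsScalarTower k R N] [IsScalarTower k Rᵐᵒᵖ M'] [IsScalarTower k R N']

variable {R}

/-- The map `f ⊗ g : M ⊗_R N → M' ⊗_R N'`. -/
def BalTensor.map (f : M →ₗ[Rᵐᵒᵖ] M') (g : N →ₗ[R] N') : BalTensor k R M N →ₗ[k] BalTensor k R M' N' :=
  Submodule.mapQ _ _ (TensorProduct.map (f.restrictScalars k) (g.restrictScalars k)) <| by
    rw [balRel, Submodule.span_le]
    rintro _ ⟨m, s, n, rfl⟩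
    refine Submodule.subset_span ⟨f m, s, g n, ?_⟩
    simp

theorem BalTensor.map_map {M'' : Type*} [AddCommGroup M''] [Module k M''] [Module Rᵐᵒᵖ M'']
    {N'' : Type*} [AddCommGroup N''] [Module k N''] [Module R N'']
    [IsScalarTower k Rᵐᵒᵖ M''] [IsScalarTower k R N'']
    (f : M →ₗ[Rᵐᵒᵖ] M') (g : N →ₗ[R] N') (f' : M' →ₗ[Rᵐᵒᵖ] M'') (g' : N' →ₗ[R] N'')
    (t : BalTensor k R M N) :
    BalTensor.map k f' g' (BalTensor.map k f g t) =
      BalTensor.map k (f' ∘ₗ f) (g' ∘ₗ g) t := by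
  obtain ⟨t, rfl⟩ := Submodule.mkQ_surjective _ t
  induction t using TensorProduct.induction_on with
  | zero => simp
  | tmul m n => rfl
  | add x y hx hy => simp only [map_add, hx, hy]

end Tensor

variable {R} (degR : ℤ → Submodule k R)

/-- A graded projective resolution `⋯ → X 1 → X 0 → N → 0` of the graded left `R`-module `N`
over the graded ring `R`. -/
structure GrRes (N : Type w) [AddCommGroup N] [Module k N] [Module R N]
    (degN : ℤ → Submodule k N) where
  X : ℕ → Type w
  [grp : ∀ i, AddCommGroup (X i)]
  [modk : ∀ i, Module k (X i)]
  [mod : ∀ i, Module R (X i)]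
  [tower : ∀ i, IsScalarTower k R (X i)]
  /-- the homogeneous components of the modules -/
  deg : ∀ i, ℤ → Submodule k (X i)
  isInternal : ∀ i, DirectSum.IsInternal (deg i)
  smul_mem : ∀ i (a b : ℤ) (s : R) (x : X i), s ∈ degR a → x ∈ deg i b → s • x ∈ deg i (a + b)
  projective : ∀ i, Module.Projective R (X i)
  d : ∀ i, X (i + 1) →ₗ[R] X i
  d_mem : ∀ i n x, x ∈ deg (i + 1) n → d i x ∈ deg i n
  aug : X 0 →ₗ[R] N
  aug_mem : ∀ n x, x ∈ deg 0 n → aug x ∈ degN n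
  aug_surjective : Function.Surjective aug
  exact_zero : Function.Exact (d 0) aug
  exact_succ : ∀ i, Function.Exact (d (i + 1)) (d i)

attribute [instance] GrRes.grp GrRes.modk GrRes.mod GrRes.tower

namespace GrRes

variable {k degR}
variable {N : Type w} [AddCommGroup N] [Module k N] [Module R N] {degN : ℤ → Submodule k N}
  {N' : Type w} [AddCommGroup N'] [Module k N'] [Module R N'] {degN' : ℤ → Submodule k N'}

/-- A graded chain map between resolutions that lifts a homomorphism `g : N → N'`. -/
structure Hom (p : GrRes k degR N degN) (q : GrRes k degR N' degN') (g : N →ₗ[R] N') where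
  f : ∀ i, p.X i →ₗ[R] q.X i
  f_mem : ∀ i n x, x ∈ p.deg i n → f i x ∈ q.deg i n
  comm : ∀ i, f i ∘ₗ p.d i = q.d i ∘ₗ f (i + 1)
  aug_comm : q.aug ∘ₗ f 0 = g ∘ₗ p.aug

variable (p : GrRes k degR N degN) (q : GrRes k degR N' degN')
  {M : Type*} [AddCommGroup M] [Module k M] [Module Rᵐᵒᵖ M] [IsScalarTower k Rᵐᵒᵖ M]
  (degM : ℤ → Submodule k M)
  {M' : Type*} [AddCommGroup M'] [Module k M'] [Module Rᵐᵒᵖ M'] [IsScalarTower k Rᵐᵒᵖ M']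
  (degM' : ℤ → Submodule k M')

variable (M) in
/-- The differential of the complex `M ⊗_R X`. -/
def bd (i : ℕ) : BalTensor k R M (p.X (i + 1)) →ₗ[k] BalTensor k R M (p.X i) :=
  BalTensor.map k LinearMap.id (p.d i)

variable (M) in
/-- The cycles of `M ⊗_R X`. -/
def cyc : (i : ℕ) → Submodule k (BalTensor k R M (p.X i))
  | 0 => ⊤
  | i + 1 => LinearMap.ker (p.bd M i)

variable (M) in
/-- `Tor_i^R(M, N)`, the homology of `M ⊗_R X` in degree `i`. -/
abbrev Tor (i : ℕ) := ↥(p.cyc M i) ⧸ (LinearMap.range (p.bd M i)).submoduleOf (p.cyc M i)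

/-- The part of `M ⊗_R X_i` of total internal degree `j`. -/
def chainDeg (i : ℕ) (j : ℤ) : Submodule k (BalTensor k R M (p.X i)) :=
  Submodule.span k {t | ∃ (a b : ℤ) (m : M) (x : p.X i), a + b = j ∧ m ∈ degM a ∧ x ∈ p.deg i b ∧
    t = Submodule.Quotient.mk (m ⊗ₜ[k] x)}

/-- The homogeneous component `Tor_i^R(M, N)_j`: the classes of the cycles of internal
degree `j`. -/
def torDeg (i : ℕ) (j : ℤ) : Submodule k (p.Tor M i) :=
  ((p.chainDeg degM i j).submoduleOf (p.cyc M i)).map (Submodule.mkQ _)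

variable {p q}

theorem map_mem_cyc (f : M →ₗ[Rᵐᵒᵖ] M') {g : N →ₗ[R] N'} (φ : p.Hom q g) (i : ℕ)
    (t : BalTensor k R M (p.X i)) (ht : t ∈ p.cyc M i) :
    BalTensor.map k f (φ.f i) t ∈ q.cyc M' i := by
  cases i with
  | zero => trivial
  | succ i =>
    have ht : BalTensor.map k LinearMap.id (p.d i) t = 0 := ht
    change BalTensor.map k LinearMap.id (q.d i) _ = 0
    rw [BalTensor.map_map, ← φ.comm, LinearMap.id_comp, ← LinearMap.comp_id f,
      ← BalTensor.map_map, ht, map_zero]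

/-- The homomorphism `Tor_i^R(M, N) → Tor_i^R(M', N')` induced by `f : M → M'` and `g : N → N'`,
computed with a lift `φ` of `g`. -/
def torMap (f : M →ₗ[Rᵐᵒᵖ] M') {g : N →ₗ[R] N'} (φ : p.Hom q g) (i : ℕ) :
    p.Tor M i →ₗ[k] q.Tor M' i :=
  Submodule.mapQ _ _ ((BalTensor.map k f (φ.f i)).restrict (map_mem_cyc f φ i)) <| by
    rintro ⟨_, h⟩ ⟨s, rfl⟩
    refine ⟨BalTensor.map k f (φ.f (i + 1)) s, ?_⟩
    change BalTensor.map k LinearMap.id (q.d i) _ =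
      BalTensor.map k f (φ.f i) (BalTensor.map k LinearMap.id (p.d i) s)
    rw [BalTensor.map_map, BalTensor.map_map, φ.comm]
    rfl

variable {degM degM'}

theorem torMap_mem (f : M →ₗ[Rᵐᵒᵖ] M') (hf : ∀ n m, m ∈ degM n → f m ∈ degM' n)
    {g : N →ₗ[R] N'} (φ : p.Hom q g) (i : ℕ) (j : ℤ) :
    ∀ t ∈ p.torDeg degM i j, torMap f φ i t ∈ q.torDeg degM' i j := by
  rintro _ ⟨t, ht, rfl⟩
  refine ⟨⟨BalTensor.map k f (φ.f i) t, map_mem_cyc f φ i _ t.2⟩, ?_, rfl⟩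
  have key : p.chainDeg degM i j ≤ (q.chainDeg degM' i j).comap (BalTensor.map k f (φ.f i)) := by
    rw [chainDeg, Submodule.span_le]
    rintro _ ⟨a, b, m, x, hab, hm, hx, rfl⟩
    exact Submodule.subset_span ⟨a, b, f m, φ.f i x, hab, hf a m hm, φ.f_mem i b x hx, rfl⟩
  exact key ht

/-- The map induced on the components of internal degree `j` by homomorphisms of graded
modules. -/
def torDegMap (f : M →ₗ[Rᵐᵒᵖ] M') (hf : ∀ n m, m ∈ degM n → f m ∈ degM' n)
    {g : N →ₗ[R] N'} (φ : p.Hom q g) (i : ℕ) (j : ℤ) :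
    ↥(p.torDeg degM i j) →ₗ[k] ↥(q.torDeg degM' i j) :=
  (torMap f φ i).restrict (torMap_mem f hf φ i j)

end GrRes

end Tor

noncomputable section Simplicial

variable {P : Type v} [PartialOrder P]

/-- An abstract simplicial complex all of whose faces are finite chains of the poset `P`, that is,
a subcomplex of the order complex of `P`. The complex without faces and the complex `{∅}` are both
allowed, and they are different. -/
structure ChainCx (P : Type v) [PartialOrder P] where
  faces : Set (Finset P)
  isChain : ∀ s ∈ faces, IsChain (· ≤ ·) (s : Set P)
  down_closed : ∀ s ∈ faces, ∀ t ⊆ s, t ∈ faces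

/-- The order complex of a subposet `S` of `P`. -/
def orderComplex (S : Set P) : ChainCx P where
  faces := {s | (s : Set P) ⊆ S ∧ IsChain (· ≤ ·) (s : Set P)}
  isChain _ hs := hs.2
  down_closed _ hs _ ht :=
    ⟨(Finset.coe_subset.2 ht).trans hs.1, hs.2.mono (Finset.coe_subset.2 ht)⟩

/-- The sequential layer `Δ^⟨j⟩`, generated by the faces of dimension at least `j`. -/
def ChainCx.layer (Δ : ChainCx P) (j : ℤ) : ChainCx P where
  faces := {s | ∃ t ∈ Δ.faces, s ⊆ t ∧ j ≤ (t.card : ℤ) - 1}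
  isChain := fun _ ⟨t, ht, hst, _⟩ => (Δ.isChain t ht).mono (Finset.coe_subset.2 hst)
  down_closed := fun _ ⟨t, ht, hst, hj⟩ _ hs => ⟨t, ht, hs.trans hst, hj⟩

variable (k : Type u) [Field k]

/-- The `k`-vector space with basis the finite subsets of `P`. -/
def FreeFin (P : Type v) : Type max u v := Finset P →₀ k

instance : AddCommGroup (FreeFin k P) := inferInstanceAs (AddCommGroup (Finset P →₀ k))
instance : Module k (FreeFin k P) := inferInstanceAs (Module k (Finset P →₀ k))

/-- The reduced simplicial chains `C_n(Δ; k)`, for `n ≥ -1`, on the faces of dimension `n`. -/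
def ChainCx.chains (Δ : ChainCx P) (n : ℤ) : Submodule k (FreeFin k P) :=
  Finsupp.supported k k {s | s ∈ Δ.faces ∧ (s.card : ℤ) - 1 = n}

open Classical in
/-- The simplicial boundary `∂ {x_0 < ⋯ < x_n} = ∑ (-1)^m {x_0 < ⋯ < x̂_m < ⋯ < x_n}`: each face is
oriented by the order of `P`, so the index `m` of a vertex `x` is the number of vertices
below `x`. -/
def bdry : FreeFin k P →ₗ[k] FreeFin k P :=
  Finsupp.linearCombination k fun s : Finset P =>
    ∑ x ∈ s, (-1 : k) ^ (s.filter (· < x)).card • (Finsupp.single (s.erase x) 1 : FreeFin k P)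

/-- The relative cycles: the `n`-chains of `Δ` with boundary in `Γ`. -/
def relCycles (Δ Γ : ChainCx P) (n : ℤ) : Submodule k (FreeFin k P) :=
  Δ.chains k n ⊓ (Γ.chains k (n - 1)).comap (bdry k)

/-- The relative boundaries: `n`-chains of `Γ` plus boundaries of `(n+1)`-chains of `Δ`. -/
def relBoundaries (Δ Γ : ChainCx P) (n : ℤ) : Submodule k (FreeFin k P) :=
  Γ.chains k n ⊔ (Δ.chains k (n + 1)).map (bdry k)

/-- The relative reduced simplicial homology `H̃_n(Δ, Γ; k)` of a subcomplex `Γ` of `Δ`, that is,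
the homology of the quotient complex `C(Δ; k) / C(Γ; k)`. -/
abbrev RelHomology (Δ Γ : ChainCx P) (n : ℤ) : Type max u v :=
  ↥(relCycles k Δ Γ n) ⧸ (relBoundaries k Δ Γ n).submoduleOf (relCycles k Δ Γ n)

end Simplicial

noncomputable section Concrete

variable (k : Type u) [Field k] {P : Type v} [PartialOrder P] (r : Setoid (NonemptyInterval P))

/-- The underlying space of the subalgebra `A_0` of `k[P]_red`, the span of the `ξ_[x,x]`. -/
def A0 : Submodule k (RedIncAlg k r) := Submodule.span k (Set.range fun e : Vtx r => xi k (idCls r e))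

/-- The two-sided ideal `I`, the span of the `ξ_[x,y]` with `x < y`. -/
def augIdeal : Submodule k (RedIncAlg k r) :=
  Submodule.span k {a | ∃ (x y : P) (h : x < y), a = xi k (cls r h.le)}

variable {r} in
/-- The subposet `(x, y)|_J` of the open interval `(x, y)`. -/
def restrictedInterval (J : Submodule k (RedIncAlg k r)) (x y : P) : Set P :=
  {z | ∃ h : x < z, z < y ∧ xi k (cls r h.le) ∈ J}

variable {k r} in
theorem xi_idCls_mem (e : Vtx r) : xi k (idCls r e) ∈ A0 k r := Submodule.subset_span ⟨e, rfl⟩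

variable [IncidenceLaws r]

variable {r} in
/-- A monomial right ideal: a right ideal contained in `I` that is generated by monomials. -/
class IsMonomialRightIdeal (J : Submodule k (RedIncAlg k r)) : Prop where
  generated : ∃ S : Set (Quotient r), J = Submodule.span k (xi k '' S) * ⊤
  le_augIdeal : J ≤ augIdeal k r

instance : IsRightIdeal (augIdeal k r) where
  mul_mem a ha b := by
    have : (augIdeal k r) ≤ (augIdeal k r).comap ((mulLin k r).flip b) := by
      rw [augIdeal, Submodule.span_le]
      rintro _ ⟨x, y, h, rfl⟩
      change xi k (cls r h.le) * b ∈ augIdeal k r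
      have hb : b ∈ (⊤ : Submodule k (RedIncAlg k r)) := trivial
      suffices H : ∀ β, xi k (cls r h.le) * xi k β ∈ augIdeal k r by
        have : (augIdeal k r).mkQ ∘ₗ mulLin k r (xi k (cls r h.le)) = 0 :=
          lhom_ext fun β => (Submodule.Quotient.mk_eq_zero _).2 (H β)
        exact (Submodule.Quotient.mk_eq_zero _).1 congr($this b)
      intro β
      rw [xi_mul_xi]
      by_cases hc : ∃ γ, Composes r (cls r h.le) β γ
      · obtain ⟨γ, hc⟩ := hc
        rw [mulXi_eq hc]
        obtain ⟨x', y', z', h1, h2, e1, rfl, rfl⟩ := hc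
        refine Submodule.subset_span ⟨x', z', lt_of_le_of_ne (h1.trans h2) ?_, rfl⟩
        rintro rfl
        obtain rfl : x' = y' := le_antisymm h1 h2
        exact h.ne (eq_of_cls_eq_refl h.le e1.symm)
      · rw [mulXi_eq_zero hc]; exact zero_mem _
    exact this ha

variable {k r}

instance (J : Submodule k (RedIncAlg k r)) [h : IsMonomialRightIdeal k J] : IsRightIdeal J where
  mul_mem x hx a := by
    obtain ⟨S, rfl⟩ := h.generated
    have := Submodule.mul_mem_mul hx (Submodule.mem_top (x := a) (R := k))
    rw [mul_assoc] at this
    exact mul_le_mul_right (le_top (a := (⊤ : Submodule k (RedIncAlg k r)) * ⊤)) _ this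

theorem A0_mul_mem (J : Submodule k (RedIncAlg k r)) [h : IsMonomialRightIdeal k J]
    {a : RedIncAlg k r} (ha : a ∈ A0 k r) : ∀ x ∈ J, a * x ∈ J := by
  classical
  obtain ⟨S, rfl⟩ := h.generated
  intro x hx
  have : A0 k r * Submodule.span k (xi k '' S) ≤ Submodule.span k (xi k '' S) := by
    rw [A0, Submodule.span_mul_span, Submodule.span_le]
    rintro _ ⟨_, ⟨e, rfl⟩, _, ⟨α, hα, rfl⟩, rfl⟩
    change xi k (idCls r e) * xi k α ∈ _
    rw [idem_mul_xi]
    split_ifs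
    · exact Submodule.subset_span ⟨α, hα, rfl⟩
    · exact zero_mem _
  have h2 := Submodule.mul_mem_mul ha hx
  rw [← mul_assoc] at h2
  exact mul_le_mul_left this _ h2

theorem A0_comm {a : RedIncAlg k r} (ha : a ∈ A0 k r) (e : Vtx r) :
    a * xi k (idCls r e) = xi k (idCls r e) * a := by
  classical
  induction ha using Submodule.span_induction with
  | mem x hx =>
    obtain ⟨e', rfl⟩ := hx
    dsimp only
    by_cases h : e = e'
    · rw [h]
    have hs : ∀ e : Vtx r, src r (idCls r e) = e := by rintro ⟨e⟩; rfl
    rw [idem_mul_xi, idem_mul_xi, if_neg, if_neg]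
    · rwa [hs]
    · rw [hs]; exact fun h' => h h'.symm
  | zero => simp
  | add x y _ _ hx hy => rw [add_mul, mul_add, hx, hy]
  | smul c x _ hx => rw [smul_mul_assoc, mul_smul_comm, hx]

variable (k r)

/-- The graded ring `R = gr_I k[P]_red`. -/
abbrev GrAlg : Type max u v := GrRing (augIdeal k r)

/-- The ideal `𝔪 = ⨁_{d > 0} R_d`. -/
def irrel : Ideal (GrAlg k r) :=
  Ideal.span {s | ∃ n : ℤ, 0 < n ∧ s ∈ ringDeg (augIdeal k r) n}

/-- The left `R`-module `A_0 = R_0 = R / 𝔪`. -/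
abbrev A0Mod : Type max u v := GrAlg k r ⧸ irrel k r

/-- The grading of a module that is concentrated in degree `0`. -/
def zeroDeg (N : Type*) [AddCommGroup N] [Module k N] (n : ℤ) : Submodule k N :=
  if n = 0 then ⊤ else ⊥

theorem irrel_mul (a : RedIncAlg k r) : irrel k r ≤ Submodule.comap
    (LinearMap.toSpanSingleton (GrAlg k r) (GrAlg k r) (grOf (augIdeal k r) a)) (irrel k r) := by
  nth_rw 1 [irrel]
  rw [Ideal.span, Submodule.span_le]
  rintro s ⟨n, hn, hs⟩
  change LinearMap.toSpanSingleton (GrAlg k r) (GrAlg k r) (grOf (augIdeal k r) a) s ∈ irrel k r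
  refine Submodule.subset_span ⟨n, hn, ?_⟩
  have : grDeg (augIdeal k r) ⊤ n ≤
      (grDeg (augIdeal k r) ⊤ n).comap ((grMul (augIdeal k r) ⊤).flip (grOf₀ (augIdeal k r) a)) := by
    refine iSup₂_le fun d hd => ?_
    rintro _ ⟨x, rfl⟩
    rw [Submodule.mem_comap, LinearMap.flip_apply, grOf₀, grMul_mk, ← hd]
    exact grMk_mem (d + 0) _
  exact this hs

/-- Right multiplication by `a` on the left `R`-module `A_0`. -/
def rightMul (a : RedIncAlg k r) : A0Mod k r →ₗ[GrAlg k r] A0Mod k r :=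
  Submodule.mapQ _ _ (LinearMap.toSpanSingleton _ _ (grOf (augIdeal k r) a)) (irrel_mul k r a)

/-- The left `R`-module `k_y = A_0 ξ_y`. -/
def kMod (y : Vtx r) : Submodule (GrAlg k r) (A0Mod k r) :=
  Submodule.span _ {Submodule.Quotient.mk (grOf (augIdeal k r) (xi k (idCls r y)))}

variable {k r}

theorem grOf_mul (a b : RedIncAlg k r) :
    grOf (augIdeal k r) a * grOf (augIdeal k r) b = grOf (augIdeal k r) (a * b) :=
  grMul_mk 0 0 _ _

theorem rightMul_mem {a : RedIncAlg k r} (ha : a ∈ A0 k r) (y : Vtx r) :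
    ∀ t ∈ kMod k r y, rightMul k r a t ∈ kMod k r y := by
  intro t ht
  obtain ⟨s, rfl⟩ := Submodule.mem_span_singleton.1 ht
  rw [map_smul]
  refine Submodule.smul_mem _ _ (Submodule.mem_span_singleton.2 ⟨grOf (augIdeal k r) a, ?_⟩)
  change Submodule.Quotient.mk (grOf (augIdeal k r) a * grOf (augIdeal k r) (xi k (idCls r y))) =
    Submodule.Quotient.mk (grOf (augIdeal k r) (xi k (idCls r y)) * grOf (augIdeal k r) a)
  rw [grOf_mul, grOf_mul, A0_comm ha]

/-- Right multiplication by `a ∈ A_0` on the left `R`-module `k_y`. -/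
def rightMulK (a : A0 k r) (y : Vtx r) : kMod k r y →ₗ[GrAlg k r] kMod k r y :=
  (rightMul k r a).restrict (rightMul_mem a.2 y)

variable (J : Submodule k (RedIncAlg k r)) [IsMonomialRightIdeal k J]

/-- Left multiplication by `a ∈ A_0` on the right `R`-module `gr_I J`. -/
def leftMul (a : A0 k r) :
    GrMod (augIdeal k r) J →ₗ[(GrAlg k r)ᵐᵒᵖ] GrMod (augIdeal k r) J :=
  grLeft (augIdeal k r) (a : RedIncAlg k r) (A0_mul_mem J a.2)

theorem leftMul_deg (a : A0 k r) (n : ℤ) (m : GrMod (augIdeal k r) J)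
    (hm : m ∈ grDeg (augIdeal k r) J n) : leftMul J a m ∈ grDeg (augIdeal k r) J n := by
  have : grDeg (augIdeal k r) J n ≤ (grDeg (augIdeal k r) J n).comap
      (grLeftLin (augIdeal k r) (a : RedIncAlg k r) (A0_mul_mem J a.2)) := by
    refine iSup₂_le fun d hd => ?_
    rintro _ ⟨x, rfl⟩
    rw [Submodule.mem_comap, grLeftLin_mk, ← hd]
    exact grMk_mem d _
  exact this hm

/-- The right `R`-module `ξ_x gr_I J`. -/
def idemPart (x : Vtx r) : Submodule (GrAlg k r)ᵐᵒᵖ (GrMod (augIdeal k r) J) :=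
  LinearMap.range (leftMul J ⟨xi k (idCls r x), xi_idCls_mem x⟩)

/-- The grading of `ξ_x gr_I J` induced by that of `gr_I J`. -/
def idemDeg (x : Vtx r) (n : ℤ) : Submodule k (idemPart J x) :=
  (grDeg (augIdeal k r) J n).comap ((idemPart J x).subtype.restrictScalars k)

theorem leftMul_comm (a : A0 k r) (x : Vtx r) (m : GrMod (augIdeal k r) J) :
    leftMul J a (leftMul J ⟨xi k (idCls r x), xi_idCls_mem x⟩ m) =
      leftMul J ⟨xi k (idCls r x), xi_idCls_mem x⟩ (leftMul J a m) := by
  have : grLeftLin (augIdeal k r) (a : RedIncAlg k r) (A0_mul_mem J a.2) ∘ₗ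
      grLeftLin (augIdeal k r) (xi k (idCls r x)) (A0_mul_mem J (xi_idCls_mem x)) =
      grLeftLin (augIdeal k r) (xi k (idCls r x)) (A0_mul_mem J (xi_idCls_mem x)) ∘ₗ
      grLeftLin (augIdeal k r) (a : RedIncAlg k r) (A0_mul_mem J a.2) := by
    refine grHom_ext fun d y => ?_
    rw [LinearMap.comp_apply, LinearMap.comp_apply, grLeftLin_mk, grLeftLin_mk, grLeftLin_mk,
      grLeftLin_mk]
    refine grMk_congr rfl _ _ ?_
    simp only [← mul_assoc, A0_comm a.2]
  exact congr($this m)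

/-- Left multiplication by `a ∈ A_0` on the right `R`-module `ξ_x gr_I J`. -/
def leftMulIdem (a : A0 k r) (x : Vtx r) : idemPart J x →ₗ[(GrAlg k r)ᵐᵒᵖ] idemPart J x :=
  (leftMul J a).restrict <| by
    rintro _ ⟨m, rfl⟩
    exact ⟨leftMul J a m, (leftMul_comm J a x m).symm⟩

theorem leftMulIdem_deg (a : A0 k r) (x : Vtx r) (n : ℤ) (m : idemPart J x)
    (hm : m ∈ idemDeg J x n) : leftMulIdem J a x m ∈ idemDeg J x n :=
  leftMul_deg J a n m hm

end Concrete
end RedInc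

open RedInc

set_option linter.unusedSectionVars false

/-! Everything reduces to the combinatorics of classes of intervals. For a monomial right ideal J,
each J I^d is spanned by monomials, so gr_I J has as a basis the classes of the monomials in J; the
class of ξ_α sits in degree `rk`, the largest d with ξ_α ∈ J I^d. Ranks are superadditive under
composition (`rk_add_le`), and in the graded product ξ_α ξ_β is ξ_γ if the rank of the composite γ
is the sum of the two ranks, and 0 otherwise. The case J = A describes R itself.

The module k_y has a normalized bar resolution over R (`barRes`): X_i has as a basis the words of i
+ 1 composable classes ending at y in which only the first letter may be an identity. Prefixing an
identity is a contracting homotopy (`barHtpy_word`). After tensoring with ξ_x gr_I J, the basis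
consists of the words whose first letter lies in J and has source x, and the differential merges
adjacent letters with alternating signs, keeping only the merges that preserve the degree.

By invariance and concatenation, such a word is the same thing as a flag x < z_1 < ⋯ < z_i < y in
the chosen representative of its composite class α, with the class of [x, z_1] in J
(`exists_flag_of_mem_modWordsDeg`, `flagWord_injective`). That is a face of Δ_α of dimension i - 1,
the empty face being the one-letter word. Merging two letters deletes a vertex. The degree of the
word is the length of a longest flag of (x, y)|_J containing the given one, so the face lies in
Δ_α^⟨j-1⟩ if and only if the degree is at least j, and in Δ_α^⟨j⟩ if and only if it exceeds j
(`toFinset_mem_layer_iff`). Words of degree j are therefore a basis of the relative chains, and the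
merges that vanish in the graded product are exactly the boundary faces that fall into Δ_α^⟨j⟩
(`barBd_faceWord`).

The bimodule decomposition is formal: 1 is the sum of the orthogonal idempotents ξ_x, these split
gr_I J and A_0, and Tor is additive in both variables. Maps on Tor do not depend on the chosen lifts
(`torMap_congr`), which gives both the compatibility with the A_0-actions and the freedom to use
arbitrary graded projective resolutions. -/

namespace RedInc
-- Balanced tensor products, graded lifts between resolutions, and functoriality of Tor.
noncomputable section GenericTor

section Tensor

variable {k : Type u} [Field k] {R : Type w} [Ring R] [Algebra k R]
variable {M : Type*} [AddCommGroup M] [Module k M] [Module Rᵐᵒᵖ M]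
  {N : Type*} [AddCommGroup N] [Module k N] [Module R N]
  {M' : Type*} [AddCommGroup M'] [Module k M'] [Module Rᵐᵒᵖ M']
  {N' : Type*} [AddCommGroup N'] [Module k N'] [Module R N']

theorem BalTensor.hom_ext {W : Type*} [AddCommMonoid W] [Module k W]
    {f g : BalTensor k R M N →ₗ[k] W}
    (h : ∀ (m : M) (n : N), f (Submodule.Quotient.mk (m ⊗ₜ[k] n)) =
      g (Submodule.Quotient.mk (m ⊗ₜ[k] n))) : f = g := by
  refine LinearMap.ext fun t => ?_
  obtain ⟨t, rfl⟩ := Submodule.mkQ_surjective _ t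
  induction t using TensorProduct.induction_on with
  | zero => simp only [map_zero]
  | tmul m n => exact h m n
  | add x y hx hy => simp only [map_add, hx, hy]

theorem BalTensor.mk_smul (m : M) (s : R) (n : N) :
    (Submodule.Quotient.mk ((MulOpposite.op s • m) ⊗ₜ[k] n) : BalTensor k R M N) =
      Submodule.Quotient.mk (m ⊗ₜ[k] (s • n)) :=
  (Submodule.Quotient.eq _).2 (Submodule.subset_span ⟨m, s, n, rfl⟩)

/-- The map out of `M ⊗_R N` given by a balanced bilinear map. -/
def BalTensor.lift {W : Type*} [AddCommGroup W] [Module k W] (f : M →ₗ[k] N →ₗ[k] W)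
    (h : ∀ m (s : R) n, f (MulOpposite.op s • m) n = f m (s • n)) : BalTensor k R M N →ₗ[k] W :=
  Submodule.liftQ _ (TensorProduct.lift f) <| by
    rw [balRel, Submodule.span_le]
    rintro _ ⟨m, s, n, rfl⟩
    simp [h]

variable [IsScalarTower k Rᵐᵒᵖ M] [IsScalarTower k R N] [IsScalarTower k Rᵐᵒᵖ M']
  [IsScalarTower k R N']

theorem BalTensor.map_mk (f : M →ₗ[Rᵐᵒᵖ] M') (g : N →ₗ[R] N') (m : M) (n : N) :
    BalTensor.map k f g (Submodule.Quotient.mk (m ⊗ₜ[k] n)) =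
      Submodule.Quotient.mk (f m ⊗ₜ[k] g n) := rfl

theorem BalTensor.map_add_left (f f' : M →ₗ[Rᵐᵒᵖ] M') (g : N →ₗ[R] N') :
    BalTensor.map k (f + f') g = BalTensor.map k f g + BalTensor.map k f' g :=
  BalTensor.hom_ext fun m n => by
    simp only [LinearMap.add_apply, BalTensor.map_mk, TensorProduct.add_tmul,
      Submodule.Quotient.mk_add]

theorem BalTensor.map_add_right (f : M →ₗ[Rᵐᵒᵖ] M') (g g' : N →ₗ[R] N') :
    BalTensor.map k f (g + g') = BalTensor.map k f g + BalTensor.map k f g' :=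
  BalTensor.hom_ext fun m n => by
    simp only [LinearMap.add_apply, BalTensor.map_mk, TensorProduct.tmul_add,
      Submodule.Quotient.mk_add]

theorem BalTensor.map_zero_right (f : M →ₗ[Rᵐᵒᵖ] M') :
    BalTensor.map k f (0 : N →ₗ[R] N') = 0 :=
  BalTensor.hom_ext fun m n => by
    simp only [LinearMap.zero_apply, BalTensor.map_mk, TensorProduct.tmul_zero,
      Submodule.Quotient.mk_zero]

theorem BalTensor.map_zero_left (g : N →ₗ[R] N') :
    BalTensor.map k (0 : M →ₗ[Rᵐᵒᵖ] M') g = 0 :=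
  BalTensor.hom_ext fun m n => by
    simp only [LinearMap.zero_apply, BalTensor.map_mk, TensorProduct.zero_tmul,
      Submodule.Quotient.mk_zero]

theorem BalTensor.map_id_id :
    BalTensor.map k (LinearMap.id : M →ₗ[Rᵐᵒᵖ] M) (LinearMap.id : N →ₗ[R] N) = LinearMap.id :=
  BalTensor.hom_ext fun _ _ => rfl

theorem BalTensor.map_sum_left {ι : Type*} (s : Finset ι) (f : ι → M →ₗ[Rᵐᵒᵖ] M')
    (g : N →ₗ[R] N') : BalTensor.map k (∑ a ∈ s, f a) g = ∑ a ∈ s, BalTensor.map k (f a) g := by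
  classical
  induction s using Finset.induction_on with
  | empty => simp only [Finset.sum_empty, BalTensor.map_zero_left]
  | insert a s ha ih => rw [Finset.sum_insert ha, Finset.sum_insert ha, map_add_left, ih]

theorem BalTensor.map_sum_right {ι : Type*} (s : Finset ι) (f : M →ₗ[Rᵐᵒᵖ] M')
    (g : ι → N →ₗ[R] N') : BalTensor.map k f (∑ a ∈ s, g a) = ∑ a ∈ s, BalTensor.map k f (g a) := by
  classical
  induction s using Finset.induction_on with
  | empty => simp only [Finset.sum_empty, BalTensor.map_zero_right]
  | insert a s ha ih => rw [Finset.sum_insert ha, Finset.sum_insert ha, map_add_right, ih]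

end Tensor

namespace GrRes

variable {k : Type u} [Field k] {R : Type w} [Ring R] [Algebra k R] {degR : ℤ → Submodule k R}
variable {N : Type w} [AddCommGroup N] [Module k N] [Module R N] {degN : ℤ → Submodule k N}
  {N' : Type w} [AddCommGroup N'] [Module k N'] [Module R N'] {degN' : ℤ → Submodule k N'}
  {N'' : Type w} [AddCommGroup N''] [Module k N''] [Module R N''] {degN'' : ℤ → Submodule k N''}
  {p : GrRes k degR N degN} {q : GrRes k degR N' degN'} {p' : GrRes k degR N'' degN''}

section Hom

/-- The identity lift. -/
def Hom.id (p : GrRes k degR N degN) : p.Hom p LinearMap.id where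
  f _ := LinearMap.id
  f_mem _ _ _ h := h
  comm _ := rfl
  aug_comm := rfl

/-- The composite of two lifts. -/
def Hom.comp {g : N →ₗ[R] N'} {g' : N' →ₗ[R] N''} (ψ : q.Hom p' g') (φ : p.Hom q g) :
    p.Hom p' (g' ∘ₗ g) where
  f i := ψ.f i ∘ₗ φ.f i
  f_mem i n x h := ψ.f_mem i n _ (φ.f_mem i n x h)
  comm i := by rw [LinearMap.comp_assoc, φ.comm, ← LinearMap.comp_assoc, ψ.comm]; rfl
  aug_comm := by rw [← LinearMap.comp_assoc, ψ.aug_comm, LinearMap.comp_assoc, φ.aug_comm]; rfl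

/-- The sum of finitely many lifts. -/
def Hom.sum {ι : Type*} (s : Finset ι) {g : ι → N →ₗ[R] N'} (φ : ∀ a, p.Hom q (g a)) :
    p.Hom q (∑ a ∈ s, g a) where
  f i := ∑ a ∈ s, (φ a).f i
  f_mem i n x h := by
    rw [LinearMap.sum_apply]
    exact sum_mem fun a _ => (φ a).f_mem i n x h
  comm i := by
    ext x
    simp only [LinearMap.comp_apply, LinearMap.sum_apply, map_sum]
    exact Finset.sum_congr rfl fun a _ => congr($((φ a).comm i) x)
  aug_comm := by
    ext x
    simp only [LinearMap.comp_apply, LinearMap.sum_apply, map_sum]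
    exact Finset.sum_congr rfl fun a _ => congr($((φ a).aug_comm) x)

/-- Projectivity lifts along surjections, so `v` is first restricted to its range. The hypothesis is
stated pointwise because exactness supplies preimages in this form. -/
theorem exists_lift {X Y Z : Type*} [AddCommGroup X] [Module R X] [Module.Projective R X]
    [AddCommGroup Y] [Module R Y] [AddCommGroup Z] [Module R Z]
    (u : X →ₗ[R] Z) (v : Y →ₗ[R] Z) (h : ∀ x, ∃ y, v y = u x) : ∃ f : X →ₗ[R] Y, v ∘ₗ f = u := by
  obtain ⟨f, hf⟩ := Module.projective_lifting_property v.rangeRestrict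
    (u.codRestrict (LinearMap.range v) fun x => h x) v.surjective_rangeRestrict
  exact ⟨f, LinearMap.ext fun x => congrArg Subtype.val congr($hf x)⟩

/-- The two lifts agree after augmentation, so their difference lands in the image of `q.d 0`. No
grading of the homotopy is needed, since it only serves to compare the induced maps on the whole of
Tor. -/
theorem homotopy_zero {g : N →ₗ[R] N'} (φ φ' : p.Hom q g) :
    ∃ s : p.X 0 →ₗ[R] q.X 1, φ.f 0 = φ'.f 0 + q.d 0 ∘ₗ s := by
  have := p.projective 0
  obtain ⟨s, hs⟩ := exists_lift (φ.f 0 - φ'.f 0) (q.d 0) fun x => (q.exact_zero _).1 <| by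
    rw [LinearMap.sub_apply, map_sub, sub_eq_zero]
    exact congr($(φ.aug_comm.trans φ'.aug_comm.symm) x)
  exact ⟨s, by rw [hs]; abel⟩

theorem d_d (p : GrRes k degR N degN) (i : ℕ) (x) : p.d i (p.d (i + 1) x) = 0 :=
  (p.exact_succ i _).2 ⟨x, rfl⟩

theorem homotopy_succ {g : N →ₗ[R] N'} (φ φ' : p.Hom q g) (i : ℕ) :
    ∃ (s : p.X (i + 1) →ₗ[R] q.X (i + 2)) (s' : p.X i →ₗ[R] q.X (i + 1)),
      φ.f (i + 1) = φ'.f (i + 1) + (q.d (i + 1) ∘ₗ s + s' ∘ₗ p.d i) := by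
  induction i with
  | zero =>
    obtain ⟨s', hs'⟩ := homotopy_zero φ φ'
    have := p.projective 1
    obtain ⟨s, hs⟩ := exists_lift (φ.f 1 - φ'.f 1 - s' ∘ₗ p.d 0) (q.d 1) fun x =>
      (q.exact_succ 0 _).1 <| by
        have h1 : φ.f 0 (p.d 0 x) = q.d 0 (φ.f 1 x) := congr($(φ.comm 0) x)
        have h2 : φ'.f 0 (p.d 0 x) = q.d 0 (φ'.f 1 x) := congr($(φ'.comm 0) x)
        have h3 := congr($hs' (p.d 0 x))
        simp only [LinearMap.add_apply, LinearMap.comp_apply] at h3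
        simp only [LinearMap.sub_apply, LinearMap.comp_apply, map_sub, ← h1, ← h2, h3]
        abel
    exact ⟨s, s', by rw [hs]; abel⟩
  | succ i ih =>
    obtain ⟨s', s'', hs'⟩ := ih
    have := p.projective (i + 2)
    obtain ⟨s, hs⟩ := exists_lift (φ.f (i + 2) - φ'.f (i + 2) - s' ∘ₗ p.d (i + 1)) (q.d (i + 2))
      fun x => (q.exact_succ (i + 1) _).1 <| by
        have h1 : φ.f (i + 1) (p.d (i + 1) x) = q.d (i + 1) (φ.f (i + 2) x) :=
          congr($(φ.comm (i + 1)) x)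
        have h2 : φ'.f (i + 1) (p.d (i + 1) x) = q.d (i + 1) (φ'.f (i + 2) x) :=
          congr($(φ'.comm (i + 1)) x)
        -- Evaluated on a boundary, the `s''` term of the previous homotopy vanishes because d² = 0;
        -- what remains says that the corrected difference is a cycle.
        have h3 := congr($hs' (p.d (i + 1) x))
        simp only [LinearMap.add_apply, LinearMap.comp_apply, d_d, map_zero, add_zero] at h3
        simp only [LinearMap.sub_apply, LinearMap.comp_apply, map_sub, ← h1, ← h2, h3]
        abel
    exact ⟨s, s', by rw [hs]; abel⟩

end Hom

section Existence

/-- The projections onto the components of an internal direct sum. -/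
theorem exists_proj {k : Type*} [Ring k] {Y : Type*} [AddCommGroup Y] [Module k Y]
    {degY : ℤ → Submodule k Y} (hY : DirectSum.IsInternal degY) :
    ∃ π : ℤ → Y →ₗ[k] Y, (∀ n y, π n y ∈ degY n) ∧ (∀ n y, y ∈ degY n → π n y = y) ∧
      (∀ n m y, y ∈ degY m → m ≠ n → π n y = 0) ∧ ∀ n y, y - π n y ∈ ⨆ m ≠ n, degY m := by
  classical
  let dec : DirectSum.Decomposition degY := hY.chooseDecomposition
  refine ⟨fun n => (degY n).subtype ∘ₗ DirectSum.component k ℤ (fun n => degY n) n ∘ₗ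
    (DirectSum.decomposeLinearEquiv degY).toLinearMap, fun n y => Subtype.prop _,
    fun n y hy => DirectSum.decompose_of_mem_same degY hy,
    fun n m y hy h => DirectSum.decompose_of_mem_ne degY hy h, fun n y => ?_⟩
  change y - (DirectSum.decompose degY y n : Y) ∈ _
  have hy : y ∈ ⨆ n, degY n := by rw [hY.submodule_iSup_eq_top]; trivial
  induction hy using Submodule.iSup_induction' with
  | mem m y hy =>
    by_cases h : m = n
    · subst h
      rw [DirectSum.decompose_of_mem_same degY hy, sub_self]
      exact zero_mem _
    · rw [DirectSum.decompose_of_mem_ne degY hy h, sub_zero]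
      exact Submodule.mem_iSup_of_mem m (Submodule.mem_iSup_of_mem h hy)
  | zero => simp
  | add y z _ _ hy hz =>
    rw [DirectSum.decompose_add]
    have := add_mem hy hz
    rwa [sub_add_sub_comm] at this

/-- A homomorphism of modules from a graded projective module can be lifted in a graded way. -/
theorem exists_graded_lift (hR : ⨆ n, degR n = ⊤)
    {X Y Z : Type*} [AddCommGroup X] [Module k X] [Module R X] [IsScalarTower k R X]
    [Module.Projective R X] [AddCommGroup Y] [Module k Y] [Module R Y] [IsScalarTower k R Y]
    [AddCommGroup Z] [Module k Z] [Module R Z]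
    {degX : ℤ → Submodule k X} {degY : ℤ → Submodule k Y} {degZ : ℤ → Submodule k Z}
    (hX : DirectSum.IsInternal degX) (hY : DirectSum.IsInternal degY) (hZ : iSupIndep degZ)
    (sX : ∀ (a b : ℤ) (s : R) (x : X), s ∈ degR a → x ∈ degX b → s • x ∈ degX (a + b))
    (sY : ∀ (a b : ℤ) (s : R) (x : Y), s ∈ degR a → x ∈ degY b → s • x ∈ degY (a + b))
    (u : X →ₗ[R] Z) (v : Y →ₗ[R] Z) (hu : ∀ n x, x ∈ degX n → u x ∈ degZ n)
    (hv : ∀ n x, x ∈ degY n → v x ∈ degZ n) (h : ∀ x, ∃ y, v y = u x) :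
    ∃ f : X →ₗ[R] Y, v ∘ₗ f = u ∧ ∀ n x, x ∈ degX n → f x ∈ degY n := by
  classical
  -- Start from a lift that ignores the grading and keep, on the component of degree n, only the
  -- degree n part of its values. The result is still linear over R, and it still lifts `u` because
  -- `u` and `v` are graded.
  obtain ⟨f₀, hf₀⟩ := exists_lift u v h
  obtain ⟨π, hπ, hπs, hπn, hπd⟩ := exists_proj hY
  have topX := hX.submodule_iSup_eq_top
  have topY := hY.submodule_iSup_eq_top
  have smulπ : ∀ (a b : ℤ) (s : R) (y : Y), s ∈ degR a → π (a + b) (s • y) = s • π b y := by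
    intro a b s y hs
    have hy : y ∈ ⨆ n, degY n := by rw [topY]; trivial
    induction hy using Submodule.iSup_induction' with
    | mem m y hy =>
      by_cases hm : m = b
      · subst hm
        rw [hπs m y hy, hπs _ _ (sY a m s y hs hy)]
      · rw [hπn b m y hy hm, hπn _ _ _ (sY a m s y hs hy) (by simpa using hm), smul_zero]
    | zero => simp
    | add y z _ _ hy hz => simp only [smul_add, map_add, hy, hz]
  -- If v y is homogeneous of degree n, then v (y - π n y) lies both in degree n and in the sum of
  -- the other degrees; it is zero by independence of the components of Z.
  have vπ : ∀ n y, v y ∈ degZ n → v (π n y) = v y := by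
    intro n y hy
    have h1 : v (y - π n y) ∈ degZ n := by
      rw [map_sub]; exact sub_mem hy (hv n _ (hπ n y))
    have h2 : v (y - π n y) ∈ ⨆ m ≠ n, degZ m := by
      have key : ∀ t ∈ ⨆ m ≠ n, degY m, v t ∈ ⨆ m ≠ n, degZ m := by
        intro t ht
        induction ht using Submodule.iSup_induction' with
        | mem m t ht =>
          by_cases hm : m ≠ n
          · rw [iSup_pos hm] at ht
            exact Submodule.mem_iSup_of_mem m (Submodule.mem_iSup_of_mem hm (hv m t ht))
          · rw [iSup_neg hm, Submodule.mem_bot] at ht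
            rw [ht, map_zero]; exact zero_mem _
        | zero => rw [map_zero]; exact zero_mem _
        | add a b _ _ ha hb => rw [map_add]; exact add_mem ha hb
      exact key _ (hπd n y)
    have := (Submodule.disjoint_def.1 (hZ n)) _ h1 h2
    rw [map_sub, sub_eq_zero] at this
    exact this.symm
  let dec : DirectSum.Decomposition degX := hX.chooseDecomposition
  let f₁ : X →ₗ[k] Y := DirectSum.toModule k ℤ Y
    (fun n => π n ∘ₗ f₀.restrictScalars k ∘ₗ (degX n).subtype) ∘ₗ
    (DirectSum.decomposeLinearEquiv degX).toLinearMap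
  have hf₁ : ∀ n x, x ∈ degX n → f₁ x = π n (f₀ x) := by
    intro n x hx
    change DirectSum.toModule k ℤ Y _ (DirectSum.decompose degX x) = _
    rw [DirectSum.decompose_of_mem degX hx, ← DirectSum.lof_eq_of k, DirectSum.toModule_lof]
    rfl
  have smulf : ∀ (s : R) (x : X), f₁ (s • x) = s • f₁ x := by
    intro s x
    have hs : s ∈ ⨆ n, degR n := by rw [hR]; trivial
    have hx : x ∈ ⨆ n, degX n := by rw [topX]; trivial
    induction hs using Submodule.iSup_induction' with
    | mem a s hs =>
      induction hx using Submodule.iSup_induction' with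
      | mem b x hx =>
        rw [hf₁ b x hx, hf₁ _ _ (sX a b s x hs hx), map_smul, smulπ a b s _ hs]
      | zero => simp
      | add y z _ _ hy hz => simp only [smul_add, map_add, hy, hz]
    | zero => simp
    | add y z _ _ hy hz => simp only [add_smul, map_add, hy, hz]
  refine ⟨{ toFun := f₁, map_add' := map_add f₁, map_smul' := smulf }, ?_, ?_⟩
  · ext x
    change v (f₁ x) = u x
    have hx : x ∈ ⨆ n, degX n := by rw [topX]; trivial
    induction hx using Submodule.iSup_induction' with
    | mem b x hx =>
      have h1 : v (f₀ x) = u x := congr($hf₀ x)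
      rw [hf₁ b x hx, vπ b _ (by rw [h1]; exact hu b x hx), h1]
    | zero => simp
    | add y z _ _ hy hz => simp only [map_add, hy, hz]
  · intro n x hx
    change f₁ x ∈ _
    rw [hf₁ n x hx]
    exact hπ _ _

/-- Every graded homomorphism has a graded lift to the resolutions. -/
theorem exists_hom (hR : ⨆ n, degR n = ⊤) (hN : iSupIndep degN') (p : GrRes k degR N degN)
    (q : GrRes k degR N' degN') (g : N →ₗ[R] N') (hg : ∀ n x, x ∈ degN n → g x ∈ degN' n) :
    Nonempty (p.Hom q g) := by
  have step0 : ∃ f : p.X 0 →ₗ[R] q.X 0, q.aug ∘ₗ f = g ∘ₗ p.aug ∧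
      ∀ n x, x ∈ p.deg 0 n → f x ∈ q.deg 0 n :=
    have := p.projective 0
    exists_graded_lift hR (p.isInternal 0) (q.isInternal 0) hN (p.smul_mem 0) (q.smul_mem 0)
      (g ∘ₗ p.aug) q.aug (fun n x hx => hg n _ (p.aug_mem n x hx)) q.aug_mem
      fun x => q.aug_surjective _
  have step1 : ∀ (f : p.X 0 →ₗ[R] q.X 0), (q.aug ∘ₗ f = g ∘ₗ p.aug ∧
      ∀ n x, x ∈ p.deg 0 n → f x ∈ q.deg 0 n) → ∃ f' : p.X 1 →ₗ[R] q.X 1,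
        q.d 0 ∘ₗ f' = f ∘ₗ p.d 0 ∧ ∀ n x, x ∈ p.deg 1 n → f' x ∈ q.deg 1 n := by
    intro f hf
    have := p.projective 1
    refine exists_graded_lift hR (p.isInternal 1) (q.isInternal 1)
      (q.isInternal 0).submodule_iSupIndep (p.smul_mem 1) (q.smul_mem 1)
      (f ∘ₗ p.d 0) (q.d 0) (fun n x hx => hf.2 n _ (p.d_mem 0 n x hx)) (q.d_mem 0) fun x =>
        (q.exact_zero _).1 ?_
    have := congr($(hf.1) (p.d 0 x))
    simp only [LinearMap.comp_apply] at this ⊢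
    rw [this, (p.exact_zero _).2 ⟨x, rfl⟩, map_zero]
  have step : ∀ i (f : p.X i →ₗ[R] q.X i) (f' : p.X (i + 1) →ₗ[R] q.X (i + 1)),
      (q.d i ∘ₗ f' = f ∘ₗ p.d i ∧ ∀ n x, x ∈ p.deg (i + 1) n → f' x ∈ q.deg (i + 1) n) →
      ∃ f'' : p.X (i + 2) →ₗ[R] q.X (i + 2), q.d (i + 1) ∘ₗ f'' = f' ∘ₗ p.d (i + 1) ∧
        ∀ n x, x ∈ p.deg (i + 2) n → f'' x ∈ q.deg (i + 2) n := by
    intro i f f' hf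
    have := p.projective (i + 2)
    refine exists_graded_lift hR (p.isInternal (i + 2)) (q.isInternal (i + 2))
      (q.isInternal (i + 1)).submodule_iSupIndep (p.smul_mem (i + 2)) (q.smul_mem (i + 2))
      (f' ∘ₗ p.d (i + 1)) (q.d (i + 1)) (fun n x hx => hf.2 n _ (p.d_mem (i + 1) n x hx))
      (q.d_mem (i + 1)) fun x => (q.exact_succ i _).1 ?_
    have := congr($(hf.1) (p.d (i + 1) x))
    simp only [LinearMap.comp_apply] at this ⊢
    rw [this, d_d, map_zero]
  obtain ⟨f0, hf0⟩ := step0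
  obtain ⟨f1, hf1⟩ := step1 f0 hf0
  choose S hS using step
  -- The recursion runs on two consecutive components together with the commuting square between
  -- them, because the next component exists only once that square is known.
  let T : ∀ i, {ff : (p.X i →ₗ[R] q.X i) × (p.X (i + 1) →ₗ[R] q.X (i + 1)) //
      (q.d i ∘ₗ ff.2 = ff.1 ∘ₗ p.d i ∧ ∀ n x, x ∈ p.deg (i + 1) n → ff.2 x ∈ q.deg (i + 1) n)} :=
    fun i => Nat.rec ⟨(f0, f1), hf1⟩
      (fun i t => ⟨(t.1.2, S i t.1.1 t.1.2 t.2), hS i t.1.1 t.1.2 t.2⟩) i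
  refine ⟨{ f := fun i => (T i).1.1, f_mem := ?_, comm := ?_, aug_comm := hf0.1 }⟩
  · intro i
    cases i with
    | zero => exact hf0.2
    | succ i => exact (T i).2.2
  · intro i
    exact (T i).2.1.symm

end Existence

section TorMap

variable {M : Type*} [AddCommGroup M] [Module k M] [Module Rᵐᵒᵖ M] [IsScalarTower k Rᵐᵒᵖ M]
  {degM : ℤ → Submodule k M}
  {M' : Type*} [AddCommGroup M'] [Module k M'] [Module Rᵐᵒᵖ M'] [IsScalarTower k Rᵐᵒᵖ M']
  {degM' : ℤ → Submodule k M'}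
  {M'' : Type*} [AddCommGroup M''] [Module k M''] [Module Rᵐᵒᵖ M''] [IsScalarTower k Rᵐᵒᵖ M'']

theorem torMap_mk (f : M →ₗ[Rᵐᵒᵖ] M') {g : N →ₗ[R] N'} (φ : p.Hom q g) (i : ℕ)
    (t : p.cyc M i) : torMap f φ i (Submodule.Quotient.mk t) =
      Submodule.Quotient.mk ⟨BalTensor.map k f (φ.f i) t, map_mem_cyc f φ i t t.2⟩ := rfl

theorem tor_hom_ext {W : Type*} [AddCommMonoid W] [Module k W] {i : ℕ} {f g : p.Tor M i →ₗ[k] W}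
    (h : ∀ t : p.cyc M i, f (Submodule.Quotient.mk t) = g (Submodule.Quotient.mk t)) : f = g := by
  refine LinearMap.ext fun t => ?_
  obtain ⟨t, rfl⟩ := Submodule.mkQ_surjective _ t
  exact h t

theorem torMap_comp (f : M →ₗ[Rᵐᵒᵖ] M') (f' : M' →ₗ[Rᵐᵒᵖ] M'') {g : N →ₗ[R] N'}
    {g' : N' →ₗ[R] N''} (φ : p.Hom q g) (ψ : q.Hom p' g') (i : ℕ) :
    torMap (f' ∘ₗ f) (ψ.comp φ) i = torMap f' ψ i ∘ₗ torMap f φ i :=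
  tor_hom_ext fun t => by
    rw [LinearMap.comp_apply, torMap_mk, torMap_mk, torMap_mk]
    congr 1
    exact Subtype.ext (BalTensor.map_map _ _ _ _ _ _).symm

theorem torMap_id (i : ℕ) : torMap (LinearMap.id : M →ₗ[Rᵐᵒᵖ] M) (Hom.id p) i = LinearMap.id :=
  tor_hom_ext fun t => by
    rw [torMap_mk]
    congr 1
    exact Subtype.ext congr($BalTensor.map_id_id (t : BalTensor k R M (p.X i)))

theorem torMap_sum_left {ι : Type*} (s : Finset ι) (f : ι → M →ₗ[Rᵐᵒᵖ] M') {g : N →ₗ[R] N'}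
    (φ : p.Hom q g) (i : ℕ) : torMap (∑ a ∈ s, f a) φ i = ∑ a ∈ s, torMap (f a) φ i :=
  tor_hom_ext fun t => by
    rw [LinearMap.sum_apply, torMap_mk]
    simp only [torMap_mk, BalTensor.map_sum_left, LinearMap.sum_apply]
    simp only [← Submodule.mkQ_apply]
    rw [← map_sum]
    congr 1
    exact Subtype.ext (by simp)

theorem torMap_sum_right {ι : Type*} (s : Finset ι) (f : M →ₗ[Rᵐᵒᵖ] M') {g : ι → N →ₗ[R] N'}
    (φ : ∀ a, p.Hom q (g a)) (i : ℕ) :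
    torMap f (Hom.sum s φ) i = ∑ a ∈ s, torMap f (φ a) i :=
  tor_hom_ext fun t => by
    rw [LinearMap.sum_apply, torMap_mk]
    simp only [torMap_mk, Hom.sum, BalTensor.map_sum_right, LinearMap.sum_apply]
    simp only [← Submodule.mkQ_apply]
    rw [← map_sum]
    congr 1
    exact Subtype.ext (by simp)

/-- Any two lifts are chain homotopic, and homotopic maps agree on homology. Allowing two
propositionally equal maps `g = g'` lets composites and sums of lifts be compared with any
convenient lift. -/
theorem torMap_congr (f : M →ₗ[Rᵐᵒᵖ] M') {g g' : N →ₗ[R] N'} (h : g = g') (φ : p.Hom q g)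
    (φ' : p.Hom q g') (i : ℕ) : torMap f φ i = torMap f φ' i := by
  subst h
  refine tor_hom_ext fun t => ?_
  rw [torMap_mk, torMap_mk, Submodule.Quotient.eq]
  change BalTensor.map k f (φ.f i) t - BalTensor.map k f (φ'.f i) t ∈ LinearMap.range (q.bd M' i)
  cases i with
  | zero =>
    obtain ⟨s, hs⟩ := homotopy_zero φ φ'
    refine ⟨BalTensor.map k f s t, ?_⟩
    rw [hs, BalTensor.map_add_right, LinearMap.add_apply, add_sub_cancel_left, bd,
      BalTensor.map_map]
    rfl
  | succ i =>
    obtain ⟨s, s', hs⟩ := homotopy_succ φ φ' i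
    refine ⟨BalTensor.map k f s t, ?_⟩
    have ht : BalTensor.map k (LinearMap.id : M →ₗ[Rᵐᵒᵖ] M) (p.d i) t = 0 := t.2
    -- This part of the homotopy factors through the differential, which kills the cycle t.
    have h2 : BalTensor.map k f (s' ∘ₗ p.d i) t = 0 := by
      have := BalTensor.map_map k (LinearMap.id : M →ₗ[Rᵐᵒᵖ] M) (p.d i) f s' t
      rw [ht, map_zero] at this
      exact this.symm
    rw [hs, BalTensor.map_add_right, LinearMap.add_apply, add_sub_cancel_left,
      BalTensor.map_add_right, LinearMap.add_apply, h2, add_zero, bd, BalTensor.map_map]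
    rfl

/-- The graded components of `Tor` do not depend on the resolution. -/
theorem nonempty_torDeg_equiv (hR : ⨆ n, degR n = ⊤) (hN : iSupIndep degN)
    (p q : GrRes k degR N degN) (degM : ℤ → Submodule k M) (i : ℕ) (j : ℤ) :
    Nonempty (p.torDeg degM i j ≃ₗ[k] q.torDeg degM i j) := by
  obtain ⟨φ⟩ := exists_hom hR hN p q LinearMap.id fun _ _ h => h
  obtain ⟨ψ⟩ := exists_hom hR hN q p LinearMap.id fun _ _ h => h
  have h1 : torMap (LinearMap.id : M →ₗ[Rᵐᵒᵖ] M) ψ i ∘ₗ torMap LinearMap.id φ i =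
      LinearMap.id := by
    rw [← torMap_comp, ← torMap_id]
    exact torMap_congr _ rfl _ _ i
  have h2 : torMap (LinearMap.id : M →ₗ[Rᵐᵒᵖ] M) φ i ∘ₗ torMap LinearMap.id ψ i =
      LinearMap.id := by
    rw [← torMap_comp, ← torMap_id]
    exact torMap_congr _ rfl _ _ i
  refine ⟨LinearEquiv.ofLinearMap
    (torDegMap (degM := degM) (degM' := degM) LinearMap.id (fun _ _ h => h) φ i j)
    (torDegMap (degM := degM) (degM' := degM) LinearMap.id (fun _ _ h => h) ψ i j) ?_ ?_⟩
  · exact LinearMap.ext fun t => Subtype.ext congr($h2 t)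
  · exact LinearMap.ext fun t => Subtype.ext congr($h1 t)

end TorMap

end GrRes
end GenericTor
end RedInc

namespace RedInc
-- Additivity of graded Tor in both variables.
noncomputable section TorDecomposition

namespace GrRes

variable {k : Type u} [Field k] {R : Type w} [Ring R] [Algebra k R] {degR : ℤ → Submodule k R}
variable {N : Type w} [AddCommGroup N] [Module k N] [Module R N] {degN : ℤ → Submodule k N}
  {X Y : Type*} [Fintype X] [Fintype Y]
  {K : Y → Type w} [∀ y, AddCommGroup (K y)] [∀ y, Module k (K y)] [∀ y, Module R (K y)]
  {degK : ∀ y, ℤ → Submodule k (K y)}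
  {M : Type*} [AddCommGroup M] [Module k M] [Module Rᵐᵒᵖ M] [IsScalarTower k Rᵐᵒᵖ M]
  {degM : ℤ → Submodule k M}
  {L : X → Type*} [∀ x, AddCommGroup (L x)] [∀ x, Module k (L x)] [∀ x, Module Rᵐᵒᵖ (L x)]
  [∀ x, IsScalarTower k Rᵐᵒᵖ (L x)] {degL : ∀ x, ℤ → Submodule k (L x)}

theorem torMap_zero_left {N' : Type w} [AddCommGroup N'] [Module k N'] [Module R N']
    {degN' : ℤ → Submodule k N'} {p : GrRes k degR N degN} {q : GrRes k degR N' degN'}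
    {M' : Type*} [AddCommGroup M'] [Module k M'] [Module Rᵐᵒᵖ M'] [IsScalarTower k Rᵐᵒᵖ M']
    {g : N →ₗ[R] N'} (φ : p.Hom q g) {f : M →ₗ[Rᵐᵒᵖ] M'} (h : f = 0) (i : ℕ) :
    torMap f φ i = 0 := by
  have h0 : f = ∑ a ∈ (∅ : Finset ℕ), f := h
  rw [h0, torMap_sum_left]
  rfl

theorem torMap_zero_right {N' : Type w} [AddCommGroup N'] [Module k N'] [Module R N']
    {degN' : ℤ → Submodule k N'} {p : GrRes k degR N degN} {q : GrRes k degR N' degN'}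
    {M' : Type*} [AddCommGroup M'] [Module k M'] [Module Rᵐᵒᵖ M'] [IsScalarTower k Rᵐᵒᵖ M']
    {g : N →ₗ[R] N'} (φ : p.Hom q g) (f : M →ₗ[Rᵐᵒᵖ] M') (h : g = 0) (i : ℕ) :
    torMap f φ i = 0 := by
  have h0 : g = ∑ a ∈ (∅ : Finset ℕ), g := h
  rw [torMap_congr f h0 φ (Hom.sum (∅ : Finset ℕ) fun _ => φ), torMap_sum_right]
  rfl

/-- Commuting squares of modules give commuting squares on Tor for any choice of lifts, since both
composites are computed by lifts of the same map. This yields the A_0-equivariance of the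
decomposition. -/
theorem torDegMap_comm {N₁ N₂ N₃ : Type w} [AddCommGroup N₁] [Module k N₁] [Module R N₁]
    [AddCommGroup N₂] [Module k N₂] [Module R N₂] [AddCommGroup N₃] [Module k N₃] [Module R N₃]
    {degN₁ : ℤ → Submodule k N₁} {degN₂ : ℤ → Submodule k N₂} {degN₃ : ℤ → Submodule k N₃}
    {p : GrRes k degR N degN} {p₁ : GrRes k degR N₁ degN₁} {p₂ : GrRes k degR N₂ degN₂}
    {p₃ : GrRes k degR N₃ degN₃} {M₁ M₂ M₃ : Type*}
    [AddCommGroup M₁] [Module k M₁] [Module Rᵐᵒᵖ M₁] [IsScalarTower k Rᵐᵒᵖ M₁]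
    [AddCommGroup M₂] [Module k M₂] [Module Rᵐᵒᵖ M₂] [IsScalarTower k Rᵐᵒᵖ M₂]
    [AddCommGroup M₃] [Module k M₃] [Module Rᵐᵒᵖ M₃] [IsScalarTower k Rᵐᵒᵖ M₃]
    {degM₁ : ℤ → Submodule k M₁} {degM₂ : ℤ → Submodule k M₂} {degM₃ : ℤ → Submodule k M₃}
    {f₁ : M →ₗ[Rᵐᵒᵖ] M₁} {f₂ : M →ₗ[Rᵐᵒᵖ] M₂} {f₁' : M₁ →ₗ[Rᵐᵒᵖ] M₃} {f₂' : M₂ →ₗ[Rᵐᵒᵖ] M₃}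
    {g₁ : N →ₗ[R] N₁} {g₂ : N →ₗ[R] N₂} {g₁' : N₁ →ₗ[R] N₃} {g₂' : N₂ →ₗ[R] N₃}
    (hf : f₁' ∘ₗ f₁ = f₂' ∘ₗ f₂) (hg : g₁' ∘ₗ g₁ = g₂' ∘ₗ g₂)
    (hf₁ : ∀ n m, m ∈ degM n → f₁ m ∈ degM₁ n) (hf₂ : ∀ n m, m ∈ degM n → f₂ m ∈ degM₂ n)
    (hf₁' : ∀ n m, m ∈ degM₁ n → f₁' m ∈ degM₃ n) (hf₂' : ∀ n m, m ∈ degM₂ n → f₂' m ∈ degM₃ n)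
    (φ₁ : p.Hom p₁ g₁) (φ₂ : p.Hom p₂ g₂) (φ₁' : p₁.Hom p₃ g₁') (φ₂' : p₂.Hom p₃ g₂')
    (i : ℕ) (j : ℤ) (t : p.torDeg degM i j) :
    torDegMap f₁' hf₁' φ₁' i j (torDegMap f₁ hf₁ φ₁ i j t) =
      torDegMap f₂' hf₂' φ₂' i j (torDegMap f₂ hf₂ φ₂ i j t) := by
  refine Subtype.ext ?_
  change (torMap f₁' φ₁' i ∘ₗ torMap f₁ φ₁ i) (t : p.Tor M i) =
    (torMap f₂' φ₂' i ∘ₗ torMap f₂ φ₂ i) (t : p.Tor M i)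
  rw [← torMap_comp, ← torMap_comp, hf, torMap_congr _ hg _ (φ₂'.comp φ₂)]

/-- Tor turns the two systems of projections and inclusions into one system indexed by pairs. The
chosen lifts need not be orthogonal or sum to the identity as chain maps; by `torMap_congr` these
relations hold on Tor. The components of the isomorphism are recorded so that equivariance can be
checked on them. -/
theorem exists_torDeg_equiv_directSum (p : GrRes k degR N degN) (q : ∀ y, GrRes k degR (K y) (degK y))
    {prK : ∀ y, N →ₗ[R] K y} {inK : ∀ y, K y →ₗ[R] N} (π : ∀ y, p.Hom (q y) (prK y))
    (ι : ∀ y, (q y).Hom p (inK y)) (hK : ∑ y, inK y ∘ₗ prK y = LinearMap.id)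
    (hK₁ : ∀ y, prK y ∘ₗ inK y = LinearMap.id) (hK₀ : ∀ y y', y ≠ y' → prK y ∘ₗ inK y' = 0)
    {prL : ∀ x, M →ₗ[Rᵐᵒᵖ] L x} {inL : ∀ x, L x →ₗ[Rᵐᵒᵖ] M}
    (hprL : ∀ x n m, m ∈ degM n → prL x m ∈ degL x n)
    (hinL : ∀ x n m, m ∈ degL x n → inL x m ∈ degM n)
    (hL : ∑ x, inL x ∘ₗ prL x = LinearMap.id)
    (hL₁ : ∀ x, prL x ∘ₗ inL x = LinearMap.id) (hL₀ : ∀ x x', x ≠ x' → prL x ∘ₗ inL x' = 0)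
    (i : ℕ) (j : ℤ) :
    ∃ e : p.torDeg degM i j ≃ₗ[k] ⨁ c : X × Y, (q c.2).torDeg (degL c.1) i j,
      ∀ t c, e t c = torDegMap (prL c.1) (hprL c.1) (π c.2) i j t := by
  classical
  let fwd : p.torDeg degM i j →ₗ[k] ∀ c : X × Y, (q c.2).torDeg (degL c.1) i j :=
    LinearMap.pi fun c => torDegMap (prL c.1) (hprL c.1) (π c.2) i j
  let back : (∀ c : X × Y, (q c.2).torDeg (degL c.1) i j) →ₗ[k] p.torDeg degM i j :=
    ∑ c : X × Y, torDegMap (inL c.1) (hinL c.1) (ι c.2) i j ∘ₗ LinearMap.proj c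
  have hback : ∀ f, (back f : p.Tor M i) =
      ∑ c : X × Y, torMap (inL c.1) (ι c.2) i (f c : (q c.2).Tor (L c.1) i) := by
    intro f
    rw [LinearMap.sum_apply, AddSubmonoidClass.coe_finsetSum]
    rfl
  have h1 : back ∘ₗ fwd = LinearMap.id := by
    refine LinearMap.ext fun t => Subtype.ext ?_
    refine (hback _).trans ?_
    change ∑ c : X × Y, (torMap (inL c.1) (ι c.2) i ∘ₗ torMap (prL c.1) (π c.2) i)
      (t : p.Tor M i) = t
    simp only [← torMap_comp]
    rw [Fintype.sum_prod_type_right]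
    dsimp only
    -- For fixed y the same lift occurs in every summand, so the sum over x is collapsed first by
    -- additivity in M; the sum over y then involves a sum of lifts, which is a lift of the identity
    -- of N.
    have h2 : ∀ y, ∑ x, (torMap (inL x ∘ₗ prL x) ((ι y).comp (π y)) i) (t : p.Tor M i) =
        torMap LinearMap.id ((ι y).comp (π y)) i t := by
      intro y
      rw [← LinearMap.sum_apply, ← torMap_sum_left, hL]
    simp only [h2]
    rw [← LinearMap.sum_apply, ← torMap_sum_right, torMap_congr LinearMap.id hK _ (Hom.id p),
      torMap_id]
    rfl
  have h2 : fwd ∘ₗ back = LinearMap.id := by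
    refine LinearMap.ext fun f => funext fun c => Subtype.ext ?_
    change torMap (prL c.1) (π c.2) i (back f : p.Tor M i) = f c
    rw [hback, map_sum, Finset.sum_eq_single c]
    · rw [← LinearMap.comp_apply, ← torMap_comp, hL₁,
        torMap_congr LinearMap.id (hK₁ c.2) _ (Hom.id (q c.2)), torMap_id]
      rfl
    · intro c' _ hc
      rw [← LinearMap.comp_apply, ← torMap_comp]
      by_cases hx : c.1 = c'.1
      · rw [torMap_zero_right _ _ (hK₀ _ _ fun hy => hc (Prod.ext hx hy).symm)]
        rfl
      · rw [torMap_zero_left _ (hL₀ _ _ hx)]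
        rfl
    · exact fun h => absurd (Finset.mem_univ c) h
  let e₁ : p.torDeg degM i j ≃ₗ[k] ∀ c : X × Y, (q c.2).torDeg (degL c.1) i j :=
    LinearEquiv.ofLinearMap fwd back h2 h1
  refine ⟨e₁.trans (DirectSum.linearEquivFunOnFintype k _ _).symm, fun t c => ?_⟩
  exact congrFun ((DirectSum.linearEquivFunOnFintype k (X × Y) _).apply_symm_apply (fwd t)) c

end GrRes

end TorDecomposition

/-! ### Splitting gr_I J and A_0 by the vertex idempotents. -/

noncomputable section BimoduleDecomposition

variable {k : Type u} [Field k] {P : Type v} [PartialOrder P] {r : Setoid (NonemptyInterval P)}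

theorem iSupIndep_zeroDeg (N : Type*) [AddCommGroup N] [Module k N] :
    iSupIndep (zeroDeg k N) := by
  intro n
  rw [Submodule.disjoint_def]
  intro x hx hx'
  by_cases hn : n = 0
  · have : ⨆ m ≠ n, zeroDeg k N m = ⊥ := by
      refine iSup₂_eq_bot.2 fun m hm => ?_
      rw [zeroDeg, if_neg (by rwa [hn] at hm)]
    rwa [this] at hx'
  · rwa [zeroDeg, if_neg hn] at hx

theorem zeroDeg_map {R : Type*} [Ring R] {N N' : Type*} [AddCommGroup N] [Module k N]
    [Module R N] [AddCommGroup N'] [Module k N'] [Module R N'] (g : N →ₗ[R] N') (n : ℤ) (x : N)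
    (hx : x ∈ zeroDeg k N n) : g x ∈ zeroDeg k N' n := by
  by_cases hn : n = 0
  · rw [zeroDeg, if_pos hn]; trivial
  · rw [zeroDeg, if_neg hn, Submodule.mem_bot] at hx
    rw [hx, map_zero]; exact zero_mem _

theorem iSup_grDeg {A : Type w} [Ring A] [Algebra k A] (I J : Submodule k A) :
    ⨆ n, grDeg I J n = ⊤ := by
  refine (Submodule.eq_top_iff').2 fun x => ?_
  induction x using DirectSum.induction_on with
  | zero => exact zero_mem _
  | of d y =>
    obtain ⟨x, rfl⟩ := pieceMk_surjective d y
    exact Submodule.mem_iSup_of_mem (d : ℤ) (grMk_mem d x)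
  | add x y hx hy => exact add_mem hx hy

theorem iSup_ringDeg {A : Type w} [Ring A] [Algebra k A] (I : Submodule k A) [IsRightIdeal I] :
    ⨆ n, ringDeg I n = ⊤ := iSup_grDeg I ⊤

variable [IncidenceLaws r] (J : Submodule k (RedIncAlg k r)) [IsMonomialRightIdeal k J]

theorem leftMul_mk (a : A0 k r) (d : ℕ) (x : ↥(J * augIdeal k r ^ d)) :
    leftMul J a (grMk (augIdeal k r) J d x) =
      grMk (augIdeal k r) J d ⟨a * x, filt_left (A0_mul_mem J a.2) d x.2⟩ :=
  grLeftLin_mk (I := augIdeal k r) (a : RedIncAlg k r) (A0_mul_mem J a.2) d x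

/-- The idempotent `ξ_x` as an element of `A_0`. -/
abbrev idem (x : Vtx r) : A0 k r := ⟨xi k (idCls r x), xi_idCls_mem x⟩

/-- This is where finiteness of P/∼ enters: the unit is a genuine finite sum of orthogonal
idempotents, which split gr_I J from the left and A_0 from the right. -/
theorem sum_idem [Fintype (Vtx r)] : ∑ x : Vtx r, xi k (idCls r x) = 1 := by
  rw [one_def, finsum_eq_sum_of_fintype]

theorem idem_mul_idem [DecidableEq (Vtx r)] (x y : Vtx r) :
    xi k (idCls r x) * xi k (idCls r y) = if x = y then xi k (idCls r y) else 0 := by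
  have hs : src r (idCls r y) = y := by obtain ⟨y⟩ := y; rfl
  rw [idem_mul_xi, hs]

theorem sum_leftMul_idem [Fintype (Vtx r)] (m) : ∑ x : Vtx r, leftMul J (idem x) m = m := by
  have : ∑ x : Vtx r, (leftMul J (idem x)).restrictScalars k = LinearMap.id := by
    refine grHom_ext fun d m => ?_
    rw [LinearMap.sum_apply]
    simp only [LinearMap.coe_restrictScalars, leftMul_mk, LinearMap.id_apply]
    rw [← map_sum]
    refine grMk_congr rfl _ _ ?_
    rw [AddSubmonoidClass.coe_finsetSum]
    change ∑ x, xi k (idCls r x) * (m : RedIncAlg k r) = _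
    rw [← Finset.sum_mul, sum_idem, one_mul]
  have := congr($this m)
  rwa [LinearMap.sum_apply] at this

theorem leftMul_idem_idem [DecidableEq (Vtx r)] (x y : Vtx r) (m) :
    leftMul J (idem x) (leftMul J (idem y) m) = if x = y then leftMul J (idem y) m else 0 := by
  have : (leftMul J (idem x)).restrictScalars k ∘ₗ (leftMul J (idem y)).restrictScalars k =
      if x = y then (leftMul J (idem y)).restrictScalars k else 0 := by
    refine grHom_ext fun d m => ?_
    simp only [LinearMap.coe_restrictScalars, LinearMap.comp_apply, leftMul_mk]
    split_ifs with h
    · rw [LinearMap.coe_restrictScalars, leftMul_mk]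
      refine grMk_congr rfl _ _ ?_
      dsimp only
      rw [← mul_assoc, idem_mul_idem, if_pos h]
    · rw [LinearMap.zero_apply, ← map_zero (grMk (augIdeal k r) J d)]
      refine grMk_congr rfl _ _ ?_
      dsimp only
      rw [← mul_assoc, idem_mul_idem, if_neg h, zero_mul]
      rfl
  have := congr($this m)
  split_ifs at this ⊢
  · exact this
  · exact this

/-- The projection `gr_I J → ξ_x gr_I J`. -/
def idemProj (x : Vtx r) : GrMod (augIdeal k r) J →ₗ[(GrAlg k r)ᵐᵒᵖ] idemPart J x :=
  (leftMul J (idem x)).rangeRestrict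

/-- The inclusion `ξ_x gr_I J → gr_I J`. -/
def idemIncl (x : Vtx r) : idemPart J x →ₗ[(GrAlg k r)ᵐᵒᵖ] GrMod (augIdeal k r) J :=
  (idemPart J x).subtype

theorem idemProj_deg (x : Vtx r) (n : ℤ) (m) (hm : m ∈ grDeg (augIdeal k r) J n) :
    idemProj J x m ∈ idemDeg J x n :=
  leftMul_deg J (idem x) n m hm

theorem idemIncl_deg (x : Vtx r) (n : ℤ) (m) (hm : m ∈ idemDeg J x n) :
    idemIncl J x m ∈ grDeg (augIdeal k r) J n := hm

theorem sum_idemIncl_idemProj [Fintype (Vtx r)] :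
    ∑ x : Vtx r, idemIncl J x ∘ₗ idemProj J x = LinearMap.id := by
  ext1 m
  rw [LinearMap.sum_apply]
  exact sum_leftMul_idem J m

theorem idemProj_idemIncl (x : Vtx r) : idemProj J x ∘ₗ idemIncl J x = LinearMap.id := by
  classical
  ext1 ⟨_, m, rfl⟩
  exact Subtype.ext ((leftMul_idem_idem J x x m).trans (if_pos rfl))

theorem idemProj_idemIncl_of_ne {x y : Vtx r} (h : x ≠ y) :
    idemProj J x ∘ₗ idemIncl J y = 0 := by
  classical
  ext1 ⟨_, m, rfl⟩
  exact Subtype.ext ((leftMul_idem_idem J x y m).trans (if_neg h))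

/-- Elements of A_0 commute with the idempotents. This is the left half of the equivariance of the
decomposition; `kProj_rightMul` is the right half. -/
theorem idemProj_leftMul (a : A0 k r) (x : Vtx r) :
    idemProj J x ∘ₗ leftMul J a = leftMulIdem J a x ∘ₗ idemProj J x :=
  LinearMap.ext fun m => Subtype.ext (leftMul_comm J a x m).symm

theorem rightMul_mk (a : RedIncAlg k r) (s : GrAlg k r) :
    rightMul k r a (Submodule.Quotient.mk s) =
      Submodule.Quotient.mk (s * grOf (augIdeal k r) a) := rfl

theorem rightMul_idem_mem (y : Vtx r) (t) : rightMul k r (xi k (idCls r y)) t ∈ kMod k r y := by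
  obtain ⟨s, rfl⟩ := Submodule.mkQ_surjective _ t
  exact Submodule.smul_mem _ s (Submodule.mem_span_singleton_self _)

/-- The projection `A_0 → k_y`. -/
def kProj (y : Vtx r) : A0Mod k r →ₗ[GrAlg k r] kMod k r y :=
  (rightMul k r (xi k (idCls r y))).codRestrict _ (rightMul_idem_mem y)

/-- The inclusion `k_y → A_0`. -/
def kIncl (y : Vtx r) : kMod k r y →ₗ[GrAlg k r] A0Mod k r := (kMod k r y).subtype

theorem rightMul_rightMul (a b : RedIncAlg k r) (t) :
    rightMul k r a (rightMul k r b t) = rightMul k r (b * a) t := by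
  obtain ⟨s, rfl⟩ := Submodule.Quotient.mk_surjective _ t
  rw [rightMul_mk, rightMul_mk, rightMul_mk, mul_assoc, grOf_mul]

theorem rightMul_one (t) : rightMul k r 1 t = t := by
  obtain ⟨s, rfl⟩ := Submodule.Quotient.mk_surjective _ t
  rw [rightMul_mk]
  exact congrArg _ (mul_one s)

theorem grOf_sum {ι : Type*} (s : Finset ι) (f : ι → RedIncAlg k r) :
    grOf (augIdeal k r) (∑ a ∈ s, f a) = ∑ a ∈ s, grOf (augIdeal k r) (f a) :=
  map_sum (M := RedIncAlg k r) (grMk (augIdeal k r) ⊤ 0 ∘ₗ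
    (LinearMap.id.codRestrict _ fun a => by simp :
      RedIncAlg k r →ₗ[k] ↥((⊤ : Submodule k (RedIncAlg k r)) * augIdeal k r ^ 0))) f s

theorem rightMul_sum {ι : Type*} (s : Finset ι) (f : ι → RedIncAlg k r) (t) :
    rightMul k r (∑ a ∈ s, f a) t = ∑ a ∈ s, rightMul k r (f a) t := by
  obtain ⟨c, rfl⟩ := Submodule.Quotient.mk_surjective _ t
  simp only [rightMul_mk, grOf_sum, Finset.mul_sum]
  exact map_sum (irrel k r).mkQ _ _

theorem rightMul_zero (t) : rightMul k r 0 t = 0 := rightMul_sum ∅ (fun _ : ℕ => 0) t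

theorem sum_kIncl_kProj [Fintype (Vtx r)] :
    ∑ y : Vtx r, kIncl (k := k) y ∘ₗ kProj y = LinearMap.id := by
  refine LinearMap.ext fun t => ?_
  rw [LinearMap.sum_apply]
  change ∑ y, rightMul k r (xi k (idCls r y)) t = t
  rw [← rightMul_sum, sum_idem, rightMul_one]

theorem exists_rightMul_of_mem_kMod {y : Vtx r} {t} (ht : t ∈ kMod k r y) :
    ∃ s, t = rightMul k r (xi k (idCls r y)) s := by
  obtain ⟨s, rfl⟩ := Submodule.mem_span_singleton.1 ht
  exact ⟨Submodule.Quotient.mk s, rfl⟩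

theorem kProj_kIncl (y : Vtx r) : kProj (k := k) y ∘ₗ kIncl y = LinearMap.id := by
  classical
  refine LinearMap.ext fun ⟨t, ht⟩ => Subtype.ext ?_
  obtain ⟨s, rfl⟩ := exists_rightMul_of_mem_kMod ht
  change rightMul k r _ (rightMul k r _ s) = rightMul k r _ s
  rw [rightMul_rightMul, idem_mul_idem, if_pos rfl]

theorem kProj_kIncl_of_ne {x y : Vtx r} (h : x ≠ y) : kProj (k := k) x ∘ₗ kIncl y = 0 := by
  classical
  refine LinearMap.ext fun ⟨t, ht⟩ => Subtype.ext ?_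
  obtain ⟨s, rfl⟩ := exists_rightMul_of_mem_kMod ht
  change rightMul k r _ (rightMul k r _ s) = 0
  rw [rightMul_rightMul, idem_mul_idem, if_neg h.symm, rightMul_zero]

theorem kProj_rightMul (b : A0 k r) (y : Vtx r) :
    kProj (k := k) y ∘ₗ rightMul k r b = rightMulK b y ∘ₗ kProj y := by
  refine LinearMap.ext fun t => Subtype.ext ?_
  change rightMul k r _ (rightMul k r _ t) = rightMul k r _ (rightMul k r _ t)
  rw [rightMul_rightMul, rightMul_rightMul, A0_comm b.2]

end BimoduleDecomposition
end RedInc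

namespace RedInc
-- Factorizations of classes and their ranks.
section Classes

variable {P : Type v} [PartialOrder P] {r : Setoid (NonemptyInterval P)}

/-- The classes of the intervals `[x, x]`. -/
def IsId (α : Quotient r) : Prop := ∃ v, α = idCls r v

/-- A set of classes that is closed under composition with arbitrary classes on the right. -/
def RightClosed (S : Set (Quotient r)) : Prop :=
  ∀ α ∈ S, ∀ β γ, Composes r α β γ → γ ∈ S

/-- The composites of a class in `S` with `d` classes that are not identities. -/
def lev (S : Set (Quotient r)) : ℕ → Set (Quotient r)
  | 0 => S
  | d + 1 => {γ | ∃ α ∈ lev S d, ∃ β, ¬ IsId β ∧ Composes r α β γ}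

/-- The largest `d` such that `γ` is a composite of a class in `S` with `d` classes that are not
identities. -/
noncomputable def rk (S : Set (Quotient r)) (γ : Quotient r) : ℕ := sSup {d | γ ∈ lev S d}

variable [IncidenceLaws r]

theorem isId_cls_iff {x y : P} (h : x ≤ y) : IsId (cls r h) ↔ x = y := by
  constructor
  · rintro ⟨⟨v⟩, hv⟩
    exact eq_of_cls_eq_refl h hv
  · rintro rfl
    exact ⟨Quotient.mk _ x, rfl⟩

theorem isId_idCls (v : Vtx r) : IsId (idCls r v) := ⟨v, rfl⟩

/-- A composite that is a one-point interval forces its middle vertex to coincide with both ends.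
Hence non-identity classes behave like an ideal under composition. -/
theorem Composes.isId {α β γ : Quotient r} (h : Composes r α β γ) (hγ : IsId γ) :
    IsId α ∧ IsId β := by
  obtain ⟨x, y, z, h1, h2, rfl, rfl, rfl⟩ := h
  have h3 : x = z := (isId_cls_iff _).1 hγ
  subst h3
  have h4 : x = y := le_antisymm h1 h2
  subst h4
  exact ⟨hγ, hγ⟩

theorem tgt_idCls (v : Vtx r) : tgt r (idCls r v) = v := by obtain ⟨v⟩ := v; rfl

theorem Composes.src_eq {α β γ : Quotient r} (h : Composes r α β γ) : src r γ = src r α := by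
  obtain ⟨x, y, z, h1, h2, rfl, rfl, rfl⟩ := h; rfl
theorem Composes.tgt_eq {α β γ : Quotient r} (h : Composes r α β γ) : tgt r γ = tgt r β := by
  obtain ⟨x, y, z, h1, h2, rfl, rfl, rfl⟩ := h; rfl

theorem rightClosed_univ : RightClosed (Set.univ : Set (Quotient r)) := fun _ _ _ _ _ => trivial

/-- The extra right factor is absorbed into the last non-identity factor, which stays a non-identity
by `Composes.isId`. -/
theorem RightClosed.lev {S : Set (Quotient r)} (hS : RightClosed S) (d : ℕ) :
    RightClosed (lev S d) := by
  cases d with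
  | zero => exact hS
  | succ d =>
    rintro γ ⟨α, hα, β, hβ, hc⟩ δ ε hε
    obtain ⟨η, h1, h2⟩ := composes_assoc.1 ⟨γ, hc, hε⟩
    exact ⟨α, hα, η, fun h => hβ (h1.isId h).1, h2⟩

theorem RightClosed.lev_anti {S : Set (Quotient r)} (hS : RightClosed S) {d e : ℕ} (h : d ≤ e) :
    RedInc.lev S e ⊆ RedInc.lev S d := by
  induction h with
  | refl => exact subset_rfl
  | step _ ih =>
    rintro γ ⟨α, hα, β, -, hc⟩
    exact hS.lev _ α (ih hα) β γ hc

/-- By invariance, a factorization of a class can be realized inside any interval that represents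
it. This replaces factorizations by chains of points in one fixed interval. -/
theorem lev_cls_iff {S : Set (Quotient r)} (d : ℕ) {x y : P} (h : x ≤ y) :
    cls r h ∈ lev S (d + 1) ↔ ∃ (z : P) (h1 : x ≤ z), z < y ∧ cls r h1 ∈ lev S d := by
  constructor
  · rintro ⟨_, hα, _, hβ, x', z', y', h1, h2, rfl, rfl, e⟩
    obtain ⟨z, h3, h4, e3, e4⟩ := exists_between h1 h2 h e
    refine ⟨z, h3, lt_of_le_of_ne h4 fun hz => hβ ?_, e3 ▸ hα⟩
    rw [← e4, isId_cls_iff]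
    exact hz
  · rintro ⟨z, h1, h2, hz⟩
    exact ⟨_, hz, cls r h2.le, fun h3 => h2.ne ((isId_cls_iff _).1 h3), x, z, y, h1, h2.le, rfl,
      rfl, rfl⟩

/-- The shadow on classes of J I^d · I^e ⊆ J I^(d+e): the non-identity factors of β are moved to the
left one at a time by associativity. -/
theorem lev_add {S : Set (Quotient r)} (hS : RightClosed S) {α β γ : Quotient r} {d e : ℕ}
    (hα : α ∈ lev S d) (hβ : β ∈ lev Set.univ e) (h : Composes r α β γ) : γ ∈ lev S (d + e) := by
  induction e generalizing β γ with
  | zero => exact hS.lev d α hα β γ h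
  | succ e ih =>
    obtain ⟨δ, hδ, ε, hε, hc⟩ := hβ
    obtain ⟨η, h1, h2⟩ := composes_assoc.2 ⟨β, hc, h⟩
    exact ⟨η, ih hδ h1, ε, hε, h2⟩

variable [LocallyFiniteOrder P]

/-- Each non-identity factor adds at least one new point to the interval. Local finiteness thus
bounds the number of factors, so the supremum defining `rk` is attained. -/
theorem lev_bound {S : Set (Quotient r)} {d : ℕ} {x y : P} (h : x ≤ y)
    (hd : cls r h ∈ lev S d) : d ≤ (Finset.Icc x y).card := by
  induction d generalizing y with
  | zero => exact Nat.zero_le _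
  | succ d ih =>
    obtain ⟨z, h1, h2, hz⟩ := (lev_cls_iff d h).1 hd
    refine (Nat.succ_le_succ (ih h1 hz)).trans (Nat.succ_le_of_lt (Finset.card_lt_card ?_))
    refine ⟨Finset.Icc_subset_Icc le_rfl h2.le, fun hs => ?_⟩
    exact absurd (Finset.mem_Icc.1 (hs (Finset.mem_Icc.2 ⟨h, le_rfl⟩))).2 (not_le_of_gt h2)

theorem bddAbove_lev (S : Set (Quotient r)) (γ : Quotient r) : BddAbove {d | γ ∈ lev S d} := by
  obtain ⟨x, y, h, rfl⟩ := cls_surj γ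
  exact ⟨_, fun d hd => lev_bound h hd⟩

theorem mem_lev_rk {S : Set (Quotient r)} {γ : Quotient r} (h : γ ∈ S) : γ ∈ lev S (rk S γ) :=
  Nat.sSup_mem (s := {d | γ ∈ lev S d}) ⟨0, h⟩ (bddAbove_lev S γ)

theorem le_rk {S : Set (Quotient r)} {γ : Quotient r} {d : ℕ} (h : γ ∈ lev S d) : d ≤ rk S γ :=
  le_csSup (bddAbove_lev S γ) h

theorem RightClosed.mem_lev_iff {S : Set (Quotient r)} (hS : RightClosed S) {γ : Quotient r}
    (h : γ ∈ S) {d : ℕ} : γ ∈ RedInc.lev S d ↔ d ≤ rk S γ :=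
  ⟨le_rk, fun hd => hS.lev_anti hd (mem_lev_rk h)⟩

/-- Strict inequality can occur, and this is precisely when the product of the two monomials
vanishes in the associated graded module. -/
theorem rk_add_le {S : Set (Quotient r)} (hS : RightClosed S) {α β γ : Quotient r}
    (hα : α ∈ S) (h : Composes r α β γ) : rk S α + rk Set.univ β ≤ rk S γ :=
  le_rk (lev_add hS (mem_lev_rk hα) (mem_lev_rk trivial) h)

theorem rk_univ_of_isId {α : Quotient r} (h : IsId α) : rk Set.univ α = 0 := by
  by_contra h0
  have h1 : α ∈ lev Set.univ 1 :=
    (rightClosed_univ.mem_lev_iff trivial).2 (Nat.one_le_iff_ne_zero.2 h0)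
  obtain ⟨β, -, γ, hγ, hc⟩ := h1
  exact hγ (hc.isId h).2

/-- The factorization used is an identity followed by α. -/
theorem one_le_rk_univ {α : Quotient r} (h : ¬ IsId α) : 1 ≤ rk Set.univ α :=
  le_rk ⟨idCls r (src r α), trivial, α, h, composes_id_left.2 ⟨rfl, rfl⟩⟩

end Classes

/-! ### The monomial bases of gr_I J and gr_I A and their multiplication. -/

noncomputable section Monomials

variable (k : Type u) [Field k] {P : Type v} [PartialOrder P] {r : Setoid (NonemptyInterval P)}

/-- The span of the monomials `ξ_α`, `α ∈ S`. -/
def mono (S : Set (Quotient r)) : Submodule k (RedIncAlg k r) := Submodule.span k (xi k '' S)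

variable {k}

/-- The coefficients of an element of the reduced incidence algebra. -/
def coeff : RedIncAlg k r →ₗ[k] (Quotient r →₀ k) := (LinearEquiv.refl k (Quotient r →₀ k)).toLinearMap

theorem coeff_xi (α : Quotient r) : coeff (xi k α) = Finsupp.single α 1 := rfl

theorem mem_mono_iff {S : Set (Quotient r)} {a : RedIncAlg k r} :
    a ∈ mono k S ↔ coeff a ∈ Finsupp.supported k k S := by
  rw [Finsupp.supported_eq_span_single]
  rfl

theorem xi_mem_mono_iff {S : Set (Quotient r)} {α : Quotient r} : xi k α ∈ mono k S ↔ α ∈ S := by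
  rw [mem_mono_iff, coeff_xi, Finsupp.mem_supported, Finsupp.support_single _ one_ne_zero]
  simp

/-- The classes of the monomials in `J`. -/
def monSet (J : Submodule k (RedIncAlg k r)) : Set (Quotient r) := {α | xi k α ∈ J}

theorem monSet_mono (S : Set (Quotient r)) : monSet (mono k S) = S :=
  Set.ext fun _ => xi_mem_mono_iff

theorem mono_univ : mono k (Set.univ : Set (Quotient r)) = ⊤ :=
  (Submodule.eq_top_iff').2 fun a => mem_mono_iff.2 <| by
    rw [Finsupp.supported_univ]; trivial

theorem monSet_top : monSet (⊤ : Submodule k (RedIncAlg k r)) = Set.univ := rfl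

/-- A subspace spanned by monomials. -/
class IsMonomial (J : Submodule k (RedIncAlg k r)) : Prop where
  eq_mono : J = mono k (monSet J)

instance : IsMonomial (⊤ : Submodule k (RedIncAlg k r)) := ⟨mono_univ.symm⟩

/-- The product of two monomials is a monomial or zero, so products of monomial subspaces are
determined by composing index sets. -/
theorem mono_mul_mono [IncidenceLaws r] (S T : Set (Quotient r)) :
    mono k S * mono k T = mono k {γ | ∃ α ∈ S, ∃ β ∈ T, Composes r α β γ} := by
  apply le_antisymm
  · rw [mono, mono, Submodule.span_mul_span, Submodule.span_le]
    rintro _ ⟨_, ⟨α, hα, rfl⟩, _, ⟨β, hβ, rfl⟩, rfl⟩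
    change xi k α * xi k β ∈ _
    rw [xi_mul_xi]
    by_cases h : ∃ γ, Composes r α β γ
    · obtain ⟨γ, h⟩ := h
      rw [mulXi_eq h]
      exact xi_mem_mono_iff.2 ⟨α, hα, β, hβ, h⟩
    · rw [mulXi_eq_zero h]
      exact zero_mem _
  · rw [mono, Submodule.span_le]
    rintro _ ⟨γ, ⟨α, hα, β, hβ, h⟩, rfl⟩
    rw [← mulXi_eq h, ← xi_mul_xi]
    exact Submodule.mul_mem_mul (xi_mem_mono_iff.2 hα) (xi_mem_mono_iff.2 hβ)

theorem augIdeal_eq_mono [IncidenceLaws r] : augIdeal k r = mono k {α | ¬ IsId α} := by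
  rw [augIdeal, mono]
  congr 1
  ext a
  constructor
  · rintro ⟨x, y, h, rfl⟩
    exact ⟨_, fun h1 => h.ne ((isId_cls_iff _).1 h1), rfl⟩
  · rintro ⟨α, hα, rfl⟩
    obtain ⟨x, y, h, rfl⟩ := cls_surj α
    exact ⟨x, y, lt_of_le_of_ne h fun h1 => hα ((isId_cls_iff _).2 h1), rfl⟩

variable [IncidenceLaws r]

instance (J : Submodule k (RedIncAlg k r)) [h : IsMonomialRightIdeal k J] : IsMonomial J := by
  obtain ⟨S, hS⟩ := h.generated
  have : J = mono k {γ | ∃ α ∈ S, ∃ β ∈ Set.univ, Composes r α β γ} := by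
    rw [hS, ← mono_univ, ← mono_mul_mono]; rfl
  constructor
  nth_rw 2 [this]
  rw [monSet_mono]
  exact this

theorem not_isId_of_mem {J : Submodule k (RedIncAlg k r)} [h : IsMonomialRightIdeal k J]
    {α : Quotient r} (hα : α ∈ monSet J) : ¬ IsId α := by
  have := h.le_augIdeal hα
  rw [augIdeal_eq_mono] at this
  exact xi_mem_mono_iff.1 this

theorem rightClosed_monSet (J : Submodule k (RedIncAlg k r)) [IsRightIdeal J] :
    RightClosed (monSet J) := fun α hα β γ h => by
  have := IsRightIdeal.mul_mem (xi k α) hα (xi k β)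
  rwa [xi_mul_xi, mulXi_eq h] at this

/-- Identifies the I-adic filtration of J with the levels of its set of monomials; therefore `rk` is
the filtration order of a monomial. -/
theorem mul_pow_augIdeal (J : Submodule k (RedIncAlg k r)) [hJ : IsMonomial J] (d : ℕ) :
    J * augIdeal k r ^ d = mono k (lev (monSet J) d) := by
  induction d with
  | zero => rw [pow_zero, mul_one]; exact hJ.eq_mono
  | succ d ih =>
    rw [pow_succ, ← mul_assoc, ih, augIdeal_eq_mono, mono_mul_mono]
    rfl

/-- The coordinate projection onto the span of the basis vectors satisfying `p`. -/
def fil {ι : Type*} (p : ι → Prop) : (ι →₀ k) →ₗ[k] (ι →₀ k) :=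
  open Classical in
  Finsupp.linearCombination k fun i => if p i then Finsupp.single i 1 else 0

theorem fil_single {ι : Type*} (p : ι → Prop) [DecidablePred p] (i : ι) :
    fil p (Finsupp.single i (1 : k)) = if p i then Finsupp.single i 1 else 0 := by
  rw [fil, Finsupp.linearCombination_single, one_smul]
  congr

theorem fil_of_pos {ι : Type*} {p : ι → Prop} {i : ι} (h : p i) :
    fil p (Finsupp.single i (1 : k)) = Finsupp.single i 1 := by
  classical rw [fil_single, if_pos h]

theorem fil_of_neg {ι : Type*} {p : ι → Prop} {i : ι} (h : ¬ p i) :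
    fil p (Finsupp.single i (1 : k)) = 0 := by
  classical rw [fil_single, if_neg h]

/-- Induction for elements supported on a set. -/
theorem supported_induction {ι : Type*} {S : Set ι} {motive : (ι →₀ k) → Prop}
    {f : ι →₀ k} (hf : f ∈ Finsupp.supported k k S)
    (single : ∀ i ∈ S, motive (Finsupp.single i 1)) (zero : motive 0)
    (add : ∀ a b, motive a → motive b → motive (a + b))
    (smul : ∀ (c : k) a, motive a → motive (c • a)) : motive f := by
  rw [Finsupp.supported_eq_span_single] at hf
  induction hf using Submodule.span_induction with
  | mem x hx => obtain ⟨i, hi, rfl⟩ := hx; exact single i hi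
  | zero => exact zero
  | add x y _ _ hx hy => exact add x y hx hy
  | smul c x _ hx => exact smul c x hx

/-- Two linear maps agree on an element supported on `S` if they agree on the basis vectors
in `S`. -/
theorem eq_of_supported {ι : Type*} {W : Type*} [AddCommGroup W] [Module k W] {S : Set ι}
    {f g : (ι →₀ k) →ₗ[k] W} (h : ∀ i ∈ S, f (Finsupp.single i 1) = g (Finsupp.single i 1))
    {x : ι →₀ k} (hx : x ∈ Finsupp.supported k k S) : f x = g x :=
  supported_induction (motive := fun x => f x = g x) hx h (by simp)
    (fun a b ha hb => by simp only [map_add, ha, hb]) (fun c a ha => by simp only [map_smul, ha])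

/-- A linear map takes an element supported on `S` into a subspace if it does so for the basis
vectors in `S`. -/
theorem map_mem_of_supported {ι : Type*} {W : Type*} [AddCommGroup W] [Module k W] {S : Set ι}
    {f : (ι →₀ k) →ₗ[k] W} {T : Submodule k W} (h : ∀ i ∈ S, f (Finsupp.single i 1) ∈ T)
    {x : ι →₀ k} (hx : x ∈ Finsupp.supported k k S) : f x ∈ T :=
  supported_induction (motive := fun x => f x ∈ T) hx h (by simp)
    (fun a b ha hb => by rw [map_add]; exact add_mem ha hb)
    (fun c a ha => by rw [map_smul]; exact Submodule.smul_mem _ c ha)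

theorem single_mem_supported {ι : Type*} {S : Set ι} {i : ι} (h : i ∈ S) :
    Finsupp.single i (1 : k) ∈ Finsupp.supported k k S :=
  Finsupp.single_mem_supported k 1 h

section Basis

variable [LocallyFiniteOrder P] (J : Submodule k (RedIncAlg k r)) [IsMonomial J] [IsRightIdeal J]

/-- The coordinates of an element of `gr_I J` with respect to the basis of monomials. -/
def grCoord : GrMod (augIdeal k r) J →ₗ[k] (Quotient r →₀ k) :=
  DirectSum.toModule k ℕ _ fun d => pieceLift
    (fil (fun α => rk (monSet J) α = d) ∘ₗ coeff ∘ₗ Submodule.subtype _) fun x hx => by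
      rw [mul_pow_augIdeal, mem_mono_iff] at hx
      -- Well-definedness: a monomial in J I^(d+1) has rank greater than d, so the filter for rank d
      -- removes it.
      refine eq_of_supported (g := 0) (fun α hα => fil_of_neg ?_) hx
      exact (Nat.lt_of_succ_le (le_rk hα)).ne'

theorem grCoord_mk (d : ℕ) (x : ↥(J * augIdeal k r ^ d)) :
    grCoord J (grMk _ J d x) = fil (fun α => rk (monSet J) α = d) (coeff (x : RedIncAlg k r)) := by
  rw [grCoord, grMk, LinearMap.comp_apply, DirectSum.toModule_lof]
  rfl

theorem xi_mem_filt {α : Quotient r} {d : ℕ} (h : α ∈ lev (monSet J) d) :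
    xi k α ∈ J * augIdeal k r ^ d := by
  rw [mul_pow_augIdeal, xi_mem_mono_iff]
  exact h

open Classical in
/-- The basis of `gr_I J` formed by the classes of the monomials in `J` (zero for the other
monomials). -/
def grBasis (α : Quotient r) : GrMod (augIdeal k r) J :=
  if h : α ∈ monSet J then grMk _ J (rk (monSet J) α) ⟨xi k α, xi_mem_filt J (mem_lev_rk h)⟩ else 0

variable {J}

theorem grBasis_of_mem {α : Quotient r} (h : α ∈ monSet J) : grBasis J α =
    grMk _ J (rk (monSet J) α) ⟨xi k α, xi_mem_filt J (mem_lev_rk h)⟩ := dif_pos h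

theorem grBasis_of_notMem {α : Quotient r} (h : α ∉ monSet J) : grBasis J α = 0 := dif_neg h

/-- A monomial of J I^d survives in the d-th graded piece only if d is its exact order; otherwise it
already lies in J I^(d+1). -/
theorem grMk_xi {α : Quotient r} {d : ℕ} (h : α ∈ lev (monSet J) d) :
    grMk _ J d ⟨xi k α, xi_mem_filt J h⟩ = if rk (monSet J) α = d then grBasis J α else 0 := by
  have hα : α ∈ monSet J := (rightClosed_monSet J).lev_anti (Nat.zero_le d) h
  split_ifs with hd
  · rw [grBasis_of_mem hα]
    exact grMk_congr hd.symm _ _ rfl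
  · refine grMk_eq_zero _ (xi_mem_filt J ?_)
    exact ((rightClosed_monSet J).mem_lev_iff hα).2 (lt_of_le_of_ne (le_rk h) (Ne.symm hd))

theorem grCoord_grBasis {α : Quotient r} (h : α ∈ monSet J) :
    grCoord J (grBasis J α) = Finsupp.single α 1 := by
  rw [grBasis_of_mem h, grCoord_mk]
  exact fil_of_pos rfl

theorem grBasis_mem_grDeg (α : Quotient r) :
    grBasis J α ∈ grDeg (augIdeal k r) J (rk (monSet J) α) := by
  by_cases h : α ∈ monSet J
  · rw [grBasis_of_mem h]; exact grMk_mem _ _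
  · rw [grBasis_of_notMem h]; exact zero_mem _

variable (J) in
/-- The element of `gr_I J` with given coordinates. -/
def grComb : (Quotient r →₀ k) →ₗ[k] GrMod (augIdeal k r) J :=
  Finsupp.linearCombination k (grBasis J)

theorem grComb_single (α : Quotient r) : grComb J (Finsupp.single α 1) = grBasis J α := by
  rw [grComb, Finsupp.linearCombination_single, one_smul]

/-- Together with `grCoord_grComb` this shows that the classes of the monomials in J form a basis of
gr_I J, so that all later arguments can be made in coordinates. -/
theorem grComb_grCoord (m : GrMod (augIdeal k r) J) : grComb J (grCoord J m) = m := by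
  classical
  have : grComb J ∘ₗ grCoord J = LinearMap.id := by
    refine grHom_ext fun d x => ?_
    rw [LinearMap.comp_apply, grCoord_mk, LinearMap.id_apply]
    obtain ⟨x, hx⟩ := x
    have hx' := hx
    rw [mul_pow_augIdeal, mono] at hx'
    induction hx' using Submodule.span_induction with
    | mem x hx' =>
      obtain ⟨α, hα, rfl⟩ := hx'
      rw [coeff_xi, fil_single, grMk_xi hα]
      split_ifs
      · rw [grComb_single]
      · rw [map_zero]
    | zero => simp only [map_zero]; exact (map_zero (grMk _ J d)).symm
    | add x y hx1 hy1 hx2 hy2 =>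
      rw [← mono, ← mul_pow_augIdeal] at hx1 hy1
      simp only [map_add, hx2 hx1, hy2 hy1]
      exact (map_add (grMk _ J d) ⟨x, hx1⟩ ⟨y, hy1⟩).symm
    | smul c x hx1 hx2 =>
      rw [← mono, ← mul_pow_augIdeal] at hx1
      simp only [map_smul, hx2 hx1]
      exact (map_smul (grMk _ J d) c ⟨x, hx1⟩).symm
  exact congr($this m)

theorem grCoord_grComb {f : Quotient r →₀ k} (hf : f ∈ Finsupp.supported k k (monSet J)) :
    grCoord J (grComb J f) = f :=
  eq_of_supported (f := grCoord J ∘ₗ grComb J) (g := LinearMap.id) (fun α hα => by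
    rw [LinearMap.comp_apply, grComb_single, grCoord_grBasis hα]; rfl) hf

theorem grCoord_mem_of_grDeg {n : ℤ} {m : GrMod (augIdeal k r) J}
    (hm : m ∈ grDeg (augIdeal k r) J n) :
    grCoord J m ∈ Finsupp.supported k k {α | α ∈ monSet J ∧ (rk (monSet J) α : ℤ) = n} := by
  classical
  have : grDeg (augIdeal k r) J n ≤ (Finsupp.supported k k
      {α | α ∈ monSet J ∧ (rk (monSet J) α : ℤ) = n}).comap (grCoord J) := by
    refine iSup₂_le fun d hd => ?_
    rintro _ ⟨⟨x, hx⟩, rfl⟩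
    rw [Submodule.mem_comap, grCoord_mk]
    rw [mul_pow_augIdeal, mem_mono_iff] at hx
    refine map_mem_of_supported (fun α hα => ?_) hx
    rw [fil_single]
    split_ifs with h
    · exact single_mem_supported ⟨(rightClosed_monSet J).lev_anti (Nat.zero_le d) hα,
        by rw [h]; exact hd⟩
    · exact zero_mem _
  exact this hm

theorem grCoord_mem (m : GrMod (augIdeal k r) J) :
    grCoord J m ∈ Finsupp.supported k k (monSet J) := by
  have hm : m ∈ ⨆ n, grDeg (augIdeal k r) J n := by rw [iSup_grDeg]; trivial
  induction hm using Submodule.iSup_induction' with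
  | mem n m hm => exact Finsupp.supported_mono (fun α hα => hα.1) (grCoord_mem_of_grDeg hm)
  | zero => rw [map_zero]; exact zero_mem _
  | add x y _ _ hx hy => rw [map_add]; exact add_mem hx hy

theorem grMul_grBasis_of_eq {α β γ : Quotient r} (hα : α ∈ monSet J) (h : Composes r α β γ)
    (hd : rk (monSet J) γ = rk (monSet J) α + rk Set.univ β) :
    grMul _ J (grBasis J α) (grBasis ⊤ β) = grBasis J γ := by
  have hγ := rightClosed_monSet J α hα β γ h
  rw [grBasis_of_mem hα, grBasis_of_mem (J := ⊤) (α := β) trivial, grMul_mk, grBasis_of_mem hγ]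
  refine grMk_congr hd.symm _ _ ?_
  change xi k α * xi k β = xi k γ
  rw [xi_mul_xi, mulXi_eq h]

/-- By superadditivity the rank of the composite is then strictly larger than expected, so the
product falls into the next filtration step. -/
theorem grMul_grBasis_of_ne {α β γ : Quotient r} (h : Composes r α β γ)
    (hd : rk (monSet J) γ ≠ rk (monSet J) α + rk Set.univ β) :
    grMul _ J (grBasis J α) (grBasis ⊤ β) = 0 := by
  by_cases hα : α ∈ monSet J
  · have hγ := rightClosed_monSet J α hα β γ h
    rw [grBasis_of_mem hα, grBasis_of_mem (J := ⊤) (α := β) trivial, grMul_mk]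
    refine grMk_eq_zero _ ?_
    change xi k α * xi k β ∈ _
    rw [xi_mul_xi, mulXi_eq h]
    refine xi_mem_filt J (((rightClosed_monSet J).mem_lev_iff hγ).2 ?_)
    exact Nat.succ_le_of_lt (lt_of_le_of_ne (rk_add_le (rightClosed_monSet J) hα h) hd.symm)
  · rw [grBasis_of_notMem hα, LinearMap.map_zero₂]

theorem grMul_grBasis_of_not {α β : Quotient r} (h : ¬ ∃ γ, Composes r α β γ) :
    grMul _ J (grBasis J α) (grBasis ⊤ β) = 0 := by
  by_cases hα : α ∈ monSet J
  · rw [grBasis_of_mem hα, grBasis_of_mem (J := ⊤) (α := β) trivial, grMul_mk]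
    refine grMk_eq_zero _ ?_
    change xi k α * xi k β ∈ _
    rw [xi_mul_xi, mulXi_eq_zero h]
    exact zero_mem _
  · rw [grBasis_of_notMem hα, LinearMap.map_zero₂]

end Basis

section Product

variable (k) [LocallyFiniteOrder P]

open Classical in
/-- The product of a monomial of `gr_I J` and a monomial of `gr_I A`, where `S` is the set of
classes of the monomials in `J`. -/
def gprod (S : Set (Quotient r)) (α β : Quotient r) : Quotient r →₀ k :=
  if h : ∃ γ, Composes r α β γ ∧ rk S γ = rk S α + rk Set.univ β then Finsupp.single h.choose 1
  else 0

variable {k}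

theorem gprod_of_eq {S : Set (Quotient r)} {α β γ : Quotient r} (h : Composes r α β γ)
    (hd : rk S γ = rk S α + rk Set.univ β) : gprod k S α β = Finsupp.single γ 1 := by
  have h' : ∃ γ, Composes r α β γ ∧ rk S γ = rk S α + rk Set.univ β := ⟨γ, h, hd⟩
  rw [gprod, dif_pos h', h'.choose_spec.1.unique h]

theorem gprod_of_ne {S : Set (Quotient r)} {α β γ : Quotient r} (h : Composes r α β γ)
    (hd : rk S γ ≠ rk S α + rk Set.univ β) : gprod k S α β = 0 :=
  dif_neg fun ⟨_, h', hd'⟩ => hd (h.unique h' ▸ hd')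

theorem gprod_of_not {S : Set (Quotient r)} {α β : Quotient r} (h : ¬ ∃ γ, Composes r α β γ) :
    gprod k S α β = 0 :=
  dif_neg fun ⟨γ, h', _⟩ => h ⟨γ, h'⟩

theorem gprod_mem (S : Set (Quotient r)) (α β : Quotient r) : gprod k S α β ∈ Finsupp.supported k k
    {γ | Composes r α β γ ∧ rk S γ = rk S α + rk Set.univ β} := by
  by_cases h : ∃ γ, Composes r α β γ ∧ rk S γ = rk S α + rk Set.univ β
  · obtain ⟨γ, h1, h2⟩ := h
    rw [gprod_of_eq h1 h2]
    exact single_mem_supported ⟨h1, h2⟩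
  · rw [gprod, dif_neg h]
    exact zero_mem _

variable {J : Submodule k (RedIncAlg k r)} [IsMonomial J] [IsRightIdeal J]

theorem grMul_grBasis {α : Quotient r} (hα : α ∈ monSet J) (β : Quotient r) :
    grMul _ J (grBasis J α) (grBasis ⊤ β) = grComb J (gprod k (monSet J) α β) := by
  by_cases h : ∃ γ, Composes r α β γ
  · obtain ⟨γ, h⟩ := h
    by_cases hd : rk (monSet J) γ = rk (monSet J) α + rk Set.univ β
    · rw [grMul_grBasis_of_eq hα h hd, gprod_of_eq h hd, grComb_single]
    · rw [grMul_grBasis_of_ne h hd, gprod_of_ne h hd, map_zero]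
  · rw [grMul_grBasis_of_not h, gprod_of_not h, map_zero]

theorem grCoord_grMul {α : Quotient r} (hα : α ∈ monSet J) (β : Quotient r) :
    grCoord J (grMul _ J (grBasis J α) (grBasis ⊤ β)) = gprod k (monSet J) α β := by
  rw [grMul_grBasis hα, grCoord_grComb]
  exact Finsupp.supported_mono (fun γ hγ => rightClosed_monSet J α hα β γ hγ.1)
    (gprod_mem (monSet J) α β)

end Product

end Monomials
end RedInc

namespace RedInc
-- Words of classes, the bar differential and its contracting homotopy.
noncomputable section Words

variable {P : Type v} [PartialOrder P] {r : Setoid (NonemptyInterval P)} [IncidenceLaws r]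

/-- The source of a list of composable classes, or `y` for the empty list. -/
def headVtx (y : Vtx r) : List (Quotient r) → Vtx r
  | [] => y
  | β :: _ => src r β

/-- The lists of composable classes, none of them an identity, with final target `y`. -/
def IsTail (y : Vtx r) : List (Quotient r) → Prop
  | [] => True
  | β :: l => ¬ IsId β ∧ tgt r β = headVtx y l ∧ IsTail y l

/-- The nonempty lists of composable classes, none of them an identity except possibly the first
one, with final target `y`. -/
def IsWord (y : Vtx r) : List (Quotient r) → Prop
  | [] => False
  | α :: l => tgt r α = headVtx y l ∧ IsTail y l

/-- The degree of a word whose first letter is a monomial of `gr_I J`, where `S` is the set of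
classes of the monomials in `J`. -/
def wdeg : Set (Quotient r) → List (Quotient r) → ℕ
  | _, [] => 0
  | S, α :: l => rk S α + wdeg Set.univ l

/-- The first letter of the word lies in `S`. -/
def HeadIn (S : Set (Quotient r)) : List (Quotient r) → Prop
  | [] => False
  | α :: _ => α ∈ S

variable (k : Type u) [Field k]

/-- Prefixing a linear combination of letters to a linear combination of words. -/
def prefixing : (Quotient r →₀ k) →ₗ[k] (List (Quotient r) →₀ k) →ₗ[k] (List (Quotient r) →₀ k) :=
  Finsupp.linearCombination k fun α => Finsupp.lmapDomain k k (α :: ·)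

variable {k}

theorem prefixing_single (α : Quotient r) (l : List (Quotient r)) :
    prefixing k (Finsupp.single α 1) (Finsupp.single l 1) = Finsupp.single (α :: l) 1 := by
  rw [prefixing, Finsupp.linearCombination_single, one_smul, Finsupp.lmapDomain_apply,
    Finsupp.mapDomain_single]

/-- Bilinear maps on coordinate spaces agree if they agree on basis vectors. -/
theorem bilin_ext {ι κ W : Type*} [AddCommGroup W] [Module k W]
    {f g : (ι →₀ k) →ₗ[k] (κ →₀ k) →ₗ[k] W}
    (h : ∀ a b, f (Finsupp.single a 1) (Finsupp.single b 1) =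
      g (Finsupp.single a 1) (Finsupp.single b 1)) : f = g :=
  Finsupp.lhom_ext' fun a => LinearMap.ext_ring <| Finsupp.lhom_ext' fun b =>
    LinearMap.ext_ring (h a b)

theorem lin_ext {ι W : Type*} [AddCommGroup W] [Module k W] {f g : (ι →₀ k) →ₗ[k] W}
    (h : ∀ a, f (Finsupp.single a 1) = g (Finsupp.single a 1)) : f = g :=
  Finsupp.lhom_ext' fun a => LinearMap.ext_ring (h a)

theorem prefixing_mem {S : Set (Quotient r)} {T U : Set (List (Quotient r))}
    {c : Quotient r →₀ k} {f : List (Quotient r) →₀ k} (hc : c ∈ Finsupp.supported k k S)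
    (hf : f ∈ Finsupp.supported k k T) (h : ∀ α ∈ S, ∀ l ∈ T, α :: l ∈ U) :
    prefixing k c f ∈ Finsupp.supported k k U := by
  refine map_mem_of_supported (f := (prefixing k).flip f) (fun α hα => ?_) hc
  rw [LinearMap.flip_apply]
  refine map_mem_of_supported (fun l hl => ?_) hf
  rw [prefixing_single]
  exact single_mem_supported (h α hα l hl)

variable (k) [LocallyFiniteOrder P]

/-- The differential of a word. -/
def wordBd : Set (Quotient r) → List (Quotient r) → (List (Quotient r) →₀ k)
  | _, [] => 0
  | _, [_] => 0
  | S, α :: β :: l => prefixing k (gprod k S α β) (Finsupp.single l 1) -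
      prefixing k (Finsupp.single α 1) (wordBd Set.univ (β :: l))

/-- The differential of the bar complex of `gr_I J`, where `S` is the set of classes of the
monomials in `J`. -/
def barBd (S : Set (Quotient r)) : (List (Quotient r) →₀ k) →ₗ[k] (List (Quotient r) →₀ k) :=
  Finsupp.linearCombination k (wordBd k S)

open Classical in
/-- The contracting homotopy of the bar complex. -/
def barHtpy : (List (Quotient r) →₀ k) →ₗ[k] (List (Quotient r) →₀ k) :=
  Finsupp.linearCombination k fun
    | [] => 0
    | α :: l => if IsId α then 0 else Finsupp.single (idCls r (src r α) :: α :: l) 1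

variable {k}

theorem barBd_single (S : Set (Quotient r)) (l : List (Quotient r)) :
    barBd k S (Finsupp.single l 1) = wordBd k S l := by
  rw [barBd, Finsupp.linearCombination_single, one_smul]

theorem barHtpy_of_isId {α : Quotient r} (h : IsId α) (l : List (Quotient r)) :
    barHtpy k (Finsupp.single (α :: l) 1) = 0 := by
  rw [barHtpy, Finsupp.linearCombination_single, one_smul]
  exact if_pos h

theorem barHtpy_of_not {α : Quotient r} (h : ¬ IsId α) (l : List (Quotient r)) :
    barHtpy k (Finsupp.single (α :: l) 1) =
      Finsupp.single (idCls r (src r α) :: α :: l) 1 := by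
  rw [barHtpy, Finsupp.linearCombination_single, one_smul]
  exact if_neg h

/-- The words that can occur in the differential of the word `l`. -/
structure IsMerge (S : Set (Quotient r)) (y : Vtx r) (l l' : List (Quotient r)) : Prop where
  isWord : IsWord y l'
  length : l'.length + 1 = l.length
  headVtx : headVtx y l' = headVtx y l
  isTail : IsTail y l → IsTail y l'
  wdeg : wdeg S l' = wdeg S l
  headIn : HeadIn S l → HeadIn S l'

theorem IsTail.isWord {y : Vtx r} {l : List (Quotient r)} (h : IsTail y l) (hl : l ≠ []) :
    IsWord y l := by
  cases l with
  | nil => exact absurd rfl hl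
  | cons α l => exact h.2

/-- All invariants are proved in one induction because they depend on each other: prefixing a letter
needs the source of the shorter word and the absence of identities in it. The degree is preserved
because `gprod` retains only composites with additive rank. A one-letter word has no boundary, which
reflects that positive-degree elements act as zero on k_y. -/
theorem wordBd_mem {S : Set (Quotient r)} (hS : RightClosed S) {y : Vtx r}
    {l : List (Quotient r)} (hl : IsWord y l) :
    wordBd k S l ∈ Finsupp.supported k k {l' | IsMerge S y l l'} := by
  induction l generalizing S with
  | nil => exact zero_mem _
  | cons α l ih =>
    cases l with
    | nil => exact zero_mem _
    | cons β l =>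
      obtain ⟨h1, h2, h3, h4⟩ := hl
      rw [wordBd]
      refine sub_mem ?_ ?_
      · refine prefixing_mem (gprod_mem S α β) (single_mem_supported (Set.mem_singleton l)) ?_
        rintro γ ⟨hc, hd⟩ _ rfl
        exact {
          isWord := ⟨hc.tgt_eq.trans h3, h4⟩
          length := rfl
          headVtx := hc.src_eq
          isTail := fun _ => ⟨fun h => h2 (hc.isId h).2, hc.tgt_eq.trans h3, h4⟩
          wdeg := by simp only [RedInc.wdeg, hd, add_assoc]
          headIn := fun h => hS α h β γ hc }
      · have ht : IsTail y (β :: l) := ⟨h2, h3, h4⟩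
        refine prefixing_mem (single_mem_supported (Set.mem_singleton α))
          (ih rightClosed_univ (ht.isWord (List.cons_ne_nil _ _))) ?_
        rintro _ rfl l' hl'
        exact {
          isWord := ⟨h1.trans hl'.headVtx.symm, hl'.isTail ht⟩
          length := congrArg (· + 1) hl'.length
          headVtx := rfl
          isTail := fun h => ⟨h.1, h1.trans hl'.headVtx.symm, hl'.isTail ht⟩
          wdeg := congrArg (rk S _ + ·) hl'.wdeg
          headIn := id }

theorem prod_id_left (α : Quotient r) :
    gprod k Set.univ (idCls r (src r α)) α = Finsupp.single α 1 :=
  gprod_of_eq (composes_id_left.2 ⟨rfl, rfl⟩) (by rw [rk_univ_of_isId (isId_idCls _), zero_add])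

theorem prod_id_right (S : Set (Quotient r)) (α : Quotient r) :
    gprod k S α (idCls r (tgt r α)) = Finsupp.single α 1 :=
  gprod_of_eq (composes_id_right.2 ⟨rfl, rfl⟩) (by rw [rk_univ_of_isId (isId_idCls _), add_zero])

/-- Every word in the boundary of a word without identities again starts with a non-identity and has
the same source, so the homotopy puts the same identity in front of all of them. -/
theorem prefixing_id_wordBd {y : Vtx r} {l : List (Quotient r)} (hl : IsTail y l) :
    barHtpy k (wordBd k Set.univ l) =
      prefixing k (Finsupp.single (idCls r (headVtx y l)) 1) (wordBd k Set.univ l) := by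
  cases l with
  | nil => rw [wordBd, map_zero, map_zero]
  | cons α l =>
    refine eq_of_supported (fun l' hl' => ?_)
      (wordBd_mem rightClosed_univ (hl.isWord (List.cons_ne_nil _ _)))
    have h1 := hl'.isTail hl
    have h2 := hl'.headVtx
    cases l' with
    | nil => exact absurd hl'.isWord id
    | cons β l' =>
      rw [barHtpy_of_not h1.1, prefixing_single, ← h2]
      rfl

/-- In the boundary of id, α, l the first merge returns α, l, and the remaining terms carry the
opposite sign of the homotopy applied to the boundary of α, l. -/
theorem barHtpy_tail {y : Vtx r} {l : List (Quotient r)} (hl : IsTail y l) (h0 : l ≠ []) :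
    barBd k Set.univ (barHtpy k (Finsupp.single l 1)) + barHtpy k (wordBd k Set.univ l) =
      Finsupp.single l 1 := by
  rw [prefixing_id_wordBd hl]
  cases l with
  | nil => exact absurd rfl h0
  | cons α l =>
    rw [barHtpy_of_not hl.1, barBd_single, wordBd, prod_id_left, prefixing_single]
    exact sub_add_cancel _ _

theorem barHtpy_prefixing_of_isId {α : Quotient r} (h : IsId α) (v : List (Quotient r) →₀ k) :
    barHtpy k (prefixing k (Finsupp.single α 1) v) = 0 := by
  have : barHtpy k ∘ₗ prefixing k (Finsupp.single α 1) = 0 := lin_ext fun l => by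
    rw [LinearMap.comp_apply, prefixing_single, barHtpy_of_isId h]; rfl
  exact congr($this v)

/-- If the first letter is an identity, the homotopy kills the word and all boundary terms that
still start with that identity; only the merge of the identity with the second letter survives, and
it reproduces the word. A one-letter identity word is excluded: it is not a boundary but maps to the
generator of k_y. -/
theorem barHtpy_word {y : Vtx r} {l : List (Quotient r)} (hl : IsWord y l) (h : 2 ≤ l.length) :
    barBd k Set.univ (barHtpy k (Finsupp.single l 1)) + barHtpy k (wordBd k Set.univ l) =
      Finsupp.single l 1 := by
  match l, hl, h with
  | α :: β :: l, hl, _ =>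
    by_cases hα : IsId α
    · obtain ⟨v, rfl⟩ := hα
      have h1 : src r β = v := by have := hl.1; rw [tgt_idCls] at this; exact this.symm
      subst h1
      rw [barHtpy_of_isId (isId_idCls _), map_zero, zero_add, wordBd, map_sub, prod_id_left,
        prefixing_single, barHtpy_of_not hl.2.1, barHtpy_prefixing_of_isId (isId_idCls _), sub_zero]
    · exact barHtpy_tail (y := y) ⟨hα, hl⟩ (List.cons_ne_nil _ _)

/-- The basis of `gr_I A` formed by the classes of the monomials. -/
def ringBasis (α : Quotient r) : GrAlg k r := grBasis (⊤ : Submodule k (RedIncAlg k r)) α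

variable (k r) in
/-- The coordinates with respect to the basis of monomials of `gr_I A`. -/
def ringCoord : GrAlg k r →ₗ[k] (Quotient r →₀ k) := grCoord (⊤ : Submodule k (RedIncAlg k r))

variable (k r) in
/-- The element of `gr_I A` with given coordinates. -/
def ringComb : (Quotient r →₀ k) →ₗ[k] GrAlg k r := grComb (⊤ : Submodule k (RedIncAlg k r))

theorem ringComb_ringCoord (s : GrAlg k r) : ringComb r k (ringCoord r k s) = s :=
  grComb_grCoord (J := ⊤) s

theorem ringCoord_ringComb (c : Quotient r →₀ k) : ringCoord r k (ringComb r k c) = c :=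
  grCoord_grComb (J := ⊤) (by rw [monSet_top, Finsupp.supported_univ]; trivial)

theorem ringComb_single (α : Quotient r) :
    ringComb r k (Finsupp.single α 1) = ringBasis α := grComb_single (J := ⊤) α

theorem ringCoord_ringBasis (α : Quotient r) :
    ringCoord r k (ringBasis α) = Finsupp.single α 1 := grCoord_grBasis (J := ⊤) trivial

theorem ringBasis_mul (α β : Quotient r) :
    (ringBasis α * ringBasis β : GrAlg k r) = ringComb r k (gprod k Set.univ α β) :=
  grMul_grBasis (J := ⊤) (α := α) trivial β

/-- The left multiplication by `s` on the first letter of a word. -/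
def headAct : GrAlg k r →ₗ[k] (List (Quotient r) →₀ k) →ₗ[k] (List (Quotient r) →₀ k) :=
  LinearMap.flip <| Finsupp.linearCombination k fun
    | [] => 0
    | β :: l => (prefixing k).flip (Finsupp.single l 1) ∘ₗ ringCoord r k ∘ₗ
        LinearMap.mulRight k (ringBasis β)

theorem headAct_nil (s : GrAlg k r) : headAct s (Finsupp.single [] (1 : k)) = 0 := by
  rw [headAct, LinearMap.flip_apply, Finsupp.linearCombination_single, one_smul]
  rfl

theorem headAct_cons (s : GrAlg k r) (β : Quotient r) (l : List (Quotient r)) :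
    headAct s (Finsupp.single (β :: l) (1 : k)) =
      prefixing k (ringCoord r k (s * ringBasis β)) (Finsupp.single l 1) := by
  rw [headAct, LinearMap.flip_apply, Finsupp.linearCombination_single, one_smul]
  rfl

theorem headAct_prefixing (s : GrAlg k r) (c : Quotient r →₀ k) (v : List (Quotient r) →₀ k) :
    headAct s (prefixing k c v) = prefixing k (ringCoord r k (s * ringComb r k c)) v := by
  have : (prefixing k).compr₂ (headAct s) =
      prefixing k ∘ₗ ringCoord r k ∘ₗ LinearMap.mulLeft k s ∘ₗ ringComb r k :=
    bilin_ext fun β l => by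
      rw [LinearMap.compr₂_apply, prefixing_single, headAct_cons]
      simp only [LinearMap.comp_apply, ringComb_single]
      rfl
  exact congr($this c v)

theorem barBd_prefixing_nil (S : Set (Quotient r)) (c : Quotient r →₀ k) :
    barBd k S (prefixing k c (Finsupp.single [] 1)) = 0 := by
  have : barBd k S ∘ₗ (prefixing k).flip (Finsupp.single [] 1) = 0 := lin_ext fun α => by
    rw [LinearMap.comp_apply, LinearMap.flip_apply, prefixing_single, barBd_single]
    rfl
  exact congr($this c)

theorem barBd_prefixing_cons (c : Quotient r →₀ k) (β : Quotient r) (l : List (Quotient r)) :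
    barBd k Set.univ (prefixing k c (Finsupp.single (β :: l) 1)) =
      prefixing k (ringCoord r k (ringComb r k c * ringBasis β)) (Finsupp.single l 1) -
        prefixing k c (wordBd k Set.univ (β :: l)) := by
  have : barBd k Set.univ ∘ₗ (prefixing k).flip (Finsupp.single (β :: l) 1) =
      (prefixing k).flip (Finsupp.single l 1) ∘ₗ ringCoord r k ∘ₗ
        LinearMap.mulRight k (ringBasis β) ∘ₗ ringComb r k -
          (prefixing k).flip (wordBd k Set.univ (β :: l)) := lin_ext fun α => by
    simp only [LinearMap.comp_apply, LinearMap.flip_apply, LinearMap.sub_apply, prefixing_single,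
      barBd_single, ringComb_single, LinearMap.mulRight_apply, ringBasis_mul, ringCoord_ringComb]
    rfl
  exact congr($this c)

/-- Linearity over R: the action changes only the first letter, so the claim reduces to
associativity of the product with the second letter. -/
theorem barBd_headAct (s : GrAlg k r) (v : List (Quotient r) →₀ k) :
    barBd k Set.univ (headAct s v) = headAct s (barBd k Set.univ v) := by
  have : barBd k Set.univ ∘ₗ headAct s = headAct s ∘ₗ barBd k Set.univ := lin_ext fun l => by
    rw [LinearMap.comp_apply, LinearMap.comp_apply, barBd_single]
    match l with
    | [] => rw [headAct_nil, wordBd, map_zero, map_zero]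
    | [α] => rw [headAct_cons, barBd_prefixing_nil, wordBd, map_zero]
    | α :: β :: l =>
      rw [headAct_cons, barBd_prefixing_cons, wordBd, map_sub, headAct_prefixing,
        headAct_prefixing, ringComb_single, ringComb_ringCoord, ← ringBasis_mul, mul_assoc]
  exact congr($this v)

theorem headAct_one {y : Vtx r} {l : List (Quotient r)} (hl : IsWord y l) :
    headAct (1 : GrAlg k r) (Finsupp.single l (1 : k)) = Finsupp.single l 1 := by
  cases l with
  | nil => exact absurd hl id
  | cons α l => rw [headAct_cons, one_mul, ringCoord_ringBasis, prefixing_single]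

theorem headAct_mul (s t : GrAlg k r) (v : List (Quotient r) →₀ k) :
    headAct (s * t) v = headAct s (headAct t v) := by
  have : headAct (s * t) = headAct s ∘ₗ headAct t := lin_ext fun l => by
    cases l with
    | nil => rw [LinearMap.comp_apply, headAct_nil, headAct_nil, map_zero]
    | cons α l =>
      rw [LinearMap.comp_apply, headAct_cons, headAct_cons, headAct_prefixing, ringComb_ringCoord,
        mul_assoc]
  exact congr($this v)

theorem headAct_ringBasis {α β : Quotient r} (l : List (Quotient r)) :
    headAct (ringBasis α) (Finsupp.single (β :: l) (1 : k)) =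
      prefixing k (gprod k Set.univ α β) (Finsupp.single l 1) := by
  rw [headAct_cons, ringBasis_mul, ringCoord_ringComb]

theorem grAlg_induction {motive : GrAlg k r → Prop} (s : GrAlg k r)
    (basis : ∀ α, motive (ringBasis α)) (zero : motive 0)
    (add : ∀ a b, motive a → motive b → motive (a + b))
    (smul : ∀ (c : k) a, motive a → motive (c • a)) : motive s := by
  rw [← ringComb_ringCoord s]
  refine supported_induction (S := Set.univ) (motive := fun c => motive (ringComb r k c))
    (by rw [Finsupp.supported_univ]; trivial)
    (fun α _ => ?_) ?_ (fun a b ha hb => ?_) fun c a ha => ?_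
  · rw [ringComb_single]; exact basis α
  · rw [map_zero]; exact zero
  · rw [map_add]; exact add _ _ ha hb
  · rw [map_smul]; exact smul _ _ ha

/-- Instead of cancelling signs, use that α, β, l is ξ_α acting on h(β, l), where h is the homotopy.
By linearity and dh = 1 - hd, its double boundary is ξ_α acting on d(β, l) - dhd(β, l). Applying dh
+ hd = 1 to d(β, l), with dd(β, l) = 0 by induction, makes this vanish. -/
theorem barBd_wordBd {y : Vtx r} {l : List (Quotient r)} (hl : IsWord y l) :
    barBd k Set.univ (wordBd k Set.univ l) = 0 := by
  induction l with
  | nil => exact absurd hl id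
  | cons α l ih =>
    cases l with
    | nil => rw [wordBd, map_zero]
    | cons β l =>
      have ht : IsTail y (β :: l) := hl.2
      have h0 := List.cons_ne_nil β l
      have h1 : headAct (ringBasis α) (barHtpy k (Finsupp.single (β :: l) 1)) =
          Finsupp.single (α :: β :: l) 1 := by
        have h2 : src r β = tgt r α := hl.1.symm
        rw [barHtpy_of_not ht.1, headAct_ringBasis, h2, prod_id_right, prefixing_single]
      have h3 : barBd k Set.univ (barHtpy k (Finsupp.single (β :: l) 1)) =
          Finsupp.single (β :: l) 1 - barHtpy k (wordBd k Set.univ (β :: l)) :=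
        eq_sub_of_add_eq (barHtpy_tail ht h0)
      have h4 : barBd k Set.univ (barHtpy k (wordBd k Set.univ (β :: l))) +
          barHtpy k (barBd k Set.univ (wordBd k Set.univ (β :: l))) =
            wordBd k Set.univ (β :: l) := by
        refine eq_of_supported (f := barBd k Set.univ ∘ₗ barHtpy k + barHtpy k ∘ₗ barBd k Set.univ)
          (g := LinearMap.id) (fun l' hl' => ?_) (wordBd_mem rightClosed_univ (ht.isWord h0))
        simp only [LinearMap.add_apply, LinearMap.comp_apply, barBd_single]
        exact barHtpy_tail (hl'.isTail ht) fun h => by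
          have := hl'.isWord
          rw [h] at this
          exact this
      rw [ih (ht.isWord h0), map_zero, add_zero] at h4
      rw [← barBd_single, ← h1, barBd_headAct, barBd_headAct, h3, map_sub, barBd_single, h4,
        sub_self, map_zero]

end Words
end RedInc

namespace RedInc
-- The graded bar resolution of k_y.
noncomputable section BarResolution

section Graded

variable {k : Type u} [Field k] {ι : Type*}

/-- A subspace of a coordinate space that is spanned by basis vectors is graded by the degrees of
the basis vectors. -/
theorem isInternal_comap_supported {X : Type*} [AddCommGroup X] [Module k X]
    (φ : X →ₗ[k] (ι →₀ k)) (hφ : Function.Injective φ) (S : Set ι)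
    (hS : LinearMap.range φ = Finsupp.supported k k S) (D : ι → ℤ) :
    DirectSum.IsInternal fun n : ℤ => (Finsupp.supported k k {i | D i = n}).comap φ := by
  refine (DirectSum.isInternal_submodule_iff_iSupIndep_and_iSup_eq_top _).2 ⟨fun n => ?_, ?_⟩
  · rw [Submodule.disjoint_def]
    intro x hx hx'
    have h1 : ⨆ m ≠ n, (Finsupp.supported k k {i | D i = m}).comap φ ≤
        (Finsupp.supported k k {i | D i ≠ n}).comap φ :=
      iSup₂_le fun m hm => Submodule.comap_mono <| Finsupp.supported_mono fun i hi h =>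
        hm (Eq.trans (Eq.symm hi) h)
    have h2 : Disjoint (Finsupp.supported k k {i | D i = n})
        (Finsupp.supported k k {i | D i ≠ n}) :=
      Finsupp.disjoint_supported_supported (Set.disjoint_left.2 fun _ ha hb => hb ha)
    exact hφ ((Submodule.disjoint_def.1 h2 _ hx (h1 hx')).trans (map_zero φ).symm)
  · refine (Submodule.eq_top_iff').2 fun x => ?_
    have hx : φ x ∈ Finsupp.supported k k S := hS ▸ LinearMap.mem_range_self φ x
    have key : φ x ∈ (⨆ n : ℤ, (Finsupp.supported k k {i | D i = n}).comap φ).map φ := by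
      refine map_mem_of_supported (f := LinearMap.id) (fun i hi => ?_) hx
      have hi' : Finsupp.single i (1 : k) ∈ LinearMap.range φ := hS ▸ single_mem_supported hi
      obtain ⟨z, hz⟩ := hi'
      refine ⟨z, Submodule.mem_iSup_of_mem (D i) ?_, hz⟩
      rw [Submodule.mem_comap, hz]
      exact single_mem_supported rfl
    obtain ⟨z, hz, hzx⟩ := key
    exact hφ hzx ▸ hz

end Graded

variable (k : Type u) [Field k] {P : Type v} [PartialOrder P] [LocallyFiniteOrder P]
  {r : Setoid (NonemptyInterval P)} [IncidenceLaws r]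

/-- The words with `i + 1` letters and final target `y`. -/
def wordSet (y : Vtx r) (i : ℕ) : Set (List (Quotient r)) := {l | IsWord y l ∧ l.length = i + 1}

variable {k} in
-- The sets are left free so that the same support argument gives both the stability of the words
-- ending at y and the compatibility with degrees.
theorem headAct_mem_of {T U : Set (List (Quotient r))} {C : Set (Quotient r)} {s : GrAlg k r}
    (hs : ringCoord r k s ∈ Finsupp.supported k k C) (hT : ∀ l ∈ T, l ≠ [])
    (h : ∀ α ∈ C, ∀ β l, β :: l ∈ T → ∀ γ, Composes r α β γ →
      rk Set.univ γ = rk Set.univ α + rk Set.univ β → γ :: l ∈ U)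
    {x : List (Quotient r) →₀ k} (hx : x ∈ Finsupp.supported k k T) :
    headAct s x ∈ Finsupp.supported k k U := by
  rw [← ringComb_ringCoord s]
  refine map_mem_of_supported (f := headAct.flip x ∘ₗ ringComb r k) (fun α hα => ?_) hs
  rw [LinearMap.comp_apply, LinearMap.flip_apply, ringComb_single]
  refine map_mem_of_supported (fun l hl => ?_) hx
  cases l with
  | nil => exact absurd rfl (hT _ hl)
  | cons β l =>
    rw [headAct_ringBasis]
    refine prefixing_mem (gprod_mem _ _ _) (single_mem_supported (Set.mem_singleton l)) ?_
    rintro γ ⟨hc, hd⟩ _ rfl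
    exact h α hα β _ hl γ hc hd

variable {k} in
theorem headAct_mem {y : Vtx r} {i : ℕ} (s : GrAlg k r) {x : List (Quotient r) →₀ k}
    (hx : x ∈ Finsupp.supported k k (wordSet y i)) :
    headAct s x ∈ Finsupp.supported k k (wordSet y i) := by
  refine headAct_mem_of (C := Set.univ) (by rw [Finsupp.supported_univ]; trivial) ?_ ?_ hx
  · rintro _ ⟨hl, -⟩ rfl
    exact hl
  · rintro α - β l ⟨⟨h1, h2⟩, h3⟩ γ hc -
    exact ⟨⟨hc.tgt_eq.trans h1, h2⟩, h3⟩

/-- The modules of the bar resolution of `k_y`. -/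
def BarMod (y : Vtx r) (i : ℕ) : Type max u v := ↥(Finsupp.supported k k (wordSet y i))

instance (y : Vtx r) (i : ℕ) : AddCommGroup (BarMod k y i) :=
  inferInstanceAs (AddCommGroup ↥(Finsupp.supported k k (wordSet y i)))
instance (y : Vtx r) (i : ℕ) : Module k (BarMod k y i) :=
  inferInstanceAs (Module k ↥(Finsupp.supported k k (wordSet y i)))

variable {k}

/-- The underlying combination of words of an element of the bar resolution. -/
def barVal (y : Vtx r) (i : ℕ) : BarMod k y i →ₗ[k] (List (Quotient r) →₀ k) :=
  (Finsupp.supported k k (wordSet y i)).subtype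

theorem barVal_mem {y : Vtx r} {i : ℕ} (x : BarMod k y i) :
    barVal y i x ∈ Finsupp.supported k k (wordSet y i) := x.2

theorem barVal_injective {y : Vtx r} {i : ℕ} : Function.Injective (barVal (k := k) y i) :=
  Subtype.val_injective

/-- The element of the bar resolution with given underlying combination of words. -/
def barMk {y : Vtx r} {i : ℕ} (x : List (Quotient r) →₀ k)
    (hx : x ∈ Finsupp.supported k k (wordSet y i)) : BarMod k y i := ⟨x, hx⟩

theorem barVal_barMk {y : Vtx r} {i : ℕ} (x : List (Quotient r) →₀ k)
    (hx : x ∈ Finsupp.supported k k (wordSet y i)) : barVal y i (barMk x hx) = x := rfl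

theorem headAct_one_of_mem {y : Vtx r} {i : ℕ} {x : List (Quotient r) →₀ k}
    (hx : x ∈ Finsupp.supported k k (wordSet y i)) : headAct (1 : GrAlg k r) x = x :=
  eq_of_supported (g := LinearMap.id) (fun _ hl => headAct_one hl.1) hx

instance (y : Vtx r) (i : ℕ) : Module (GrAlg k r) (BarMod k y i) where
  smul s x := barMk (headAct s (barVal y i x)) (headAct_mem s (barVal_mem x))
  one_smul x := barVal_injective (headAct_one_of_mem (barVal_mem x))
  mul_smul s t x := barVal_injective (headAct_mul s t (barVal y i x))
  smul_zero s := barVal_injective (map_zero (headAct s))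
  smul_add s x x' := barVal_injective (map_add (headAct s) (barVal y i x) (barVal y i x'))
  add_smul s t x := barVal_injective (LinearMap.map_add₂ headAct s t (barVal y i x))
  zero_smul x := barVal_injective (LinearMap.map_zero₂ headAct (barVal y i x))

theorem barVal_smul {y : Vtx r} {i : ℕ} (s : GrAlg k r) (x : BarMod k y i) :
    barVal y i (s • x) = headAct s (barVal y i x) := rfl

instance (y : Vtx r) (i : ℕ) : IsScalarTower k (GrAlg k r) (BarMod k y i) :=
  ⟨fun c s x => barVal_injective (LinearMap.map_smul₂ headAct c s (barVal y i x))⟩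

theorem barBd_mem {y : Vtx r} {i : ℕ} {x : List (Quotient r) →₀ k}
    (hx : x ∈ Finsupp.supported k k (wordSet y (i + 1))) :
    barBd k Set.univ x ∈ Finsupp.supported k k (wordSet y i) := by
  refine map_mem_of_supported (fun l hl => ?_) hx
  rw [barBd_single]
  refine Finsupp.supported_mono (fun l' hl' => ?_) (wordBd_mem rightClosed_univ hl.1)
  exact ⟨hl'.isWord, Nat.succ_injective (hl'.length.trans hl.2)⟩

theorem barHtpy_mem {y : Vtx r} {i : ℕ} {x : List (Quotient r) →₀ k}
    (hx : x ∈ Finsupp.supported k k (wordSet y i)) :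
    barHtpy k x ∈ Finsupp.supported k k (wordSet y (i + 1)) := by
  refine map_mem_of_supported (fun l hl => ?_) hx
  cases l with
  | nil => exact absurd hl.1 id
  | cons α l =>
    by_cases hα : IsId α
    · rw [barHtpy_of_isId hα]; exact zero_mem _
    · rw [barHtpy_of_not hα]
      exact single_mem_supported ⟨⟨tgt_idCls _, hα, hl.1⟩, congrArg (· + 1) hl.2⟩

/-- The differential of the bar resolution. -/
def barD (y : Vtx r) (i : ℕ) : BarMod k y (i + 1) →ₗ[GrAlg k r] BarMod k y i where
  toFun x := barMk (barBd k Set.univ (barVal y (i + 1) x)) (barBd_mem (barVal_mem x))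
  map_add' _ _ := barVal_injective (map_add (barBd k Set.univ) _ _)
  map_smul' s x := barVal_injective (barBd_headAct s (barVal y (i + 1) x))

theorem barVal_barD {y : Vtx r} {i : ℕ} (x : BarMod k y (i + 1)) :
    barVal y i (barD y i x) = barBd k Set.univ (barVal y (i + 1) x) := rfl

theorem barBd_barBd {y : Vtx r} {i : ℕ} {x : List (Quotient r) →₀ k}
    (hx : x ∈ Finsupp.supported k k (wordSet y i)) :
    barBd k Set.univ (barBd k Set.univ x) = 0 :=
  eq_of_supported (f := barBd k Set.univ ∘ₗ barBd k Set.univ) (g := 0) (fun l hl => by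
    rw [LinearMap.comp_apply, barBd_single, barBd_wordBd hl.1]; rfl) hx

/-- Words here have at least two letters, so dh + hd = 1 and every cycle is the boundary of its
image under h. -/
theorem exact_barD (y : Vtx r) (i : ℕ) :
    Function.Exact (barD (k := k) y (i + 1)) (barD y i) := by
  intro x
  constructor
  · intro hx
    refine ⟨barMk (barHtpy k (barVal y (i + 1) x)) (barHtpy_mem (barVal_mem x)),
      barVal_injective ?_⟩
    rw [barVal_barD, barVal_barMk]
    have h1 : barBd k Set.univ (barVal y (i + 1) x) = 0 := congrArg (barVal y i) hx
    have h2 := eq_of_supported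
      (f := barBd k Set.univ ∘ₗ barHtpy k + barHtpy k ∘ₗ barBd k Set.univ) (g := LinearMap.id)
      (fun l hl => by
        simp only [LinearMap.add_apply, LinearMap.comp_apply, barBd_single]
        exact barHtpy_word hl.1 (by rw [hl.2]; omega)) (barVal_mem x)
    simp only [LinearMap.add_apply, LinearMap.comp_apply, h1, map_zero, add_zero] at h2
    exact h2
  · rintro ⟨x, rfl⟩
    exact barVal_injective (barBd_barBd (barVal_mem x))

variable (k) in
/-- The embedding of the bar resolution into a free module, on combinations of words. -/
def sectionLin : (List (Quotient r) →₀ k) →ₗ[k] (List (Quotient r) →₀ GrAlg k r) :=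
  Finsupp.linearCombination k fun
    | [] => 0
    | α :: l => Finsupp.single l (ringBasis α)

theorem sectionLin_cons (α : Quotient r) (l : List (Quotient r)) :
    sectionLin k (Finsupp.single (α :: l) 1) = Finsupp.single l (ringBasis α) := by
  rw [sectionLin, Finsupp.linearCombination_single, one_smul]

theorem sectionLin_nil : sectionLin (r := r) k (Finsupp.single [] 1) = 0 := by
  rw [sectionLin, Finsupp.linearCombination_single, one_smul]

theorem sectionLin_prefixing (c : Quotient r →₀ k) (l : List (Quotient r)) :
    sectionLin k (prefixing k c (Finsupp.single l 1)) = Finsupp.single l (ringComb r k c) := by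
  have : sectionLin k ∘ₗ (prefixing k).flip (Finsupp.single l 1) =
      Finsupp.lsingle l ∘ₗ ringComb r k := lin_ext fun α => by
    rw [LinearMap.comp_apply, LinearMap.flip_apply, prefixing_single, sectionLin_cons,
      LinearMap.comp_apply, ringComb_single]
    rfl
  exact congr($this c)

theorem sectionLin_headAct (s : GrAlg k r) (x : List (Quotient r) →₀ k) :
    sectionLin k (headAct s x) = s • sectionLin k x := by
  refine supported_induction (S := Set.univ)
    (motive := fun x => sectionLin k (headAct s x) = s • sectionLin k x)
    (by rw [Finsupp.supported_univ]; trivial) (fun l _ => ?_) ?_ (fun a b ha hb => ?_)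
    fun c a ha => ?_
  · cases l with
    | nil => rw [headAct_nil, map_zero, sectionLin_nil, smul_zero]
    | cons α l =>
      rw [headAct_cons, sectionLin_prefixing, ringComb_ringCoord, sectionLin_cons,
        Finsupp.smul_single, smul_eq_mul]
  · simp only [map_zero, smul_zero]
  · simp only [map_add, smul_add, ha, hb]
  · rw [map_smul, map_smul, map_smul, ha, smul_comm]

/-- The embedding of the bar resolution into a free module. -/
def barSection (y : Vtx r) (i : ℕ) :
    BarMod k y i →ₗ[GrAlg k r] (List (Quotient r) →₀ GrAlg k r) where
  toFun x := sectionLin k (barVal y i x)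
  map_add' x x' := by rw [map_add, map_add]
  map_smul' s x := by rw [barVal_smul, sectionLin_headAct]; rfl

open Classical in
/-- The projection from a free module onto the bar resolution. -/
def barRetract (y : Vtx r) (i : ℕ) :
    (List (Quotient r) →₀ GrAlg k r) →ₗ[GrAlg k r] BarMod k y i :=
  Finsupp.linearCombination (GrAlg k r) fun l =>
    if h : idCls r (headVtx y l) :: l ∈ wordSet y i then
      barMk (Finsupp.single (idCls r (headVtx y l) :: l) 1) (single_mem_supported h) else 0

theorem barRetract_single {y : Vtx r} {i : ℕ} {l : List (Quotient r)} {α : Quotient r}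
    (h : α :: l ∈ wordSet y i) :
    barRetract y i (Finsupp.single l (ringBasis α)) =
      barMk (Finsupp.single (α :: l) (1 : k)) (single_mem_supported h) := by
  have h' : idCls r (headVtx y l) :: l ∈ wordSet y i := ⟨⟨tgt_idCls _, h.1.2⟩, h.2⟩
  refine barVal_injective ?_
  rw [barRetract, Finsupp.linearCombination_single, dif_pos h', barVal_smul, barVal_barMk,
    headAct_ringBasis, ← h.1.1, prod_id_right, prefixing_single, barVal_barMk]

theorem barRetract_barSection (y : Vtx r) (i : ℕ) :
    barRetract (k := k) y i ∘ₗ barSection y i = LinearMap.id := by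
  refine LinearMap.ext fun x => barVal_injective ?_
  refine eq_of_supported (f := barVal y i ∘ₗ (barRetract y i).restrictScalars k ∘ₗ sectionLin k)
    (g := LinearMap.id) (fun l hl => ?_) (barVal_mem x)
  cases l with
  | nil => exact absurd hl.1 id
  | cons α l =>
    rw [LinearMap.comp_apply, LinearMap.comp_apply, sectionLin_cons,
      LinearMap.coe_restrictScalars, barRetract_single hl]
    rfl

/-- X_i is a direct sum, over the tails l, of the modules R ξ_v with v the source of l. Each is a
summand of R because ξ_v is idempotent, so X_i is a retract of the free module on lists: α, l goes
to ξ_α in the coordinate l, and the basis vector of l goes back to l preceded by an identity, or to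
zero if that is not an admissible word. -/
theorem projective_barMod (y : Vtx r) (i : ℕ) : Module.Projective (GrAlg k r) (BarMod k y i) :=
  Module.Projective.of_split (barSection y i) (barRetract y i) (barRetract_barSection y i)

/-- The grading of the bar resolution. -/
def barDeg (y : Vtx r) (i : ℕ) (n : ℤ) : Submodule k (BarMod k y i) :=
  (Finsupp.supported k k {l | (wdeg Set.univ l : ℤ) = n}).comap (barVal y i)

theorem isInternal_barDeg (y : Vtx r) (i : ℕ) : DirectSum.IsInternal (barDeg (k := k) y i) :=
  isInternal_comap_supported (barVal y i) barVal_injective (wordSet y i)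
    (Submodule.range_subtype _) fun l => (wdeg Set.univ l : ℤ)

theorem mem_barDeg {y : Vtx r} {i : ℕ} {n : ℤ} {x : BarMod k y i} : x ∈ barDeg y i n ↔
    barVal y i x ∈ Finsupp.supported k k {l | (wdeg Set.univ l : ℤ) = n} := Iff.rfl

theorem mem_barDeg' {y : Vtx r} {i : ℕ} {n : ℤ} {x : BarMod k y i} : x ∈ barDeg y i n ↔
    barVal y i x ∈ Finsupp.supported k k {l | l ∈ wordSet y i ∧ (wdeg Set.univ l : ℤ) = n} := by
  rw [mem_barDeg]
  constructor
  · intro h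
    have := Submodule.mem_inf.2 ⟨barVal_mem x, h⟩
    rwa [← Finsupp.supported_inter] at this
  · exact fun h => Finsupp.supported_mono (fun l hl => hl.2) h

theorem ringCoord_mem_of_ringDeg {n : ℤ} {s : GrAlg k r} (hs : s ∈ ringDeg (augIdeal k r) n) :
    ringCoord r k s ∈ Finsupp.supported k k {α | (rk Set.univ α : ℤ) = n} :=
  Finsupp.supported_mono (fun _ h => h.2) (grCoord_mem_of_grDeg (J := ⊤) hs)

theorem smul_mem_barDeg (y : Vtx r) (i : ℕ) (a b : ℤ) (s : GrAlg k r) (x : BarMod k y i)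
    (hs : s ∈ ringDeg (augIdeal k r) a) (hx : x ∈ barDeg y i b) : s • x ∈ barDeg y i (a + b) := by
  rw [mem_barDeg'] at hx
  rw [mem_barDeg, barVal_smul]
  refine headAct_mem_of (ringCoord_mem_of_ringDeg hs) ?_ ?_ hx
  · rintro _ ⟨⟨hl, -⟩, -⟩ rfl
    exact hl
  · rintro α hα β l ⟨-, hl⟩ γ - hd
    simp only [Set.mem_ofPred_eq, wdeg, Nat.cast_add] at hα hl ⊢
    rw [hd, ← hα, ← hl, Nat.cast_add]
    ring

theorem barD_mem (y : Vtx r) (i : ℕ) (n : ℤ) (x : BarMod k y (i + 1))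
    (hx : x ∈ barDeg y (i + 1) n) : barD y i x ∈ barDeg y i n := by
  rw [mem_barDeg'] at hx
  rw [mem_barDeg, barVal_barD]
  refine map_mem_of_supported (fun l hl => ?_) hx
  rw [barBd_single]
  refine Finsupp.supported_mono (fun l' hl' => ?_) (wordBd_mem rightClosed_univ hl.1.1)
  exact (congrArg Nat.cast hl'.wdeg).trans hl.2

variable (k) in
/-- The generator of `k_y`. -/
def kGen (y : Vtx r) : kMod k r y :=
  ⟨Submodule.Quotient.mk (grOf (augIdeal k r) (xi k (idCls r y))), Submodule.mem_span_singleton_self _⟩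

theorem ringBasis_idCls (y : Vtx r) :
    (ringBasis (idCls r y) : GrAlg k r) = grOf (augIdeal k r) (xi k (idCls r y)) := by
  refine (grBasis_of_mem (J := ⊤) trivial).trans ?_
  exact grMk_congr (rk_univ_of_isId (isId_idCls y)) _ _ rfl

theorem coe_smul_kGen (y : Vtx r) (s : GrAlg k r) :
    ((s • kGen k y : kMod k r y) : A0Mod k r) =
      Submodule.Quotient.mk (s * ringBasis (idCls r y)) := by
  rw [ringBasis_idCls]
  rfl

variable (k) in
/-- The element of `gr_I A` with the same coefficients as a combination of words with one
letter. -/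
def letterVal : (List (Quotient r) →₀ k) →ₗ[k] GrAlg k r := Finsupp.lapply [] ∘ₗ sectionLin k

/-- The augmentation of the bar resolution. -/
def barAug (y : Vtx r) : BarMod k y 0 →ₗ[GrAlg k r] kMod k r y :=
  LinearMap.toSpanSingleton _ _ (kGen k y) ∘ₗ Finsupp.lapply [] ∘ₗ barSection y 0

theorem barAug_apply {y : Vtx r} (x : BarMod k y 0) :
    barAug y x = letterVal k (barVal y 0 x) • kGen k y := rfl

theorem mk_ringBasis {α : Quotient r} (h : ¬ IsId α) :
    (Submodule.Quotient.mk (ringBasis α) : A0Mod k r) = 0 := by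
  refine (Submodule.Quotient.mk_eq_zero _).2 (Submodule.subset_span
    ⟨rk Set.univ α, ?_, grBasis_mem_grDeg (J := ⊤) α⟩)
  exact_mod_cast one_le_rk_univ h

/-- The span of the non-identity monomials contains every element of positive degree, since
identities have rank 0. It is a left ideal because a composite with a non-identity is never an
identity. Hence it contains the generated ideal; `mem_irrel_iff` adds the converse. -/
theorem ringCoord_of_mem_irrel {s : GrAlg k r} (hs : s ∈ irrel k r) :
    ringCoord r k s ∈ Finsupp.supported k k {α | ¬ IsId α} := by
  have mulmem : ∀ (t s : GrAlg k r), ringCoord r k s ∈ Finsupp.supported k k {α | ¬ IsId α} →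
      ringCoord r k (t * s) ∈ Finsupp.supported k k {α | ¬ IsId α} := by
    intro t s hs
    rw [← ringComb_ringCoord s]
    refine map_mem_of_supported (f := ringCoord r k ∘ₗ LinearMap.mulLeft k t ∘ₗ ringComb r k)
      (fun β hβ => ?_) hs
    simp only [LinearMap.comp_apply, ringComb_single, LinearMap.mulLeft_apply]
    induction t using grAlg_induction with
    | basis α =>
      rw [ringBasis_mul, ringCoord_ringComb]
      exact Finsupp.supported_mono (fun γ hγ (h : IsId γ) => hβ (hγ.1.isId h).2) (gprod_mem _ _ _)
    | zero => rw [zero_mul, map_zero]; exact zero_mem _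
    | add a b ha hb => rw [add_mul, map_add]; exact add_mem ha hb
    | smul c a ha => rw [smul_mul_assoc, map_smul]; exact Submodule.smul_mem _ c ha
  rw [irrel, Ideal.span] at hs
  induction hs using Submodule.span_induction with
  | mem s hs =>
    obtain ⟨n, hn, hs⟩ := hs
    refine Finsupp.supported_mono (fun α hα h => ?_) (ringCoord_mem_of_ringDeg hs)
    simp only [Set.mem_ofPred_eq, rk_univ_of_isId h] at hα
    rw [← hα] at hn
    exact absurd hn (by simp)
  | zero => rw [map_zero]; exact zero_mem _
  | add a b _ _ ha hb => rw [map_add]; exact add_mem ha hb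
  | smul t s _ hs => exact mulmem t s hs

theorem mem_irrel_iff {s : GrAlg k r} :
    s ∈ irrel k r ↔ ringCoord r k s ∈ Finsupp.supported k k {α | ¬ IsId α} := by
  refine ⟨ringCoord_of_mem_irrel, fun h => ?_⟩
  rw [← ringComb_ringCoord s]
  refine map_mem_of_supported (T := (irrel k r).restrictScalars k) (fun α hα => ?_) h
  rw [ringComb_single]
  exact (Submodule.Quotient.mk_eq_zero _).1 (mk_ringBasis hα)

/-- The words with one letter. -/
theorem mem_wordSet_zero {y : Vtx r} {l : List (Quotient r)} (hl : l ∈ wordSet y 0) :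
    ∃ α, l = [α] ∧ tgt r α = y := by
  match l, hl with
  | [α], hl => exact ⟨α, rfl, hl.1.1⟩

/-- The words with two letters. -/
theorem mem_wordSet_one {y : Vtx r} {l : List (Quotient r)} (hl : l ∈ wordSet y 1) :
    ∃ α β, l = [α, β] ∧ ¬ IsId β := by
  match l, hl with
  | [α, β], hl => exact ⟨α, β, rfl, hl.1.2.1⟩

theorem letterVal_single (α : Quotient r) :
    letterVal k (Finsupp.single [α] 1) = ringBasis α := by
  rw [letterVal, LinearMap.comp_apply, sectionLin_cons]
  exact Finsupp.single_eq_same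

theorem letterVal_mul {y : Vtx r} {x : List (Quotient r) →₀ k}
    (hx : x ∈ Finsupp.supported k k (wordSet y 0)) :
    letterVal k x * ringBasis (idCls r y) = letterVal k x := by
  refine supported_induction
    (motive := fun x => letterVal k x * ringBasis (idCls r y) = letterVal k x) hx
    (fun l hl => ?_) ?_ (fun a b ha hb => ?_) fun c a ha => ?_
  · refine (mem_wordSet_zero hl).elim fun α hα => ?_
    rw [hα.1, letterVal_single, ringBasis_mul, ← hα.2, prod_id_right, ringComb_single]
  · rw [map_zero, zero_mul]
  · rw [map_add, add_mul, ha, hb]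
  · rw [map_smul, smul_mul_assoc, ha]

theorem barAug_eq {y : Vtx r} (x : BarMod k y 0) :
    (barAug y x : A0Mod k r) = Submodule.Quotient.mk (letterVal k (barVal y 0 x)) :=
  (congrArg Subtype.val (barAug_apply x)).trans
    ((coe_smul_kGen y _).trans (congrArg Submodule.Quotient.mk (letterVal_mul (barVal_mem x))))

theorem barAug_eq_zero_iff {y : Vtx r} {x : BarMod k y 0} : barAug y x = 0 ↔
    ringCoord r k (letterVal k (barVal y 0 x)) ∈ Finsupp.supported k k {α | ¬ IsId α} := by
  rw [← mem_irrel_iff, ← Submodule.Quotient.mk_eq_zero, ← barAug_eq]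
  exact Subtype.ext_iff

theorem barAug_mem (y : Vtx r) (n : ℤ) (x : BarMod k y 0) (hx : x ∈ barDeg y 0 n) :
    barAug y x ∈ zeroDeg k (kMod k r y) n := by
  by_cases hn : n = 0
  · rw [zeroDeg, if_pos hn]; trivial
  rw [zeroDeg, if_neg hn, Submodule.mem_bot, barAug_eq_zero_iff]
  rw [mem_barDeg'] at hx
  refine map_mem_of_supported (f := ringCoord r k ∘ₗ letterVal k) (fun l hl => ?_) hx
  obtain ⟨α, rfl, -⟩ := mem_wordSet_zero hl.1
  rw [LinearMap.comp_apply, letterVal_single, ringCoord_ringBasis]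
  -- An identity has rank 0, so in a nonzero degree every letter is a non-identity and dies in A_0.
  refine single_mem_supported fun h : IsId α => hn ?_
  rw [← hl.2, wdeg, wdeg, rk_univ_of_isId h]
  rfl

theorem barAug_surjective (y : Vtx r) : Function.Surjective (barAug (k := k) y) := by
  rintro ⟨t, ht⟩
  obtain ⟨s, rfl⟩ := Submodule.mem_span_singleton.1 ht
  refine ⟨s • barMk (Finsupp.single [idCls r y] 1)
    (single_mem_supported ⟨⟨tgt_idCls y, trivial⟩, rfl⟩), Subtype.ext ?_⟩
  rw [map_smul, Submodule.coe_smul, barAug_eq, barVal_barMk, letterVal_single, ringBasis_idCls]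

theorem prefixing_letterVal {y : Vtx r} (x : BarMod k y 0) :
    prefixing k (ringCoord r k (letterVal k (barVal y 0 x))) (Finsupp.single [] 1) =
      barVal y 0 x := by
  have := eq_of_supported (f := (prefixing k).flip (Finsupp.single [] 1) ∘ₗ ringCoord r k ∘ₗ
    letterVal k) (g := LinearMap.id) (fun l hl => by
      obtain ⟨α, rfl, -⟩ := mem_wordSet_zero hl
      rw [LinearMap.comp_apply, LinearMap.comp_apply, letterVal_single, ringCoord_ringBasis,
        LinearMap.flip_apply, prefixing_single, LinearMap.id_apply]) (barVal_mem x)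
  rwa [LinearMap.comp_apply, LinearMap.comp_apply, LinearMap.flip_apply, LinearMap.id_apply] at this

theorem barBd_barHtpy_letter (α : Quotient r) (hα : ¬ IsId α) :
    barBd k Set.univ (barHtpy k (Finsupp.single [α] 1)) = Finsupp.single [α] 1 := by
  have := barHtpy_tail (k := k) (y := tgt r α) (l := [α]) ⟨hα, rfl, trivial⟩
    (List.cons_ne_nil _ _)
  rwa [wordBd, map_zero, add_zero] at this

/-- The kernel of the augmentation is spanned by one-letter words with a non-identity letter, and
for those the homotopy identity has no second term. -/
theorem barBd_barHtpy_of_barAug {y : Vtx r} (x : BarMod k y 0)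
    (hx : ringCoord r k (letterVal k (barVal y 0 x)) ∈ Finsupp.supported k k {α | ¬ IsId α}) :
    barBd k Set.univ (barHtpy k (barVal y 0 x)) = barVal y 0 x := by
  rw [← prefixing_letterVal x]
  have := eq_of_supported (f := barBd k Set.univ ∘ₗ barHtpy k ∘ₗ
    (prefixing k).flip (Finsupp.single [] 1)) (g := (prefixing k).flip (Finsupp.single [] 1))
    (fun α hα => by
      rw [LinearMap.comp_apply, LinearMap.comp_apply, LinearMap.flip_apply, prefixing_single]
      exact barBd_barHtpy_letter α hα) hx
  rwa [LinearMap.comp_apply, LinearMap.comp_apply, LinearMap.flip_apply] at this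

/-- The second letter of a two-letter word is a non-identity, hence so is any composite that occurs
in the boundary. -/
theorem ringCoord_letterVal_barBd {y : Vtx r} {x : List (Quotient r) →₀ k}
    (hx : x ∈ Finsupp.supported k k (wordSet y 1)) :
    ringCoord r k (letterVal k (barBd k Set.univ x)) ∈
      Finsupp.supported k k {α | ¬ IsId α} := by
  have := map_mem_of_supported (f := ringCoord r k ∘ₗ letterVal k ∘ₗ barBd k Set.univ)
    (T := Finsupp.supported k k {α | ¬ IsId α}) (fun l hl => by
      obtain ⟨α, β, rfl, hβ⟩ := mem_wordSet_one hl
      rw [LinearMap.comp_apply, LinearMap.comp_apply, barBd_single, wordBd, wordBd, map_zero,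
        sub_zero, letterVal, LinearMap.comp_apply, sectionLin_prefixing, Finsupp.lapply_apply,
        Finsupp.single_eq_same, ringCoord_ringComb]
      exact Finsupp.supported_mono (fun γ hγ (h : IsId γ) => hβ (hγ.1.isId h).2)
        (gprod_mem _ _ _)) hx
  rwa [LinearMap.comp_apply, LinearMap.comp_apply] at this

theorem exact_barAug (y : Vtx r) : Function.Exact (barD (k := k) y 0) (barAug y) := by
  refine fun x => Iff.trans barAug_eq_zero_iff ⟨fun hx => ?_, fun hx => ?_⟩
  · exact ⟨barMk (barHtpy k (barVal y 0 x)) (barHtpy_mem (barVal_mem x)),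
      barVal_injective (barBd_barHtpy_of_barAug x hx)⟩
  · refine hx.elim fun z hz => ?_
    rw [← hz, barVal_barD]
    exact ringCoord_letterVal_barBd (barVal_mem z)

variable (k) in
/-- The bar resolution of `k_y`. -/
def barRes (y : Vtx r) :
    GrRes k (ringDeg (augIdeal k r)) (kMod k r y) (zeroDeg k (kMod k r y)) where
  X := BarMod k y
  deg := barDeg y
  isInternal := isInternal_barDeg y
  smul_mem := smul_mem_barDeg y
  projective := projective_barMod y
  d := barD y
  d_mem := barD_mem y
  aug := barAug y
  aug_mem := barAug_mem y
  aug_surjective := barAug_surjective y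
  exact_zero := exact_barAug y
  exact_succ := exact_barD y

end BarResolution
end RedInc

namespace RedInc
-- The complex ξ_x gr_I J ⊗_R X in coordinates.
noncomputable section BarTensor

variable {k : Type u} [Field k] {P : Type v} [PartialOrder P] [LocallyFiniteOrder P]
  {r : Setoid (NonemptyInterval P)} [IncidenceLaws r]

section Action

variable {J : Submodule k (RedIncAlg k r)} [IsMonomial J] [IsRightIdeal J]

variable (J) in
/-- The product of an element of `gr_I J` with the first letter of a word. -/
def modAct : GrMod (augIdeal k r) J →ₗ[k] (List (Quotient r) →₀ k) →ₗ[k] (List (Quotient r) →₀ k) :=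
  LinearMap.flip <| Finsupp.linearCombination k fun
    | [] => 0
    | β :: l => (prefixing k).flip (Finsupp.single l 1) ∘ₗ grCoord J ∘ₗ
        (grMul (augIdeal k r) J).flip (grBasis ⊤ β)

theorem modAct_nil (m : GrMod (augIdeal k r) J) : modAct J m (Finsupp.single [] 1) = 0 := by
  rw [modAct, LinearMap.flip_apply, Finsupp.linearCombination_single, one_smul]
  rfl

theorem modAct_cons (m : GrMod (augIdeal k r) J) (β : Quotient r) (l : List (Quotient r)) :
    modAct J m (Finsupp.single (β :: l) 1) =
      prefixing k (grCoord J (grMul _ J m (grBasis ⊤ β))) (Finsupp.single l 1) := by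
  rw [modAct, LinearMap.flip_apply, Finsupp.linearCombination_single, one_smul]
  rfl

theorem modAct_prefixing (m : GrMod (augIdeal k r) J) (c : Quotient r →₀ k)
    (v : List (Quotient r) →₀ k) :
    modAct J m (prefixing k c v) = prefixing k (grCoord J (grMul _ J m (grComb ⊤ c))) v := by
  have : (prefixing k).compr₂ (modAct J m) =
      prefixing k ∘ₗ grCoord J ∘ₗ grMul _ J m ∘ₗ grComb ⊤ :=
    bilin_ext fun β l => by
      rw [LinearMap.compr₂_apply, prefixing_single, modAct_cons]
      simp only [LinearMap.comp_apply, grComb_single]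
  exact congr($this c v)

/-- Associativity of the action of gr_I A on gr_I J. This is the balancedness that lets the
coordinates descend to the tensor product over R. -/
theorem modAct_headAct (m : GrMod (augIdeal k r) J) (s : GrAlg k r)
    (v : List (Quotient r) →₀ k) :
    modAct J (grMul _ J m s) v = modAct J m (headAct s v) := by
  have : modAct J (grMul _ J m s) = modAct J m ∘ₗ headAct s := lin_ext fun l => by
    cases l with
    | nil => rw [LinearMap.comp_apply, headAct_nil, modAct_nil, map_zero]
    | cons β l =>
      rw [LinearMap.comp_apply, headAct_cons, modAct_prefixing, modAct_cons]
      refine congrArg (fun m' => prefixing k (grCoord J m') (Finsupp.single l 1)) ?_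
      exact (grMul_assoc m s (grBasis ⊤ β)).trans
        (congrArg (grMul _ J m) (ringComb_ringCoord (s * ringBasis β)).symm)
  exact congr($this v)

theorem barBd_prefixing_cons_of_mem {c : Quotient r →₀ k}
    (hc : c ∈ Finsupp.supported k k (monSet J)) (β : Quotient r) (l : List (Quotient r)) :
    barBd k (monSet J) (prefixing k c (Finsupp.single (β :: l) 1)) =
      prefixing k (grCoord J (grMul _ J (grComb J c) (grBasis ⊤ β))) (Finsupp.single l 1) -
        prefixing k c (wordBd k Set.univ (β :: l)) :=
  eq_of_supported (f := barBd k (monSet J) ∘ₗ (prefixing k).flip (Finsupp.single (β :: l) 1))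
    (g := (prefixing k).flip (Finsupp.single l 1) ∘ₗ grCoord J ∘ₗ
      (grMul _ J).flip (grBasis ⊤ β) ∘ₗ grComb J -
        (prefixing k).flip (wordBd k Set.univ (β :: l))) (fun α hα => by
      simp only [LinearMap.comp_apply, LinearMap.flip_apply, LinearMap.sub_apply, prefixing_single,
        barBd_single, grComb_single, grCoord_grMul hα]
      rfl) hc

/-- The bar differential for J differs from that for A only in the product involving the first
letter, where ranks are taken in J; the claim is again associativity. It makes `barCoord` a chain
map. -/
theorem barBd_modAct (m : GrMod (augIdeal k r) J) (v : List (Quotient r) →₀ k) :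
    barBd k (monSet J) (modAct J m v) = modAct J m (barBd k Set.univ v) := by
  have : barBd k (monSet J) ∘ₗ modAct J m = modAct J m ∘ₗ barBd k Set.univ := lin_ext fun l => by
    rw [LinearMap.comp_apply, LinearMap.comp_apply, barBd_single]
    match l with
    | [] => rw [modAct_nil, wordBd, map_zero, map_zero]
    | [α] => rw [modAct_cons, barBd_prefixing_nil, wordBd, map_zero]
    | α :: β :: l =>
      rw [modAct_cons, barBd_prefixing_cons_of_mem (grCoord_mem _), wordBd, map_sub,
        modAct_prefixing, modAct_prefixing, grComb_single, grComb_grCoord, grMul_assoc]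
      congr 5
      exact ringBasis_mul α β
  exact congr($this v)

theorem modAct_grBasis {α : Quotient r} (hα : α ∈ monSet J) (β : Quotient r)
    (l : List (Quotient r)) : modAct J (grBasis J α) (Finsupp.single (β :: l) 1) =
      prefixing k (gprod k (monSet J) α β) (Finsupp.single l 1) := by
  rw [modAct_cons, grCoord_grMul hα]

theorem modAct_mem_of {T U : Set (List (Quotient r))} {C : Set (Quotient r)}
    {m : GrMod (augIdeal k r) J} (hC : C ⊆ monSet J)
    (hm : grCoord J m ∈ Finsupp.supported k k C)
    (h : ∀ α ∈ C, ∀ β l, β :: l ∈ T → ∀ γ, Composes r α β γ →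
      rk (monSet J) γ = rk (monSet J) α + rk Set.univ β → γ :: l ∈ U)
    {x : List (Quotient r) →₀ k} (hx : x ∈ Finsupp.supported k k T) :
    modAct J m x ∈ Finsupp.supported k k U := by
  rw [← grComb_grCoord m]
  refine map_mem_of_supported (f := (modAct J).flip x ∘ₗ grComb J) (fun α hα => ?_) hm
  rw [LinearMap.comp_apply, LinearMap.flip_apply, grComb_single]
  refine map_mem_of_supported (fun l hl => ?_) hx
  cases l with
  | nil => rw [modAct_nil]; exact zero_mem _
  | cons β l =>
    rw [modAct_grBasis (hC hα)]
    refine prefixing_mem (gprod_mem _ _ _) (single_mem_supported (Set.mem_singleton l)) ?_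
    rintro γ ⟨hc, hd⟩ _ rfl
    exact h α hα β _ hl γ hc hd

end Action

section Generators

theorem barMod_induction {y : Vtx r} {i : ℕ} {motive : BarMod k y i → Prop}
    (single : ∀ l (h : l ∈ wordSet y i),
      motive (barMk (Finsupp.single l 1) (single_mem_supported h)))
    (zero : motive 0) (add : ∀ a b, motive a → motive b → motive (a + b))
    (smul : ∀ (c : k) a, motive a → motive (c • a)) (X : BarMod k y i) : motive X := by
  have : ∃ h : barVal y i X ∈ Finsupp.supported k k (wordSet y i),
      motive (barMk (barVal y i X) h) := by
    refine supported_induction (motive := fun v => ∃ h : v ∈ Finsupp.supported k k (wordSet y i),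
      motive (barMk v h)) (barVal_mem X) (fun l hl => ⟨_, single l hl⟩) ⟨zero_mem _, zero⟩ ?_ ?_
    · exact fun a b ⟨ha, ha'⟩ ⟨hb, hb'⟩ => ⟨add_mem ha hb, add _ _ ha' hb'⟩
    · exact fun c a ⟨ha, ha'⟩ => ⟨Submodule.smul_mem _ c ha, smul c _ ha'⟩
  exact this.elim fun _ h => h

open Classical in
/-- The word `l`, preceded by an identity. -/
def barGen (y : Vtx r) (i : ℕ) (l : List (Quotient r)) : BarMod k y i :=
  if h : idCls r (headVtx y l) :: l ∈ wordSet y i then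
    barMk (Finsupp.single (idCls r (headVtx y l) :: l) 1) (single_mem_supported h) else 0

theorem mem_wordSet_id {y : Vtx r} {i : ℕ} {α : Quotient r} {l : List (Quotient r)}
    (h : α :: l ∈ wordSet y i) : idCls r (headVtx y l) :: l ∈ wordSet y i :=
  ⟨⟨tgt_idCls _, h.1.2⟩, h.2⟩

theorem barVal_barGen {y : Vtx r} {i : ℕ} {α : Quotient r} {l : List (Quotient r)}
    (h : α :: l ∈ wordSet y i) : barVal y i (barGen y i l) =
      Finsupp.single (idCls r (headVtx y l) :: l) (1 : k) := by
  rw [barGen, dif_pos (mem_wordSet_id h), barVal_barMk]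

/-- Each word is its first letter times a generator that starts with an identity; thus the first
letter can be moved across the tensor sign. -/
theorem ringBasis_smul_barGen {y : Vtx r} {i : ℕ} {α : Quotient r} {l : List (Quotient r)}
    (h : α :: l ∈ wordSet y i) : (ringBasis α : GrAlg k r) • barGen (k := k) y i l =
      barMk (Finsupp.single (α :: l) 1) (single_mem_supported h) :=
  barVal_injective <| by
    rw [barVal_smul, barVal_barGen h, headAct_ringBasis, ← h.1.1, prod_id_right, prefixing_single,
      barVal_barMk]

theorem barGen_mem {y : Vtx r} {i : ℕ} {α : Quotient r} {l : List (Quotient r)}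
    (h : α :: l ∈ wordSet y i) :
    barGen (k := k) y i l ∈ barDeg y i (wdeg Set.univ l : ℤ) := by
  rw [mem_barDeg, barVal_barGen h]
  refine single_mem_supported ?_
  rw [Set.mem_ofPred_eq, wdeg, rk_univ_of_isId (isId_idCls _), zero_add]

end Generators

variable (J : Submodule k (RedIncAlg k r)) [IsMonomialRightIdeal k J]

theorem leftMul_idem_grBasis [DecidableEq (Vtx r)] (x : Vtx r) (α : Quotient r) :
    leftMul J (idem x) (grBasis J α) = if x = src r α then grBasis J α else 0 := by
  by_cases hα : α ∈ monSet J
  · rw [grBasis_of_mem hα, leftMul_mk]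
    split_ifs with h
    · refine grMk_congr rfl _ _ ?_
      change xi k (idCls r x) * xi k α = _
      rw [idem_mul_xi, if_pos h]
    · rw [← map_zero (grMk (augIdeal k r) J (rk (monSet J) α))]
      refine grMk_congr rfl _ _ ?_
      change xi k (idCls r x) * xi k α = _
      rw [idem_mul_xi, if_neg h]
      rfl
  · rw [grBasis_of_notMem hα, map_zero, ite_self]

theorem idemProj_val (x : Vtx r) (m : idemPart J x) :
    idemProj J x (m : GrMod (augIdeal k r) J) = m :=
  congr($(idemProj_idemIncl J x) m)

variable {J} in
theorem grCoord_mem_of_idemPart (x : Vtx r) (m : idemPart J x) :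
    grCoord J (m : GrMod (augIdeal k r) J) ∈ Finsupp.supported k k {α | src r α = x} := by
  classical
  have h1 : leftMul J (idem x) (m : GrMod (augIdeal k r) J) = m :=
    congrArg Subtype.val (idemProj_val J x m)
  rw [← h1]
  have h2 := grCoord_mem (m : GrMod (augIdeal k r) J)
  rw [← grComb_grCoord (m : GrMod (augIdeal k r) J)]
  refine map_mem_of_supported
    (f := grCoord J ∘ₗ (leftMul J (idem x)).restrictScalars k ∘ₗ grComb J) (fun α hα => ?_) h2
  rw [LinearMap.comp_apply, LinearMap.comp_apply, grComb_single, LinearMap.coe_restrictScalars,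
    leftMul_idem_grBasis]
  split_ifs with h
  · rw [grCoord_grBasis hα]; exact single_mem_supported h.symm
  · rw [map_zero]; exact zero_mem _

/-- The words of length `i + 1` from `x` to `y` whose first letter is a monomial in `J`. -/
def modWords (x y : Vtx r) (i : ℕ) : Set (List (Quotient r)) :=
  {l | l ∈ wordSet y i ∧ HeadIn (monSet J) l ∧ headVtx y l = x}

/-- The coordinates of an element of `ξ_x gr_I J ⊗ X_i` with respect to the basis of words. -/
def barCoord (x y : Vtx r) (i : ℕ) :
    BalTensor k (GrAlg k r) (idemPart J x) (BarMod k y i) →ₗ[k] (List (Quotient r) →₀ k) :=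
  BalTensor.lift ((modAct J ∘ₗ (idemIncl J x).restrictScalars k).compl₂ (barVal y i))
    fun m s X => modAct_headAct (idemIncl J x m) s (barVal y i X)

theorem barCoord_mk {x y : Vtx r} {i : ℕ} (m : idemPart J x) (X : BarMod k y i) :
    barCoord J x y i (Submodule.Quotient.mk (m ⊗ₜ[k] X)) =
      modAct J (m : GrMod (augIdeal k r) J) (barVal y i X) := rfl

/-- The element of `ξ_x gr_I J ⊗ X_i` with given coordinates. -/
def barComb (x y : Vtx r) (i : ℕ) :
    (List (Quotient r) →₀ k) →ₗ[k] BalTensor k (GrAlg k r) (idemPart J x) (BarMod k y i) :=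
  Finsupp.linearCombination k fun
    | [] => 0
    | α :: l => Submodule.Quotient.mk (idemProj J x (grBasis J α) ⊗ₜ[k] barGen y i l)

theorem barComb_cons (x y : Vtx r) (i : ℕ) (α : Quotient r) (l : List (Quotient r)) :
    barComb J x y i (Finsupp.single (α :: l) 1) =
      Submodule.Quotient.mk (idemProj J x (grBasis J α) ⊗ₜ[k] barGen y i l) := by
  rw [barComb, Finsupp.linearCombination_single, one_smul]

theorem barComb_prefixing (x y : Vtx r) (i : ℕ) (c : Quotient r →₀ k) (l : List (Quotient r)) :
    barComb J x y i (prefixing k c (Finsupp.single l 1)) =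
      Submodule.Quotient.mk (idemProj J x (grComb J c) ⊗ₜ[k] barGen y i l) := by
  have : barComb J x y i ∘ₗ (prefixing k).flip (Finsupp.single l 1) =
      Submodule.mkQ _ ∘ₗ (TensorProduct.mk k _ _).flip (barGen y i l) ∘ₗ
        (idemProj J x).restrictScalars k ∘ₗ grComb J := lin_ext fun α => by
    rw [LinearMap.comp_apply, LinearMap.flip_apply, prefixing_single, barComb_cons]
    simp only [LinearMap.comp_apply, grComb_single]
    rfl
  exact congr($this c)

/-- Uses m ⊗ (β, l) = mβ ⊗ (id, l): after the first letter has been moved to the left, expanding mβ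
in the monomial basis recovers the tensor. -/
theorem barComb_barCoord {x y : Vtx r} {i : ℕ}
    (t : BalTensor k (GrAlg k r) (idemPart J x) (BarMod k y i)) :
    barComb J x y i (barCoord J x y i t) = t := by
  have : barComb J x y i ∘ₗ barCoord J x y i = LinearMap.id := BalTensor.hom_ext fun m X => by
    rw [LinearMap.comp_apply, barCoord_mk, LinearMap.id_apply]
    induction X using barMod_induction with
    | single l h =>
      cases l with
      | nil => exact absurd h.1 id
      | cons β l =>
        rw [barVal_barMk, modAct_cons, barComb_prefixing, grComb_grCoord,
          ← ringBasis_smul_barGen h, ← BalTensor.mk_smul]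
        exact congrArg (fun m' : idemPart J x => Submodule.Quotient.mk (m' ⊗ₜ[k] barGen y i l))
          (idemProj_val J x (MulOpposite.op (ringBasis β : GrAlg k r) • m))
    | zero => simp only [map_zero, TensorProduct.tmul_zero, Submodule.Quotient.mk_zero]
    | add a b ha hb =>
      simp only [map_add, ha, hb, TensorProduct.tmul_add, Submodule.Quotient.mk_add]
    | smul c a ha => simp only [map_smul, ha, TensorProduct.tmul_smul, Submodule.Quotient.mk_smul]
  exact congr($this t)

theorem barCoord_injective {x y : Vtx r} {i : ℕ} : Function.Injective (barCoord J x y i) :=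
  Function.LeftInverse.injective (barComb_barCoord J)

theorem barCoord_barComb_single {x y : Vtx r} {i : ℕ} {l : List (Quotient r)}
    (hl : l ∈ modWords J x y i) :
    barCoord J x y i (barComb J x y i (Finsupp.single l 1)) = Finsupp.single l 1 := by
  classical
  cases l with
  | nil => exact absurd hl.2.1 id
  | cons α l =>
    rw [barComb_cons, barCoord_mk, barVal_barGen hl.1]
    have h1 : (idemProj J x (grBasis J α) : GrMod (augIdeal k r) J) = grBasis J α :=
      (leftMul_idem_grBasis J x α).trans (if_pos hl.2.2.symm)
    rw [h1, modAct_grBasis hl.2.1, ← hl.1.1.1, prod_id_right, prefixing_single]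

theorem barCoord_barComb {x y : Vtx r} {i : ℕ} {v : List (Quotient r) →₀ k}
    (hv : v ∈ Finsupp.supported k k (modWords J x y i)) :
    barCoord J x y i (barComb J x y i v) = v :=
  eq_of_supported (f := barCoord J x y i ∘ₗ barComb J x y i) (g := LinearMap.id)
    (fun _ hl => barCoord_barComb_single J hl) hv

theorem barCoord_mem {x y : Vtx r} {i : ℕ}
    (t : BalTensor k (GrAlg k r) (idemPart J x) (BarMod k y i)) :
    barCoord J x y i t ∈ Finsupp.supported k k (modWords J x y i) := by
  have : (Finsupp.supported k k (modWords J x y i)).mkQ ∘ₗ barCoord J x y i = 0 :=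
    BalTensor.hom_ext fun m X => by
      rw [LinearMap.comp_apply, barCoord_mk]
      refine (Submodule.Quotient.mk_eq_zero _).2 ?_
      have hm := Submodule.mem_inf.2 ⟨grCoord_mem (m : GrMod (augIdeal k r) J),
        grCoord_mem_of_idemPart x m⟩
      rw [← Finsupp.supported_inter] at hm
      refine modAct_mem_of (fun α hα => hα.1) hm ?_ (barVal_mem X)
      rintro α ⟨hα, hx⟩ β l ⟨⟨h1, h2⟩, h3⟩ γ hc -
      exact ⟨⟨⟨hc.tgt_eq.trans h1, h2⟩, h3⟩, rightClosed_monSet J α hα β γ hc, hc.src_eq.trans hx⟩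
  exact (Submodule.Quotient.mk_eq_zero _).1 congr($this t)

theorem barCoord_bd {x y : Vtx r} {i : ℕ}
    (t : BalTensor k (GrAlg k r) (idemPart J x) (BarMod k y (i + 1))) :
    barCoord J x y i ((barRes k y).bd (idemPart J x) i t) =
      barBd k (monSet J) (barCoord J x y (i + 1) t) := by
  have : barCoord J x y i ∘ₗ (barRes k y).bd (idemPart J x) i =
      barBd k (monSet J) ∘ₗ barCoord J x y (i + 1) :=
    BalTensor.hom_ext fun m X =>
      (barBd_modAct (m : GrMod (augIdeal k r) J) (barVal y (i + 1) X)).symm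
  exact congr($this t)

/-- The words of degree `j` in `modWords J x y i`. -/
def modWordsDeg (x y : Vtx r) (i : ℕ) (j : ℤ) : Set (List (Quotient r)) :=
  {l | l ∈ modWords J x y i ∧ (wdeg (monSet J) l : ℤ) = j}

/-- The internal degree of m ⊗ word is the rank of m plus the degree of the word, and the graded
product is supported on monomials for which these degrees add up. -/
theorem barCoord_mem_of_chainDeg {x y : Vtx r} {i : ℕ} {j : ℤ}
    {t : BalTensor k (GrAlg k r) (idemPart J x) (BarMod k y i)}
    (ht : t ∈ (barRes k y).chainDeg (idemDeg J x) i j) :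
    barCoord J x y i t ∈ Finsupp.supported k k (modWordsDeg J x y i j) := by
  have key : (barRes k y).chainDeg (idemDeg J x) i j ≤
      (Finsupp.supported k k (modWordsDeg J x y i j)).comap (barCoord J x y i) := by
    refine Submodule.span_le.2 ?_
    rintro _ ⟨a, b, m, X, hab, hm, hX, rfl⟩
    have hX := mem_barDeg'.1 hX
    have hm' := Submodule.mem_inf.2 ⟨grCoord_mem_of_grDeg (m := (m : GrMod (augIdeal k r) J)) hm,
      grCoord_mem_of_idemPart x m⟩
    rw [← Finsupp.supported_inter] at hm'
    refine modAct_mem_of (fun α hα => hα.1.1) hm' ?_ hX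
    rintro α ⟨⟨hα, ha⟩, hx⟩ β l ⟨⟨⟨h1, h2⟩, h3⟩, hb⟩ γ hc hd
    refine ⟨⟨⟨⟨hc.tgt_eq.trans h1, h2⟩, h3⟩, rightClosed_monSet J α hα β γ hc,
      hc.src_eq.trans hx⟩, ?_⟩
    rw [wdeg] at hb ⊢
    rw [← hab, ← ha, ← hb, hd]
    push_cast
    ring
  exact key ht

theorem barComb_mem_chainDeg {x y : Vtx r} {i : ℕ} {j : ℤ} {v : List (Quotient r) →₀ k}
    (hv : v ∈ Finsupp.supported k k (modWordsDeg J x y i j)) :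
    barComb J x y i v ∈ (barRes k y).chainDeg (idemDeg J x) i j := by
  refine map_mem_of_supported (T := (barRes k y).chainDeg (idemDeg J x) i j) (fun l hl => ?_) hv
  cases l with
  | nil => exact absurd hl.1.2.1 id
  | cons α l =>
    refine (congrArg (· ∈ (barRes k y).chainDeg (idemDeg J x) i j)
      (barComb_cons J x y i α l)).mpr ?_
    refine Submodule.subset_span ⟨rk (monSet J) α, wdeg Set.univ l, _, _, ?_,
      idemProj_deg J x _ _ (grBasis_mem_grDeg α), barGen_mem hl.1.1, rfl⟩
    rw [← hl.2, wdeg]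
    push_cast
    rfl

/-- In homological degree 0 every chain is a cycle, which agrees with the convention that one-letter
words have zero boundary. -/
theorem mem_cyc_iff {x y : Vtx r} {i : ℕ}
    (t : BalTensor k (GrAlg k r) (idemPart J x) (BarMod k y i)) :
    t ∈ (barRes k y).cyc (idemPart J x) i ↔ barBd k (monSet J) (barCoord J x y i t) = 0 := by
  cases i with
  | zero =>
    refine iff_of_true trivial (eq_of_supported (g := 0) (fun l hl => ?_) (barCoord_mem J t))
    refine (mem_wordSet_zero hl.1).elim fun α hα => ?_
    rw [barBd_single, hα.1, wordBd]
    rfl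
  | succ i =>
    rw [← barCoord_bd]
    exact (map_eq_zero_iff (barCoord J x y i) (barCoord_injective J)).symm

end BarTensor
end RedInc

namespace RedInc
-- Words as flags in intervals, and degrees as lengths of refinements.
noncomputable section Flags

variable {P : Type v} [PartialOrder P] {r : Setoid (NonemptyInterval P)}

variable (r) in
open Classical in
/-- The class of `[x, y]` if `x ≤ y`. -/
def tcls (x y : P) : Quotient r := if h : x ≤ y then cls r h else cls r (le_refl x)

theorem tcls_of_le {x y : P} (h : x ≤ y) : tcls r x y = cls r h := dif_pos h

variable (r) in
/-- The word of the successive intervals of a flag `x < z₁ < ⋯ < zₙ < y`. -/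
def flagWord (y : P) : P → List P → List (Quotient r)
  | x, [] => [tcls r x y]
  | x, z :: zs => tcls r x z :: flagWord y z zs

/-- The flags `z₁ < ⋯ < zₙ` of elements `z` of the open interval `(x, y)` such that the class of
`[x, z]` lies in `S`. -/
def IsFlag (S : Set (Quotient r)) (x y : P) (zs : List P) : Prop :=
  zs.Pairwise (· < ·) ∧ ∀ z ∈ zs, x < z ∧ z < y ∧ tcls r x z ∈ S

theorem isFlag_nil (S : Set (Quotient r)) (x y : P) : IsFlag S x y [] :=
  ⟨List.Pairwise.nil, fun _ h => absurd h List.not_mem_nil⟩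

theorem IsFlag.univ {S : Set (Quotient r)} {x y : P} {zs : List P} (h : IsFlag S x y zs) :
    IsFlag (Set.univ : Set (Quotient r)) x y zs :=
  ⟨h.1, fun z hz => ⟨(h.2 z hz).1, (h.2 z hz).2.1, trivial⟩⟩

theorem IsFlag.sublist {S : Set (Quotient r)} {x y : P} {zs us : List P} (h : IsFlag S x y zs)
    (hu : us.Sublist zs) : IsFlag S x y us :=
  ⟨h.1.sublist hu, fun z hz => h.2 z (hu.subset hz)⟩

theorem flagWord_ne_nil (x y : P) (zs : List P) : flagWord r y x zs ≠ [] := by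
  cases zs <;> exact List.cons_ne_nil _ _

theorem length_flagWord (x y : P) (zs : List P) : (flagWord r y x zs).length = zs.length + 1 := by
  induction zs generalizing x with
  | nil => rfl
  | cons z zs ih => exact congrArg (· + 1) (ih z)

variable [IncidenceLaws r]

theorem RightClosed.tcls_mem {S : Set (Quotient r)} (hS : RightClosed S) {x z w : P}
    (hz : tcls r x z ∈ S) (h1 : x ≤ z) (h2 : z ≤ w) : tcls r x w ∈ S := by
  rw [tcls_of_le (h1.trans h2)]
  rw [tcls_of_le h1] at hz
  exact hS _ hz _ _ ⟨x, z, w, h1, h2, rfl, rfl, rfl⟩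

theorem composes_tcls {x y z : P} (h1 : x ≤ y) (h2 : y ≤ z) :
    Composes r (tcls r x y) (tcls r y z) (tcls r x z) := by
  rw [tcls_of_le h1, tcls_of_le h2, tcls_of_le (h1.trans h2)]
  exact ⟨x, y, z, h1, h2, rfl, rfl, rfl⟩

theorem not_isId_tcls {x y : P} (h : x < y) : ¬ IsId (tcls r x y) := by
  rw [tcls_of_le h.le, isId_cls_iff]
  exact h.ne

theorem src_tcls (x y : P) : src r (tcls r x y) = Quotient.mk _ x := by
  rw [tcls]
  split_ifs <;> rfl

theorem tgt_tcls {x y : P} (h : x ≤ y) : tgt r (tcls r x y) = Quotient.mk _ y := by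
  rw [tcls_of_le h]; rfl

/-- Because S is closed under right composition, membership in S has to be tested only at the first
element. This mirrors words, in which only the first letter is required to lie in J. -/
theorem isFlag_cons {S : Set (Quotient r)} (hS : RightClosed S) {x y z : P} {zs : List P} :
    IsFlag S x y (z :: zs) ↔
      (x < z ∧ z < y ∧ tcls r x z ∈ S) ∧ IsFlag (Set.univ : Set (Quotient r)) z y zs := by
  constructor
  · rintro ⟨h1, h2⟩
    rw [List.pairwise_cons] at h1
    exact ⟨h2 z List.mem_cons_self, h1.2, fun w hw =>
      ⟨h1.1 w hw, (h2 w (List.mem_cons_of_mem _ hw)).2.1, trivial⟩⟩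
  · rintro ⟨hz, h1, h2⟩
    refine ⟨List.pairwise_cons.2 ⟨fun w hw => (h2 w hw).1, h1⟩, fun w hw => ?_⟩
    rcases List.mem_cons.1 hw with rfl | hw
    · exact hz
    · exact ⟨hz.1.trans (h2 w hw).1, (h2 w hw).2.1,
        hS.tcls_mem hz.2.2 hz.1.le (h2 w hw).1.le⟩

theorem headVtx_flagWord (v : Vtx r) (x y : P) (zs : List P) :
    headVtx v (flagWord r y x zs) = Quotient.mk _ x := by
  cases zs <;> exact src_tcls _ _

theorem isWord_flagWord {x y : P} (h : x ≤ y) {zs : List P}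
    (hz : IsFlag (Set.univ : Set (Quotient r)) x y zs) :
    IsWord (Quotient.mk _ y : Vtx r) (flagWord r y x zs) := by
  induction zs generalizing x with
  | nil => exact ⟨tgt_tcls h, trivial⟩
  | cons z zs ih =>
    obtain ⟨⟨h1, h2, -⟩, h3⟩ := (isFlag_cons rightClosed_univ).1 hz
    refine ⟨(tgt_tcls h1.le).trans (headVtx_flagWord _ _ _ _).symm, ?_⟩
    have h4 := ih h2.le h3
    cases zs with
    | nil => exact ⟨not_isId_tcls h2, h4⟩
    | cons w zs =>
      exact ⟨not_isId_tcls (h3.2 w List.mem_cons_self).1, h4⟩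

theorem headIn_flagWord {S : Set (Quotient r)} {x y : P} (h : tcls r x y ∈ S) {zs : List P}
    (hz : IsFlag S x y zs) : HeadIn S (flagWord r y x zs) := by
  cases zs with
  | nil => exact h
  | cons z zs => exact (hz.2 z List.mem_cons_self).2.2

/-- The class of the whole interval is the composite of the letters, and composites are unique by
order-compatibility. -/
theorem tcls_eq_of_flagWord_eq {x y x' y' : P} (h : x ≤ y) (h' : x' ≤ y') {zs zs' : List P}
    (hz : IsFlag (Set.univ : Set (Quotient r)) x y zs)
    (hz' : IsFlag (Set.univ : Set (Quotient r)) x' y' zs')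
    (e : flagWord r y x zs = flagWord r y' x' zs') : tcls r x y = tcls r x' y' := by
  induction zs generalizing x x' zs' with
  | nil =>
    cases zs' with
    | nil => exact (List.cons.inj e).1
    | cons z' zs' => exact absurd (List.cons.inj e).2.symm (flagWord_ne_nil _ _ _)
  | cons z zs ih =>
    cases zs' with
    | nil => exact absurd (List.cons.inj e).2 (flagWord_ne_nil _ _ _)
    | cons z' zs' =>
      obtain ⟨⟨h1, h2, -⟩, h3⟩ := (isFlag_cons rightClosed_univ).1 hz
      obtain ⟨⟨h1', h2', -⟩, h3'⟩ := (isFlag_cons rightClosed_univ).1 hz'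
      obtain ⟨e1, e2⟩ := List.cons.inj e
      have e3 := ih h2.le h2'.le h3 h3' e2
      have c1 := composes_tcls (r := r) h1.le h2.le
      have c2 := composes_tcls (r := r) h1'.le h2'.le
      rw [e1, e3] at c1
      exact c1.unique c2

/-- Uniqueness in the invariance axiom: the identity of [x, y] and the map that only moves z to z'
satisfy the same conditions, so they coincide. -/
theorem eq_of_tcls_eq {x y z z' : P} (h1 : x ≤ z) (h2 : z ≤ y) (h1' : x ≤ z') (h2' : z' ≤ y)
    (e1 : tcls r x z = tcls r x z') (e2 : tcls r z y = tcls r z' y) : z = z' := by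
  classical
  rw [tcls_of_le h1, tcls_of_le h1'] at e1
  rw [tcls_of_le h2, tcls_of_le h2'] at e2
  obtain ⟨τ, -, hτ⟩ := IncidenceLaws.invariance (r := r) (h1.trans h2) (h1.trans h2) rfl
  have ha : id = τ := hτ _ fun t => ⟨rfl, rfl⟩
  have hb : Function.update id ⟨z, h1, h2⟩ ⟨z', h1', h2'⟩ = τ := hτ _ fun t => by
    by_cases ht : t = ⟨z, h1, h2⟩
    · rw [ht, Function.update_self]; exact ⟨e1.symm, e2.symm⟩
    · rw [Function.update_of_ne ht]; exact ⟨rfl, rfl⟩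
  have hc := congrFun (ha.trans hb.symm) ⟨z, h1, h2⟩
  rw [Function.update_self] at hc
  exact congrArg Subtype.val hc

theorem flagWord_injective {x y : P} {zs zs' : List P}
    (hz : IsFlag (Set.univ : Set (Quotient r)) x y zs)
    (hz' : IsFlag (Set.univ : Set (Quotient r)) x y zs')
    (e : flagWord r y x zs = flagWord r y x zs') : zs = zs' := by
  induction zs generalizing x zs' with
  | nil =>
    cases zs' with
    | nil => rfl
    | cons z' zs' => exact absurd (List.cons.inj e).2.symm (flagWord_ne_nil _ _ _)
  | cons z zs ih =>
    cases zs' with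
    | nil => exact absurd (List.cons.inj e).2 (flagWord_ne_nil _ _ _)
    | cons z' zs' =>
      obtain ⟨⟨h1, h2, -⟩, h3⟩ := (isFlag_cons rightClosed_univ).1 hz
      obtain ⟨⟨h1', h2', -⟩, h3'⟩ := (isFlag_cons rightClosed_univ).1 hz'
      obtain ⟨e1, e2⟩ := List.cons.inj e
      obtain rfl : z = z' := eq_of_tcls_eq h1.le h2.le h1'.le h2'.le e1
        (tcls_eq_of_flagWord_eq h2.le h2'.le h3 h3' e2)
      rw [ih h3 h3' e2]

/-- Flags can be transported along equivalent intervals. -/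
theorem exists_flag_of_tcls_eq {x y x' y' : P} (h : x ≤ y) (h' : x' ≤ y')
    (e : tcls r x y = tcls r x' y') {zs : List P}
    (hz : IsFlag (Set.univ : Set (Quotient r)) x y zs) :
    ∃ zs', IsFlag (Set.univ : Set (Quotient r)) x' y' zs' ∧
      flagWord r y' x' zs' = flagWord r y x zs := by
  induction zs generalizing x x' with
  | nil => exact ⟨[], isFlag_nil _ _ _, congrArg (fun α => [α]) e.symm⟩
  | cons z zs ih =>
    obtain ⟨⟨h1, h2, -⟩, h3⟩ := (isFlag_cons rightClosed_univ).1 hz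
    rw [tcls_of_le h, tcls_of_le h'] at e
    -- Invariance provides the image of the first element; the rest of the flag is transported along
    -- the equivalent intervals [z, y] and [z', y'].
    obtain ⟨z', h1', h2', e1, e2⟩ := exists_between h1.le h2.le h' e
    rw [← tcls_of_le, ← tcls_of_le] at e1 e2
    obtain ⟨zs', h3', e3⟩ := ih h2.le h2' e2.symm h3
    have n1 : x' < z' := lt_of_le_of_ne h1' fun hh => not_isId_tcls (r := r) h1 <| by
      rw [← e1, tcls_of_le h1', isId_cls_iff]; exact hh
    have n2 : z' < y' := lt_of_le_of_ne h2' fun hh => not_isId_tcls (r := r) h2 <| by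
      rw [← e2, tcls_of_le h2', isId_cls_iff]; exact hh
    refine ⟨z' :: zs', (isFlag_cons rightClosed_univ).2 ⟨⟨n1, n2, trivial⟩, h3'⟩, ?_⟩
    rw [flagWord, flagWord, e1, e3]

/-- Every word without identities comes from a flag. -/
theorem exists_flag_of_isTail {v : Vtx r} {l : List (Quotient r)} (hl : IsTail v l)
    (h0 : l ≠ []) : ∃ (x y : P) (zs : List P), x < y ∧
      IsFlag (Set.univ : Set (Quotient r)) x y zs ∧ flagWord r y x zs = l ∧
        (Quotient.mk _ y : Vtx r) = v := by
  induction l with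
  | nil => exact absurd rfl h0
  | cons α l ih =>
    obtain ⟨a, b, hab, rfl⟩ := cls_surj α
    cases l with
    | nil =>
      exact ⟨a, b, [], lt_of_le_of_ne hab fun hh => hl.1 ((isId_cls_iff _).2 hh),
        isFlag_nil _ _ _, congrArg (fun α => [α]) (tcls_of_le hab), hl.2.1⟩
    | cons β l =>
      obtain ⟨c, d, zs, hcd, hz, e, hd⟩ := ih hl.2.2 (List.cons_ne_nil _ _)
      have hc : (Quotient.mk _ b : Vtx r) = Quotient.mk _ c := by
        rw [← headVtx_flagWord (r := r) v c d zs, e]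
        exact hl.2.1
      -- The first letter and the flag of the remaining letters live in unrelated intervals.
      -- Concatenation glues copies of them, and the flag is then transported into the copy of the
      -- second interval.
      obtain ⟨x', y', z', h1, h2, e1, e2⟩ := IncidenceLaws.concatenation hab hcd.le hc
      have e2' : tcls r c d = tcls r y' z' := by rw [tcls_of_le hcd.le, tcls_of_le h2, e2]
      obtain ⟨zs', hz', e3⟩ := exists_flag_of_tcls_eq hcd.le h2 e2' hz
      have n1 : x' < y' := lt_of_le_of_ne h1 fun hh => hl.1 (e1 ▸ (isId_cls_iff h1).2 hh)
      have n2 : y' < z' := lt_of_le_of_ne h2 fun hh =>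
        not_isId_tcls (r := r) hcd (by rw [e2', tcls_of_le h2, isId_cls_iff]; exact hh)
      refine ⟨x', z', y' :: zs', n1.trans n2,
        (isFlag_cons rightClosed_univ).2 ⟨⟨n1, n2, trivial⟩, hz'⟩, ?_, ?_⟩
      · rw [flagWord, tcls_of_le h1, e1, e3, e]
      · rw [← hd, ← tgt_tcls (r := r) h2, ← e2', tgt_tcls hcd.le]

/-- A flag of `(x, y)` whose word starts in `S` is a flag of elements `z` with `[x, z]` in `S`. -/
theorem IsFlag.of_headIn {S : Set (Quotient r)} (hS : RightClosed S) {x y : P} {zs : List P}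
    (hz : IsFlag (Set.univ : Set (Quotient r)) x y zs) (h : HeadIn S (flagWord r y x zs)) :
    IsFlag S x y zs := by
  cases zs with
  | nil => exact isFlag_nil _ _ _
  | cons z zs =>
    obtain ⟨⟨h1, h2, -⟩, h3⟩ := (isFlag_cons rightClosed_univ).1 hz
    exact (isFlag_cons hS).2 ⟨⟨h1, h2, h⟩, h3⟩

theorem IsFlag.append {S : Set (Quotient r)} (hS : RightClosed S) {x y z : P} {zs us : List P}
    (hxz : x < z) (hzy : z < y) (hS' : tcls r x z ∈ S) (hz : IsFlag S x z zs)
    (hu : IsFlag (Set.univ : Set (Quotient r)) z y us) : IsFlag S x y (zs ++ z :: us) := by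
  refine ⟨List.pairwise_append.2 ⟨hz.1, List.pairwise_cons.2 ⟨fun w hw => (hu.2 w hw).1, hu.1⟩,
    fun a ha b hb => ?_⟩, fun w hw => ?_⟩
  · rcases List.mem_cons.1 hb with rfl | hb
    · exact (hz.2 a ha).2.1
    · exact (hz.2 a ha).2.1.trans (hu.2 b hb).1
  · rcases List.mem_append.1 hw with hw | hw
    · exact ⟨(hz.2 w hw).1, (hz.2 w hw).2.1.trans hzy, (hz.2 w hw).2.2⟩
    · rcases List.mem_cons.1 hw with rfl | hw
      · exact ⟨hxz, hzy, hS'⟩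
      · exact ⟨hxz.trans (hu.2 w hw).1, (hu.2 w hw).2.1,
          hS.tcls_mem hS' hxz.le (hu.2 w hw).1.le⟩

/-- A class of level `d` contains a flag of length `d`. -/
theorem exists_flag_of_mem_lev {S : Set (Quotient r)} (hS : RightClosed S)
    (hS' : ∀ α ∈ S, ¬ IsId α) (d : ℕ) {x y : P} (h : x ≤ y) (hd : tcls r x y ∈ lev S d) :
    ∃ zs : List P, zs.length = d ∧ IsFlag S x y zs := by
  induction d generalizing y with
  | zero => exact ⟨[], rfl, isFlag_nil _ _ _⟩
  | succ d ih =>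
    rw [tcls_of_le h, lev_cls_iff] at hd
    obtain ⟨z, h1, h2, hz⟩ := hd
    rw [← tcls_of_le h1] at hz
    have hzS : tcls r x z ∈ S := hS.lev_anti (Nat.zero_le d) hz
    -- Since S contains no identities, the first segment is proper; this is why d non-identity
    -- factors after an element of S yield d cut points.
    have h3 : x < z := lt_of_le_of_ne h1 fun hh => hS' _ hzS <| by
      rw [tcls_of_le h1, isId_cls_iff]; exact hh
    obtain ⟨zs, hl, hf⟩ := ih h1 hz
    exact ⟨zs ++ [z], by rw [List.length_append, hl]; rfl,
      hf.append hS h3 h2 hzS (isFlag_nil _ _ _)⟩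

theorem rightClosed_not_isId : RightClosed {α : Quotient r | ¬ IsId α} :=
  fun _ hα _ _ h hγ => hα (h.isId hγ).1

/-- For the full ring the first non-identity factor plays the part of the element of S. This makes
the flag construction, which needs S to be free of identities, available for `Set.univ`. -/
theorem lev_univ_succ (d : ℕ) :
    lev (Set.univ : Set (Quotient r)) (d + 1) = lev {α : Quotient r | ¬ IsId α} d := by
  induction d with
  | zero =>
    ext γ
    constructor
    · rintro ⟨α, -, β, hβ, hc⟩
      exact fun h => hβ (hc.isId h).2
    · exact fun h => ⟨idCls r (src r γ), trivial, γ, h, composes_id_left.2 ⟨rfl, rfl⟩⟩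
  | succ d ih => rw [lev, ih, lev]

section Degree

variable [LocallyFiniteOrder P]

theorem exists_flag_rk {S : Set (Quotient r)} (hS : RightClosed S)
    (hS' : ∀ α ∈ S, ¬ IsId α) {x y : P} (h : x ≤ y) (hd : tcls r x y ∈ S) :
    ∃ zs : List P, zs.length = rk S (tcls r x y) ∧ IsFlag S x y zs :=
  exists_flag_of_mem_lev hS hS' _ h (mem_lev_rk hd)

/-- Here d factors give only d - 1 cut points, one fewer than for an ideal inside I: no element of S
precedes the factors. -/
theorem exists_flag_rk_univ {x y : P} (h : x < y) :
    ∃ zs : List P, zs.length + 1 = rk Set.univ (tcls r x y) ∧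
      IsFlag (Set.univ : Set (Quotient r)) x y zs := by
  have h1 : rk Set.univ (tcls r x y) = rk Set.univ (tcls r x y) - 1 + 1 :=
    (Nat.sub_add_cancel (one_le_rk_univ (not_isId_tcls h))).symm
  have h2 : tcls r x y ∈ lev Set.univ (rk Set.univ (tcls r x y)) := mem_lev_rk trivial
  rw [h1, lev_univ_succ] at h2
  obtain ⟨zs, hl, hz⟩ := exists_flag_of_mem_lev rightClosed_not_isId (fun _ h => h) _ h.le h2
  exact ⟨zs, by rw [hl]; exact h1.symm, hz.univ⟩

/-- Each segment is refined separately by as many points as its rank allows, and the old points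
separate the pieces; the off-by-one of each segment is made up for by these points. -/
theorem exists_refinement_univ {x y : P} (h : x < y) {zs : List P}
    (hz : IsFlag (Set.univ : Set (Quotient r)) x y zs) :
    ∃ ts : List P, zs ⊆ ts ∧ ts.length + 1 = wdeg Set.univ (flagWord r y x zs) ∧
      IsFlag (Set.univ : Set (Quotient r)) x y ts := by
  induction zs generalizing x with
  | nil =>
    obtain ⟨ts, h1, h2⟩ := exists_flag_rk_univ (r := r) h
    exact ⟨ts, List.nil_subset _, h1, h2⟩
  | cons z zs ih =>
    obtain ⟨⟨h1, h2, -⟩, h3⟩ := (isFlag_cons rightClosed_univ).1 hz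
    obtain ⟨us, hu1, hu2, hu3⟩ := ih h2 h3
    obtain ⟨ts, ht1, ht2⟩ := exists_flag_rk_univ (r := r) h1
    refine ⟨ts ++ z :: us, ?_, ?_, ht2.append rightClosed_univ h1 h2 trivial hu3⟩
    · exact List.cons_subset.2 ⟨List.mem_append_right _ List.mem_cons_self,
        fun w hw => List.mem_append_right _ (List.mem_cons_of_mem _ (hu1 hw))⟩
    · rw [flagWord, wdeg, ← ht1, ← hu2, List.length_append, List.length_cons]
      omega

/-- A flag can be refined to a flag whose length is the degree of its word. -/
theorem exists_refinement {S : Set (Quotient r)} (hS : RightClosed S)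
    (hS' : ∀ α ∈ S, ¬ IsId α) {x y : P} (h : x ≤ y) (hxy : tcls r x y ∈ S) {zs : List P}
    (hz : IsFlag S x y zs) :
    ∃ ts : List P, zs ⊆ ts ∧ ts.length = wdeg S (flagWord r y x zs) ∧ IsFlag S x y ts := by
  cases zs with
  | nil =>
    obtain ⟨ts, h1, h2⟩ := exists_flag_rk hS hS' h hxy
    exact ⟨ts, List.nil_subset _, h1, h2⟩
  | cons z zs =>
    obtain ⟨⟨h1, h2, h4⟩, h3⟩ := (isFlag_cons hS).1 hz
    obtain ⟨us, hu1, hu2, hu3⟩ := exists_refinement_univ h2 h3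
    obtain ⟨ts, ht1, ht2⟩ := exists_flag_rk hS hS' h1.le h4
    refine ⟨ts ++ z :: us, ?_, ?_, ht2.append hS h1 h2 h4 hu3⟩
    · exact List.cons_subset.2 ⟨List.mem_append_right _ List.mem_cons_self,
        fun w hw => List.mem_append_right _ (List.mem_cons_of_mem _ (hu1 hw))⟩
    · rw [flagWord, wdeg, ← ht1, ← hu2, List.length_append, List.length_cons]

theorem length_le_wdeg_univ {x y : P} (h : x < y) {zs : List P}
    (hz : IsFlag (Set.univ : Set (Quotient r)) x y zs) :
    zs.length + 1 ≤ wdeg Set.univ (flagWord r y x zs) := by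
  induction zs generalizing x with
  | nil => exact one_le_rk_univ (not_isId_tcls h)
  | cons z zs ih =>
    obtain ⟨⟨h1, h2, -⟩, h3⟩ := (isFlag_cons rightClosed_univ).1 hz
    have h4 := ih h2 h3
    have h5 := one_le_rk_univ (not_isId_tcls (r := r) h1)
    rw [flagWord, wdeg, List.length_cons]
    omega

theorem length_le_wdeg {S : Set (Quotient r)} (hS : RightClosed S) {x y : P} {zs : List P}
    (hz : IsFlag S x y zs) : zs.length ≤ wdeg S (flagWord r y x zs) := by
  cases zs with
  | nil => exact Nat.zero_le _
  | cons z zs =>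
    obtain ⟨⟨h1, h2, -⟩, h3⟩ := (isFlag_cons hS).1 hz
    have h4 := length_le_wdeg_univ h2 h3
    rw [flagWord, wdeg, List.length_cons]
    omega

/-- Deleting the first element merges the first two letters, and superadditivity of ranks bounds the
effect on the degree. -/
theorem wdeg_flagWord_cons_le {S : Set (Quotient r)} (hS : RightClosed S) {x y z : P}
    (h1 : x ≤ z) (h2 : z ≤ y) (hz : tcls r x z ∈ S) {zs : List P}
    (hf : IsFlag (Set.univ : Set (Quotient r)) z y zs) :
    wdeg S (flagWord r y x (z :: zs)) ≤ wdeg S (flagWord r y x zs) := by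
  cases zs with
  | nil =>
    have := rk_add_le hS hz (composes_tcls h1 h2)
    simpa only [flagWord, wdeg, add_zero] using this
  | cons w zs =>
    have := rk_add_le hS hz (composes_tcls h1 (hf.2 w List.mem_cons_self).1.le)
    simp only [flagWord, wdeg] at this ⊢
    omega

/-- The degree of a word increases if elements are deleted from the flag. -/
theorem wdeg_le_of_sublist {S : Set (Quotient r)} (hS : RightClosed S) {x y : P} (h : x ≤ y)
    {zs us : List P} (hz : IsFlag S x y zs) (hu : us.Sublist zs) :
    wdeg S (flagWord r y x zs) ≤ wdeg S (flagWord r y x us) := by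
  induction hu generalizing S x with
  | slnil => exact le_rfl
  | cons z hu ih =>
    obtain ⟨⟨h1, h2, h4⟩, h3⟩ := (isFlag_cons hS).1 hz
    refine (wdeg_flagWord_cons_le hS h1.le h2.le h4 h3).trans ?_
    exact ih hS h (hz.sublist (List.sublist_cons_self _ _))
  | cons_cons z hu ih =>
    obtain ⟨⟨h1, h2, h4⟩, h3⟩ := (isFlag_cons hS).1 hz
    exact Nat.add_le_add_left (ih rightClosed_univ h2.le h3) _

end Degree

end Flags
end RedInc

namespace RedInc
-- Order complexes, sequential layers and boundaries in terms of flags.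
noncomputable section FlagComplex

variable (k : Type u) [Field k] {P : Type v} [PartialOrder P]

/-- The alternating sum of the lists obtained from a list by deleting one element. -/
def listBd : List P → (List P →₀ k)
  | [] => 0
  | z :: zs => Finsupp.single zs 1 - Finsupp.lmapDomain k k (z :: ·) (listBd zs)

theorem listBd_mem (zs : List P) :
    listBd k zs ∈ Finsupp.supported k k {us | us.Sublist zs ∧ us.length + 1 = zs.length} := by
  induction zs with
  | nil => exact zero_mem _
  | cons z zs ih =>
    refine sub_mem (single_mem_supported ⟨List.sublist_cons_self _ _, rfl⟩) ?_
    refine map_mem_of_supported (fun us hus => ?_) ih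
    rw [Finsupp.lmapDomain_apply, Finsupp.mapDomain_single]
    exact single_mem_supported ⟨hus.1.cons_cons z, congrArg (· + 1) hus.2⟩

/-- The simplicial boundary, on combinations of finite sets. -/
def setBd : (Finset P →₀ k) →ₗ[k] (Finset P →₀ k) := bdry k

open Classical in
theorem setBd_single (s : Finset P) : setBd k (Finsupp.single s 1) =
    ∑ x ∈ s, (-1 : k) ^ (s.filter (· < x)).card • Finsupp.single (s.erase x) 1 := by
  rw [setBd, bdry]
  exact (Finsupp.linearCombination_single (M := FreeFin k P) k (1 : k) s).trans (one_smul k _)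

open Classical in
-- A new minimum raises the index of every other vertex by one and so reverses its sign. The
-- resulting recursion has the same shape as those of `listBd` and `wordBd`.
theorem setBd_single_insert (z : P) (s : Finset P) (h : ∀ x ∈ s, z < x) :
    setBd k (Finsupp.single (insert z s) 1) =
      Finsupp.single s 1 - Finsupp.lmapDomain k k (insert z) (setBd k (Finsupp.single s 1)) := by
  have hz : z ∉ s := fun hz => lt_irrefl z (h z hz)
  rw [setBd_single, setBd_single, Finset.sum_insert hz, Finset.erase_insert hz, map_sum,
    sub_eq_add_neg, ← Finset.sum_neg_distrib]
  congr 1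
  · have : (insert z s).filter (· < z) = ∅ := by
      refine Finset.filter_eq_empty_iff.2 fun x hx => ?_
      rcases Finset.mem_insert.1 hx with rfl | hx
      · exact lt_irrefl _
      · exact (h x hx).not_gt
    rw [this, Finset.card_empty, pow_zero, one_smul]
  · refine Finset.sum_congr rfl fun x hx => ?_
    have hne : z ≠ x := (h x hx).ne
    rw [map_smul, Finsupp.lmapDomain_apply, Finsupp.mapDomain_single,
      Finset.erase_insert_of_ne hne, Finset.filter_insert, if_pos (h x hx),
      Finset.card_insert_of_notMem fun hh => hz (Finset.mem_filter.1 hh).1, pow_succ, mul_neg_one,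
      neg_smul]

open Classical in
theorem setBd_single_toFinset {zs : List P} (h : zs.Pairwise (· < ·)) :
    setBd k (Finsupp.single zs.toFinset 1) =
      Finsupp.lmapDomain k k List.toFinset (listBd k zs) := by
  induction zs with
  | nil => rw [List.toFinset_nil, setBd_single, listBd, map_zero, Finset.sum_empty]
  | cons z zs ih =>
    rw [List.pairwise_cons] at h
    rw [List.toFinset_cons, setBd_single_insert k z _ (fun x hx => h.1 x (List.mem_toFinset.1 hx)),
      ih h.2, listBd, map_sub, Finsupp.lmapDomain_apply k k List.toFinset (Finsupp.single zs 1), Finsupp.mapDomain_single]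
    refine congrArg (Finsupp.single zs.toFinset 1 - ·) ?_
    have : Finsupp.lmapDomain k k (insert z) ∘ₗ Finsupp.lmapDomain k k List.toFinset =
        Finsupp.lmapDomain k k List.toFinset ∘ₗ Finsupp.lmapDomain k k (z :: ·) :=
      lin_ext fun us => by
        simp only [LinearMap.comp_apply, Finsupp.lmapDomain_apply, Finsupp.mapDomain_single,
          List.toFinset_cons]
    exact congr($this (listBd k zs))

theorem toFinset_injective_of_pairwise [DecidableEq P] {zs us : List P}
    (hz : zs.Pairwise (· < ·)) (hu : us.Pairwise (· < ·)) (h : zs.toFinset = us.toFinset) :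
    zs = us := by
  have hp : zs.Perm us := List.perm_of_nodup_nodup_toFinset_eq
    (hz.imp fun h => h.ne) (hu.imp fun h => h.ne) h
  exact hp.eq_of_pairwise (fun _ _ _ _ hab hba => absurd hba hab.not_gt) hz hu

/-- A minimal element of a finite chain is its least element; it becomes the head of the sorted
list. -/
theorem exists_list_of_isChain [DecidableEq P] (s : Finset P) (h : IsChain (· ≤ ·) (s : Set P)) :
    ∃ zs : List P, zs.Pairwise (· < ·) ∧ zs.toFinset = s := by
  induction s using Finset.strongInduction with
  | H s ih =>
    rcases s.eq_empty_or_nonempty with rfl | hs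
    · exact ⟨[], List.Pairwise.nil, rfl⟩
    · obtain ⟨z, hz⟩ := s.exists_minimal hs
      obtain ⟨zs, h1, h2⟩ := ih (s.erase z) (Finset.erase_ssubset hz.1)
        (h.mono (Finset.coe_subset.2 (Finset.erase_subset _ _)))
      refine ⟨z :: zs, List.pairwise_cons.2 ⟨fun x hx => ?_, h1⟩, ?_⟩
      · rw [← List.mem_toFinset, h2, Finset.mem_erase] at hx
        rcases h (Finset.mem_coe.2 hz.1) (Finset.mem_coe.2 hx.2) hx.1.symm with h3 | h3
        · exact lt_of_le_of_ne h3 hx.1.symm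
        · exact absurd (le_antisymm h3 (hz.2 hx.2 h3)) hx.1
      · rw [List.toFinset_cons, h2, Finset.insert_erase hz.1]

variable {r : Setoid (NonemptyInterval P)}

/-- The order complex of the elements `z` of the open interval `(x, y)` such that the class of
`[x, z]` lies in `S`. -/
def flagComplex (S : Set (Quotient r)) (x y : P) : ChainCx P :=
  orderComplex {z | x < z ∧ z < y ∧ tcls r x z ∈ S}

theorem restrictedInterval_eq (J : Submodule k (RedIncAlg k r)) (x y : P) :
    restrictedInterval k J x y = {z | x < z ∧ z < y ∧ tcls r x z ∈ monSet J} := by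
  ext z
  constructor
  · rintro ⟨h1, h2, h3⟩
    exact ⟨h1, h2, by rw [tcls_of_le h1.le]; exact h3⟩
  · rintro ⟨h1, h2, h3⟩
    rw [tcls_of_le h1.le] at h3
    exact ⟨h1, h2, h3⟩

theorem IsFlag.toFinset_mem [DecidableEq P] {S : Set (Quotient r)} {x y : P} {zs : List P}
    (h : IsFlag S x y zs) : zs.toFinset ∈ (flagComplex S x y).faces := by
  refine ⟨fun z hz => h.2 z (List.mem_toFinset.1 hz), ?_⟩
  intro a ha b hb hab
  have : Std.Symm fun a b : P => a ≤ b ∨ b ≤ a := ⟨fun _ _ h => h.symm⟩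
  exact (h.1.imp fun hab => Or.inl hab.le : zs.Pairwise fun a b => a ≤ b ∨ b ≤ a).forall
    (List.mem_toFinset.1 ha) (List.mem_toFinset.1 hb) hab

theorem exists_isFlag_of_mem_faces [DecidableEq P] {S : Set (Quotient r)} {x y : P}
    {s : Finset P} (h : s ∈ (flagComplex S x y).faces) :
    ∃ zs, IsFlag S x y zs ∧ zs.toFinset = s := by
  obtain ⟨zs, h1, h2⟩ := exists_list_of_isChain s h.2
  exact ⟨zs, ⟨h1, fun z hz => h.1 (Finset.mem_coe.2 (h2 ▸ List.mem_toFinset.2 hz))⟩, h2⟩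

theorem IsFlag.card_toFinset [DecidableEq P] {S : Set (Quotient r)} {x y : P} {zs : List P}
    (h : IsFlag S x y zs) : zs.toFinset.card = zs.length :=
  List.toFinset_card_of_nodup (h.1.imp fun h => h.ne)

variable [IncidenceLaws r] [LocallyFiniteOrder P]

/-- The faces of the sequential layers in terms of the degrees of words. -/
theorem toFinset_mem_layer_iff [DecidableEq P] {S : Set (Quotient r)} (hS : RightClosed S)
    (hS' : ∀ α ∈ S, ¬ IsId α) {x y : P} (h : x ≤ y) (hxy : tcls r x y ∈ S) {zs : List P}
    (hz : IsFlag S x y zs) (m : ℤ) : zs.toFinset ∈ ((flagComplex S x y).layer m).faces ↔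
      m + 1 ≤ (wdeg S (flagWord r y x zs) : ℤ) := by
  constructor
  · rintro ⟨t, ht, hzt, hm⟩
    obtain ⟨us, hu, rfl⟩ := exists_isFlag_of_mem_faces ht
    -- A face in the layer is contained in a flag us of more than m elements. The length of us is at
    -- most its degree, and passing from us to the subflag zs can only increase the degree.
    have h1 : zs.Sublist us := by
      have hs : zs.Subperm us := List.subperm_of_subset (hz.1.imp fun h => h.ne) fun w hw =>
        List.mem_toFinset.1 (hzt (List.mem_toFinset.2 hw))
      have : Std.Antisymm fun a b : P => a < b := ⟨fun a b hab hba => absurd hba hab.not_gt⟩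
      exact List.sublist_of_subperm_of_pairwise hs hz.1 hu.1
    have h2 := wdeg_le_of_sublist hS h hu h1
    have h3 := length_le_wdeg hS hu
    rw [hu.card_toFinset] at hm
    omega
  · intro hm
    -- The refinement has as many elements as the degree, hence dimension one less than the degree;
    -- this accounts for the shift m + 1.
    obtain ⟨ts, h1, h2, h3⟩ := exists_refinement hS hS' h hxy hz
    refine ⟨ts.toFinset, h3.toFinset_mem, fun w hw =>
      List.mem_toFinset.2 (h1 (List.mem_toFinset.1 hw)), ?_⟩
    rw [h3.card_toFinset, h2]
    omega

open Classical in
/-- The word of a flag if it has degree `j`, zero otherwise. -/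
def degWord (S : Set (Quotient r)) (x y : P) (j : ℤ) (zs : List P) : List (Quotient r) →₀ k :=
  if (wdeg S (flagWord r y x zs) : ℤ) = j then Finsupp.single (flagWord r y x zs) 1 else 0

variable {k}

theorem degWord_of_eq {S : Set (Quotient r)} {x y : P} {j : ℤ} {zs : List P}
    (h : (wdeg S (flagWord r y x zs) : ℤ) = j) :
    degWord k S x y j zs = Finsupp.single (flagWord r y x zs) 1 := if_pos h

theorem degWord_of_ne {S : Set (Quotient r)} {x y : P} {j : ℤ} {zs : List P}
    (h : (wdeg S (flagWord r y x zs) : ℤ) ≠ j) : degWord k S x y j zs = 0 := if_neg h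

theorem degWord_cons (S : Set (Quotient r)) (x y z : P) (j : ℤ) (zs : List P) :
    degWord k S x y j (z :: zs) = prefixing k (Finsupp.single (tcls r x z) 1)
      (degWord k Set.univ z y (j - rk S (tcls r x z)) zs) := by
  by_cases h : (wdeg S (flagWord r y x (z :: zs)) : ℤ) = j
  · have h' : (wdeg Set.univ (flagWord r y z zs) : ℤ) = j - rk S (tcls r x z) := by
      rw [← h, flagWord, wdeg]; push_cast; ring
    rw [degWord_of_eq h, degWord_of_eq h', prefixing_single, flagWord]
  · have h' : (wdeg Set.univ (flagWord r y z zs) : ℤ) ≠ j - rk S (tcls r x z) := fun h' =>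
      h (by rw [flagWord, wdeg]; push_cast; rw [h']; ring)
    rw [degWord_of_ne h, degWord_of_ne h', map_zero]

/-- By superadditivity the merged word has degree at least d, with equality exactly when the graded
product is nonzero. Thus the merges that survive are those that keep the degree. -/
theorem prefixing_gprod_tcls (S : Set (Quotient r)) {x z w : P} (h1 : x ≤ z) (h2 : z ≤ w)
    (l : List (Quotient r)) (d : ℤ) (hd : rk S (tcls r x z) + rk Set.univ (tcls r z w) +
      wdeg Set.univ l = d) [Decidable ((wdeg S (tcls r x w :: l) : ℤ) = d)] :
    prefixing k (gprod k S (tcls r x z) (tcls r z w)) (Finsupp.single l 1) =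
      if (wdeg S (tcls r x w :: l) : ℤ) = d then Finsupp.single (tcls r x w :: l) 1 else 0 := by
  by_cases h : rk S (tcls r x w) = rk S (tcls r x z) + rk Set.univ (tcls r z w)
  · rw [gprod_of_eq (composes_tcls h1 h2) h, prefixing_single, if_pos]
    rw [wdeg, ← hd, h]; push_cast; rfl
  · rw [gprod_of_ne (composes_tcls h1 h2) h, LinearMap.map_zero₂, if_neg]
    rw [wdeg, ← hd]; push_cast; omega

/-- The differential of the word of a flag. -/
theorem wordBd_flagWord {S : Set (Quotient r)} (hS : RightClosed S) {x y : P} {zs : List P}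
    (hz : IsFlag S x y zs) {j : ℤ} (hj : (wdeg S (flagWord r y x zs) : ℤ) = j) :
    wordBd k S (flagWord r y x zs) =
      Finsupp.linearCombination k (degWord k S x y j) (listBd k zs) := by
  classical
  induction zs generalizing S x j with
  | nil => rw [listBd, map_zero, flagWord, wordBd]
  | cons z zs ih =>
    obtain ⟨⟨h1, h2, h4⟩, h3⟩ := (isFlag_cons hS).1 hz
    have hj' : (wdeg Set.univ (flagWord r y z zs) : ℤ) = j - rk S (tcls r x z) := by
      rw [← hj, flagWord, wdeg]; push_cast; ring
    -- Adding a first element to flags corresponds to prefixing a letter to words, with the target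
    -- degree lowered by the rank of that letter; this matches the recursive term of both
    -- boundaries.
    have key : Finsupp.linearCombination k (degWord k S x y j) ∘ₗ
        Finsupp.lmapDomain k k (z :: ·) = prefixing k (Finsupp.single (tcls r x z) 1) ∘ₗ
          Finsupp.linearCombination k (degWord k Set.univ z y (j - rk S (tcls r x z))) :=
      lin_ext fun us => by
        simp only [LinearMap.comp_apply, Finsupp.lmapDomain_apply, Finsupp.mapDomain_single,
          Finsupp.linearCombination_single, one_smul, degWord_cons]
    have key' := congr($key (listBd k zs))
    rw [LinearMap.comp_apply, LinearMap.comp_apply, ← ih rightClosed_univ h3 hj'] at key'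
    rw [listBd, map_sub, key', Finsupp.linearCombination_single, one_smul]
    cases zs with
    | nil =>
      simp only [flagWord, wordBd]
      congr 1
      refine (prefixing_gprod_tcls S h1.le h2.le [] j ?_).trans ?_
      · rw [← hj]; simp only [flagWord, wdeg]; push_cast; ring
      · rfl
    | cons w zs =>
      have h5 := h3.2 w List.mem_cons_self
      simp only [flagWord, wordBd]
      congr 1
      refine (prefixing_gprod_tcls S h1.le h5.1.le (flagWord r y w zs) j ?_).trans ?_
      · rw [← hj]; simp only [flagWord, wdeg]; push_cast; ring
      · rfl

end FlagComplex
end RedInc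

namespace RedInc
-- Comparison of relative simplicial chains with words of fixed degree.
noncomputable section FaceWords

variable {k : Type u} [Field k] {P : Type v} [PartialOrder P]

theorem setBd_mem (Δ : ChainCx P) (n : ℤ) {c : Finset P →₀ k}
    (hc : c ∈ Finsupp.supported k k {s | s ∈ Δ.faces ∧ (s.card : ℤ) - 1 = n}) :
    setBd k c ∈ Finsupp.supported k k {s | s ∈ Δ.faces ∧ (s.card : ℤ) - 1 = n - 1} := by
  classical
  refine map_mem_of_supported (fun s hs => ?_) hc
  rw [setBd_single]
  refine sum_mem fun x hx => Submodule.smul_mem _ _ (single_mem_supported ⟨?_, ?_⟩)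
  · exact Δ.down_closed s hs.1 _ (Finset.erase_subset x s)
  · have h1 := Finset.card_erase_add_one hx
    rw [← hs.2, ← h1]
    push_cast
    ring

theorem ChainCx.mem_faces_of_mem_layer {Δ : ChainCx P} {m : ℤ} {s : Finset P}
    (h : s ∈ (Δ.layer m).faces) : s ∈ Δ.faces := by
  obtain ⟨t, ht, hst, -⟩ := h
  exact Δ.down_closed t ht s hst

variable {r : Setoid (NonemptyInterval P)} [IncidenceLaws r] [LocallyFiniteOrder P]

section General

variable (k)

open Classical in
/-- The words of degree `j` of the faces of the flag complex. -/
def faceWord (S : Set (Quotient r)) (x y : P) (j : ℤ) :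
    (Finset P →₀ k) →ₗ[k] (List (Quotient r) →₀ k) :=
  Finsupp.linearCombination k fun s =>
    if h : ∃ zs, IsFlag S x y zs ∧ zs.toFinset = s then degWord k S x y j h.choose else 0

open Classical in
/-- The faces of the flag complex that belong to words. -/
def wordFace (S : Set (Quotient r)) (x y : P) :
    (List (Quotient r) →₀ k) →ₗ[k] (Finset P →₀ k) :=
  Finsupp.linearCombination k fun l =>
    if h : ∃ zs, IsFlag S x y zs ∧ flagWord r y x zs = l then
      Finsupp.single h.choose.toFinset 1 else 0

variable {k} {S : Set (Quotient r)} {x y : P}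

open Classical in
theorem faceWord_toFinset (j : ℤ) {zs : List P} (hz : IsFlag S x y zs) :
    faceWord k S x y j (Finsupp.single zs.toFinset 1) = degWord k S x y j zs := by
  have h : ∃ us, IsFlag S x y us ∧ us.toFinset = zs.toFinset := ⟨zs, hz, rfl⟩
  rw [faceWord, Finsupp.linearCombination_single, one_smul, dif_pos h,
    toFinset_injective_of_pairwise h.choose_spec.1.1 hz.1 h.choose_spec.2]

open Classical in
theorem wordFace_flagWord {zs : List P} (hz : IsFlag S x y zs) :
    wordFace k S x y (Finsupp.single (flagWord r y x zs) 1) = Finsupp.single zs.toFinset 1 := by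
  have h : ∃ us, IsFlag S x y us ∧ flagWord r y x us = flagWord r y x zs := ⟨zs, hz, rfl⟩
  rw [wordFace, Finsupp.linearCombination_single, one_smul, dif_pos h,
    flagWord_injective h.choose_spec.1.univ hz.univ h.choose_spec.2]

/-- A word determines the class of its interval, so distinct classes have disjoint sets of words.
This makes the sum over α direct. -/
theorem wordFace_of_ne {x' y' : P} (h : x ≤ y) (h' : x' ≤ y') (hne : tcls r x y ≠ tcls r x' y')
    {zs : List P} (hz : IsFlag S x' y' zs) :
    wordFace k S x y (Finsupp.single (flagWord r y' x' zs) 1) = 0 := by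
  rw [wordFace, Finsupp.linearCombination_single, one_smul, dif_neg]
  exact fun ⟨us, hu, e⟩ => hne (tcls_eq_of_flagWord_eq h h' hu.univ hz.univ e)

theorem wordFace_faceWord_of_ne {x' y' : P} (h : x ≤ y) (h' : x' ≤ y')
    (hne : tcls r x y ≠ tcls r x' y') (j : ℤ) (c : Finset P →₀ k) :
    wordFace k S x y (faceWord k S x' y' j c) = 0 := by
  classical
  have : wordFace k S x y ∘ₗ faceWord k S x' y' j = 0 := lin_ext fun s => by
    rw [LinearMap.comp_apply, LinearMap.zero_apply]
    by_cases hs : ∃ zs, IsFlag S x' y' zs ∧ zs.toFinset = s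
    · obtain ⟨zs, hz, rfl⟩ := hs
      rw [faceWord_toFinset j hz, degWord]
      split_ifs
      · exact wordFace_of_ne h h' hne hz
      · exact map_zero _
    · rw [faceWord, Finsupp.linearCombination_single, one_smul, dif_neg hs, map_zero]
  exact congr($this c)

open Classical in
theorem faceWord_lmapDomain (j : ℤ) {v : List P →₀ k}
    (hv : v ∈ Finsupp.supported k k {zs | IsFlag S x y zs}) :
    faceWord k S x y j (Finsupp.lmapDomain k k List.toFinset v) =
      Finsupp.linearCombination k (degWord k S x y j) v :=
  eq_of_supported (f := faceWord k S x y j ∘ₗ Finsupp.lmapDomain k k List.toFinset)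
    (fun zs hz => by
      rw [LinearMap.comp_apply, Finsupp.lmapDomain_apply, Finsupp.mapDomain_single,
        faceWord_toFinset j hz, Finsupp.linearCombination_single, one_smul]) hv

/-- Faces in the next layer have degree greater than j, so `faceWord` factors through the relative
chains. -/
theorem faceWord_of_mem_layer (hS : RightClosed S) (hS' : ∀ α ∈ S, ¬ IsId α) (h : x ≤ y)
    (hxy : tcls r x y ∈ S) (j : ℤ) {s : Finset P}
    (hs : s ∈ ((flagComplex S x y).layer j).faces) :
    faceWord k S x y j (Finsupp.single s 1) = 0 := by
  classical
  obtain ⟨zs, hz, rfl⟩ := exists_isFlag_of_mem_faces (ChainCx.mem_faces_of_mem_layer hs)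
  rw [toFinset_mem_layer_iff hS hS' h hxy hz] at hs
  rw [faceWord_toFinset j hz, degWord_of_ne]
  omega

/-- The faces of the layer of dimension `j - 1` that are not in the next layer are the flags whose
words have degree `j`. -/
theorem layer_cases [DecidableEq P] (hS : RightClosed S) (hS' : ∀ α ∈ S, ¬ IsId α) (h : x ≤ y)
    (hxy : tcls r x y ∈ S) (j : ℤ) {s : Finset P}
    (hs : s ∈ ((flagComplex S x y).layer (j - 1)).faces) :
    s ∈ ((flagComplex S x y).layer j).faces ∨ ∃ zs, IsFlag S x y zs ∧ zs.toFinset = s ∧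
      (wdeg S (flagWord r y x zs) : ℤ) = j := by
  obtain ⟨zs, hz, rfl⟩ := exists_isFlag_of_mem_faces (ChainCx.mem_faces_of_mem_layer hs)
  rw [toFinset_mem_layer_iff hS hS' h hxy hz] at hs ⊢
  rcases (show j ≤ _ by omega : j ≤ (wdeg S (flagWord r y x zs) : ℤ)).eq_or_lt with h1 | h1
  · exact Or.inr ⟨zs, hz, rfl, h1.symm⟩
  · exact Or.inl h1

theorem faceWord_eq_zero (hS : RightClosed S) (hS' : ∀ α ∈ S, ¬ IsId α) (h : x ≤ y)
    (hxy : tcls r x y ∈ S) (j n : ℤ) {c : Finset P →₀ k} (hc : c ∈ Finsupp.supported k k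
      {s | s ∈ ((flagComplex S x y).layer j).faces ∧ (s.card : ℤ) - 1 = n}) :
    faceWord k S x y j c = 0 :=
  eq_of_supported (g := 0) (fun _ hs => faceWord_of_mem_layer hS hS' h hxy j hs.1) hc

/-- The chain-map property. Faces of degree j are handled by `wordBd_flagWord`; for faces in layer j
both sides vanish, because that layer is closed under passing to boundaries. -/
theorem barBd_faceWord (hS : RightClosed S) (hS' : ∀ α ∈ S, ¬ IsId α) (h : x ≤ y)
    (hxy : tcls r x y ∈ S) (j n : ℤ) {c : Finset P →₀ k} (hc : c ∈ Finsupp.supported k k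
      {s | s ∈ ((flagComplex S x y).layer (j - 1)).faces ∧ (s.card : ℤ) - 1 = n}) :
    barBd k S (faceWord k S x y j c) = faceWord k S x y j (setBd k c) := by
  classical
  refine eq_of_supported (f := barBd k S ∘ₗ faceWord k S x y j)
    (g := faceWord k S x y j ∘ₗ setBd k) (fun s hs => ?_) hc
  rw [LinearMap.comp_apply, LinearMap.comp_apply]
  rcases layer_cases hS hS' h hxy j hs.1 with h1 | ⟨zs, hz, rfl, hj⟩
  · rw [faceWord_of_mem_layer hS hS' h hxy j h1, map_zero]
    exact (faceWord_eq_zero hS hS' h hxy j _ (setBd_mem _ _ (single_mem_supported ⟨h1, rfl⟩))).symm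
  · rw [faceWord_toFinset j hz, degWord_of_eq hj, barBd_single, wordBd_flagWord hS hz hj,
      setBd_single_toFinset k hz.1]
    exact (faceWord_lmapDomain j
      (Finsupp.supported_mono (fun us hus => hz.sublist hus.1) (listBd_mem k zs))).symm

/-- The two maps are inverse only modulo chains of layer j, which is all that relative homology
requires. -/
theorem wordFace_faceWord_sub_mem (hS : RightClosed S) (hS' : ∀ α ∈ S, ¬ IsId α) (h : x ≤ y)
    (hxy : tcls r x y ∈ S) (j n : ℤ) {c : Finset P →₀ k}
    (hc : c ∈ Finsupp.supported k k
      {s | s ∈ ((flagComplex S x y).layer (j - 1)).faces ∧ (s.card : ℤ) - 1 = n}) :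
    wordFace k S x y (faceWord k S x y j c) - c ∈ Finsupp.supported k k
      {s | s ∈ ((flagComplex S x y).layer j).faces ∧ (s.card : ℤ) - 1 = n} := by
  classical
  refine map_mem_of_supported (f := wordFace k S x y ∘ₗ faceWord k S x y j - LinearMap.id)
    (fun s hs => ?_) hc
  rw [LinearMap.sub_apply, LinearMap.comp_apply, LinearMap.id_apply]
  rcases layer_cases hS hS' h hxy j hs.1 with h1 | ⟨zs, hz, rfl, hj⟩
  · rw [faceWord_of_mem_layer hS hS' h hxy j h1, map_zero, zero_sub]
    exact neg_mem (single_mem_supported ⟨h1, hs.2⟩)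
  · rw [faceWord_toFinset j hz, degWord_of_eq hj, wordFace_flagWord hz, sub_self]
    exact zero_mem _

end General

section MonomialIdeal

variable (J : Submodule k (RedIncAlg k r)) [IsMonomialRightIdeal k J]

theorem flagWord_mem_modWordsDeg {x y : P} (h : x ≤ y) (hxy : tcls r x y ∈ monSet J) {i : ℕ}
    {j : ℤ} {zs : List P} (hz : IsFlag (monSet J) x y zs) (hi : zs.length = i)
    (hj : (wdeg (monSet J) (flagWord r y x zs) : ℤ) = j) :
    flagWord r y x zs ∈ modWordsDeg J (Quotient.mk _ x) (Quotient.mk _ y) i j :=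
  ⟨⟨⟨isWord_flagWord h hz.univ, by rw [length_flagWord, hi]⟩, headIn_flagWord hxy hz,
    headVtx_flagWord _ _ _ _⟩, hj⟩

theorem faceWord_mem {x y : P} (h : x ≤ y) (hxy : tcls r x y ∈ monSet J) {i : ℕ} {j n : ℤ}
    (hn : (i : ℤ) - 1 = n) {c : Finset P →₀ k} (hc : c ∈ Finsupp.supported k k
      {s | s ∈ ((flagComplex (monSet J) x y).layer (j - 1)).faces ∧ (s.card : ℤ) - 1 = n}) :
    faceWord k (monSet J) x y j c ∈ Finsupp.supported k k
      (modWordsDeg J (Quotient.mk _ x) (Quotient.mk _ y) i j) := by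
  classical
  refine map_mem_of_supported (fun s hs => ?_) hc
  rcases layer_cases (rightClosed_monSet J) (fun _ => not_isId_of_mem) h hxy j hs.1 with
    h1 | ⟨zs, hz, rfl, hj⟩
  · rw [faceWord_of_mem_layer (rightClosed_monSet J) (fun _ => not_isId_of_mem) h hxy j h1]
    exact zero_mem _
  · rw [faceWord_toFinset j hz, degWord_of_eq hj]
    refine single_mem_supported (flagWord_mem_modWordsDeg J h hxy hz ?_ hj)
    have := hs.2
    rw [hz.card_toFinset] at this
    omega

/-- Every word comes from a flag in exactly one of the representing intervals. -/
theorem exists_flag_of_mem_modWordsDeg (rep : Quotient r → NonemptyInterval P)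
    (hrep : ∀ α, Quotient.mk r (rep α) = α) {v w : Vtx r} {i : ℕ} {j : ℤ} {l : List (Quotient r)}
    (hl : l ∈ modWordsDeg J v w i j) :
    ∃ α, (xi k α ∈ J ∧ src r α = v ∧ tgt r α = w) ∧
      ∃ zs, IsFlag (monSet J) (rep α).fst (rep α).snd zs ∧ zs.length = i ∧
        flagWord r (rep α).snd (rep α).fst zs = l := by
  obtain ⟨⟨⟨h1, h2⟩, h3, h4⟩, h5⟩ := hl
  -- The first letter lies in J, hence in I, so no letter of the word is an identity and the word
  -- comes from a flag.
  have ht : IsTail w l := by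
    cases l with
    | nil => trivial
    | cons α l => exact ⟨not_isId_of_mem h3, h1⟩
  have h0 : l ≠ [] := by rintro rfl; exact h1
  obtain ⟨x, y, us, hlt, hu, rfl, hw⟩ := exists_flag_of_isTail ht h0
  -- The interval found by concatenation need not be the chosen representative of its class; the
  -- flag is transported there with its word unchanged.
  have hα : tcls r x y = tcls r (rep (tcls r x y)).fst (rep (tcls r x y)).snd :=
    (hrep _).symm.trans (tcls_of_le (rep (tcls r x y)).fst_le_snd).symm
  obtain ⟨zs, hz, e⟩ := exists_flag_of_tcls_eq hlt.le (rep (tcls r x y)).fst_le_snd hα hu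
  have hu' : IsFlag (monSet J) x y us := hu.of_headIn (rightClosed_monSet J) h3
  have hz' := hz.of_headIn (rightClosed_monSet J) (e ▸ h3)
  refine ⟨tcls r x y, ⟨?_, ?_, ?_⟩, zs, hz', ?_, e⟩
  · change tcls r x y ∈ monSet J
    cases us with
    | nil => exact h3
    | cons z us =>
      exact (rightClosed_monSet J).tcls_mem h3 (hu.2 z List.mem_cons_self).1.le
        (hu.2 z List.mem_cons_self).2.1.le
  · rw [src_tcls, ← h4, headVtx_flagWord]
  · rw [tgt_tcls hlt.le, hw]
  · have h7 := congrArg List.length e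
    rw [length_flagWord] at h7
    omega

end MonomialIdeal

end FaceWords
end RedInc

namespace RedInc
-- Linear algebra of homology, and Tor as the homology of words.
noncomputable section Homology

section Abstract

variable {k : Type*} [Field k] {V U : Type*} [AddCommGroup V] [Module k V] [AddCommGroup U]
  [Module k U]

/-- The quotient of the cycles `Z` by the boundaries `B`. -/
abbrev Subquotient (Z B : Submodule k V) := ↥Z ⧸ B.submoduleOf Z

/-- A homology space that is split into homology spaces indexed by `Γ`. -/
theorem nonempty_homology_equiv_directSum {Γ : Type*} {Z B : Submodule k V}
    {Z' B' : Γ → Submodule k U} (n : Γ → U →ₗ[k] V) (p : Γ → V →ₗ[k] U)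
    (hn : ∀ γ, ∀ c ∈ Z' γ, n γ c ∈ Z) (hnB : ∀ γ, ∀ c ∈ B' γ, n γ c ∈ B)
    (hp : ∀ γ, ∀ z ∈ Z, p γ z ∈ Z' γ) (hpB : ∀ γ, ∀ z ∈ B, p γ z ∈ B' γ)
    (hpn : ∀ γ, ∀ c ∈ Z' γ, p γ (n γ c) - c ∈ B' γ)
    (hne : ∀ γ γ', γ ≠ γ' → ∀ c, p γ (n γ' c) = 0)
    (hsum : ∀ z ∈ Z, ∃ F : Finset Γ, ∑ γ ∈ F, n γ (p γ z) = z) :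
    Nonempty (Subquotient Z B ≃ₗ[k] ⨁ γ, Subquotient (Z' γ) (B' γ)) := by
  classical
  let N : ∀ γ, (↥(Z' γ) ⧸ (B' γ).submoduleOf (Z' γ)) →ₗ[k] (↥Z ⧸ B.submoduleOf Z) := fun γ =>
    Submodule.mapQ _ _ ((n γ).restrict (hn γ)) fun c hc => hnB γ c hc
  let Q : ∀ γ, (↥Z ⧸ B.submoduleOf Z) →ₗ[k] (↥(Z' γ) ⧸ (B' γ).submoduleOf (Z' γ)) := fun γ =>
    Submodule.mapQ _ _ ((p γ).restrict (hp γ)) fun c hc => hpB γ c hc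
  have hQN : ∀ γ c, Q γ (N γ c) = c := fun γ c => by
    obtain ⟨c, rfl⟩ := Submodule.mkQ_surjective _ c
    exact (Submodule.Quotient.eq _).2 (hpn γ c c.2)
  have hQN' : ∀ γ γ', γ ≠ γ' → ∀ c, Q γ (N γ' c) = 0 := fun γ γ' h c => by
    obtain ⟨c, rfl⟩ := Submodule.mkQ_surjective _ c
    refine (Submodule.Quotient.mk_eq_zero _).2 ?_
    change p γ (n γ' c) ∈ B' γ
    rw [hne γ γ' h]
    exact zero_mem _
  -- On homology the maps Q γ read off the components of the sum of the maps N γ; this gives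
  -- injectivity.
  have hcomp : ∀ γ f, Q γ (DirectSum.toModule k Γ _ N f) = f γ := fun γ f => by
    have : Q γ ∘ₗ DirectSum.toModule k Γ _ N = DirectSum.component k Γ _ γ := by
      refine DirectSum.linearMap_ext _ fun γ' => LinearMap.ext fun c => ?_
      rw [LinearMap.comp_apply, LinearMap.comp_apply, DirectSum.toModule_lof]
      by_cases h : γ = γ'
      · subst h
        rw [hQN, LinearMap.comp_apply, DirectSum.component.lof_self]
      · rw [hQN' γ γ' h, LinearMap.comp_apply, DirectSum.component.of, dif_neg (Ne.symm h)]
    exact congr($this f)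
  refine ⟨(LinearEquiv.ofBijective (DirectSum.toModule k Γ _ N) ⟨?_, fun q => ?_⟩).symm⟩
  · intro f g hfg
    exact DFinsupp.ext fun γ => by rw [← hcomp γ f, ← hcomp γ g, hfg]
  · obtain ⟨z, rfl⟩ := Submodule.mkQ_surjective _ q
    obtain ⟨F, hF⟩ := hsum z z.2
    refine ⟨∑ γ ∈ F, DirectSum.lof k Γ _ γ (Q γ (Submodule.mkQ _ z)), ?_⟩
    rw [map_sum]
    simp only [DirectSum.toModule_lof]
    -- For surjectivity the cycle is literally the finite sum of its components, not only up to a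
    -- boundary.
    have h1 : z = ∑ γ ∈ F, (n γ).restrict (hn γ) ((p γ).restrict (hp γ) z) :=
      Subtype.ext <| by
        rw [AddSubmonoidClass.coe_finsetSum]
        exact hF.symm
    conv_rhs => rw [h1, map_sum]
    rfl

/-- The homology classes of the cycles in a subspace `C`, computed in coordinates. -/
theorem nonempty_map_mkQ_equiv {T : Type*} [AddCommGroup T] [Module k T] {Zc Bd C : Submodule k T}
    {Z B : Submodule k V} (co : T →ₗ[k] V) (cm : V →ₗ[k] T) (h1 : ∀ t, cm (co t) = t)
    (hZ : ∀ z ∈ Z, cm z ∈ Zc) (hC : ∀ z ∈ Z, cm z ∈ C) (hco : ∀ t ∈ Zc, t ∈ C → co t ∈ Z)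
    (hB : ∀ z ∈ Z, cm z ∈ Bd ↔ z ∈ B) :
    Nonempty (↥((C.submoduleOf Zc).map (Bd.submoduleOf Zc).mkQ) ≃ₗ[k]
      Subquotient Z B) := by
  let θ : ↥Z →ₗ[k] ↥((C.submoduleOf Zc).map (Bd.submoduleOf Zc).mkQ) :=
    ((Bd.submoduleOf Zc).mkQ ∘ₗ cm.restrict hZ).codRestrict _ fun z =>
      ⟨cm.restrict hZ z, hC z z.2, rfl⟩
  have hθ : Function.Surjective θ := by
    rintro ⟨_, t, ht, rfl⟩
    exact ⟨⟨co t, hco t t.2 ht⟩, Subtype.ext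
      (congrArg (Bd.submoduleOf Zc).mkQ (Subtype.ext (h1 t)))⟩
  have hk : LinearMap.ker θ = B.submoduleOf Z := by
    ext z
    rw [LinearMap.mem_ker]
    refine Iff.trans ?_ (hB z z.2)
    exact Subtype.ext_iff.trans (Submodule.Quotient.mk_eq_zero _)
  exact ⟨((Submodule.quotEquivOfEq _ _ hk.symm).trans (θ.quotKerEquivOfSurjective hθ)).symm⟩

end Abstract

variable {k : Type u} [Field k] {P : Type v} [PartialOrder P] [LocallyFiniteOrder P]
  {r : Setoid (NonemptyInterval P)} [IncidenceLaws r]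
  (J : Submodule k (RedIncAlg k r)) [IsMonomialRightIdeal k J]

/-- The cycles of the complex of words. -/
def wordCycles (v w : Vtx r) (i : ℕ) (j : ℤ) : Submodule k (List (Quotient r) →₀ k) :=
  Finsupp.supported k k (modWordsDeg J v w i j) ⊓ LinearMap.ker (barBd k (monSet J))

/-- The boundaries of the complex of words. -/
def wordBoundaries (v w : Vtx r) (i : ℕ) (j : ℤ) : Submodule k (List (Quotient r) →₀ k) :=
  (Finsupp.supported k k (modWordsDeg J v w (i + 1) j)).map (barBd k (monSet J))

/-- The differential preserves the degree of words, so a boundary that is homogeneous of degree j is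
already the boundary of the degree j part of its primitive. This reconciles Tor, whose boundaries
come from chains of all degrees, with the complex in a single degree. -/
theorem wordBoundaries_of_mem {v w : Vtx r} {i : ℕ} {j : ℤ} {c : List (Quotient r) →₀ k}
    (hc : c ∈ Finsupp.supported k k (modWords J v w (i + 1)))
    (hb : barBd k (monSet J) c ∈ Finsupp.supported k k (modWordsDeg J v w i j)) :
    barBd k (monSet J) c ∈ wordBoundaries J v w i j := by
  obtain ⟨p, hp⟩ : ∃ p : List (Quotient r) → Prop, ∀ l, p l ↔ (wdeg (monSet J) l : ℤ) = j :=
    ⟨_, fun _ => Iff.rfl⟩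
  refine ⟨fil p c, ?_, ?_⟩
  · refine map_mem_of_supported (fun l hl => ?_) hc
    by_cases h : p l
    · rw [fil_of_pos h]; exact single_mem_supported ⟨hl, (hp l).1 h⟩
    · rw [fil_of_neg h]; exact zero_mem _
  · have h1 : fil p (barBd k (monSet J) c) = barBd k (monSet J) c :=
      eq_of_supported (g := LinearMap.id) (fun l hl => fil_of_pos ((hp l).2 hl.2)) hb
    refine Eq.trans ?_ h1
    refine eq_of_supported (f := barBd k (monSet J) ∘ₗ fil p) (g := fil p ∘ₗ barBd k (monSet J))
      (fun l hl => ?_) hc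
    rw [LinearMap.comp_apply, LinearMap.comp_apply, barBd_single]
    have hm := wordBd_mem (k := k) (rightClosed_monSet J) hl.1.1
    by_cases h : p l
    · rw [fil_of_pos h, barBd_single]
      have h2 : fil p (wordBd k (monSet J) l) = wordBd k (monSet J) l := eq_of_supported
        (f := fil p) (g := LinearMap.id) (fun l' hl' => fil_of_pos (p := p) (i := l') (by rw [hp, hl'.wdeg, ← hp]; exact h)) hm
      exact h2.symm
    · rw [fil_of_neg h, map_zero]
      have h2 : fil p (wordBd k (monSet J) l) = 0 := eq_of_supported
        (f := fil p) (g := 0) (fun l' hl' => fil_of_neg (p := p) (i := l') (by rw [hp, hl'.wdeg, ← hp]; exact h)) hm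
      exact h2.symm

/-- The coordinates identify cycles, boundaries and internal degrees of the tensored bar resolution
with those of words. -/
theorem nonempty_torDeg_equiv_words (v w : Vtx r) (i : ℕ) (j : ℤ) :
    Nonempty ((barRes k w).torDeg (idemDeg J v) i j ≃ₗ[k]
      Subquotient (wordCycles J v w i j) (wordBoundaries J v w i j)) := by
  have hmem : ∀ z ∈ wordCycles J v w i j, barCoord J v w i (barComb J v w i z) = z := fun z hz =>
    barCoord_barComb J (Finsupp.supported_mono (fun _ hl => hl.1) hz.1)
  refine nonempty_map_mkQ_equiv (barCoord J v w i) (barComb J v w i) (barComb_barCoord J)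
    (fun z hz => ?_) (fun z hz => barComb_mem_chainDeg J hz.1) (fun t ht htC => ?_) fun z hz => ?_
  · exact (mem_cyc_iff J _).2 ((congrArg (barBd k (monSet J)) (hmem z hz)).trans hz.2)
  · exact ⟨barCoord_mem_of_chainDeg J htC, (mem_cyc_iff J t).1 ht⟩
  · constructor
    · rintro ⟨s, hs⟩
      have h1 : barBd k (monSet J) (barCoord J v w (i + 1) s) = z :=
        (barCoord_bd J s).symm.trans ((congrArg (barCoord J v w i) hs).trans (hmem z hz))
      rw [← h1]
      refine wordBoundaries_of_mem J (barCoord_mem J s) ?_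
      rw [h1]
      exact hz.1
    · rintro ⟨c, hc, rfl⟩
      have h1 : barCoord J v w (i + 1) (barComb J v w (i + 1) c) = c :=
        barCoord_barComb J (Finsupp.supported_mono (fun _ hl => hl.1) hc)
      refine ⟨barComb J v w (i + 1) c, ?_⟩
      refine (barComb_barCoord J _).symm.trans (congrArg (barComb J v w i) ?_)
      exact (barCoord_bd J _).trans (congrArg _ h1)

end Homology
end RedInc

namespace RedInc
-- Splitting the complex of words by the composite class.
noncomputable section WordDecomposition

variable {k : Type u} [Field k] {P : Type v} [PartialOrder P] [LocallyFiniteOrder P]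
  {r : Setoid (NonemptyInterval P)} [IncidenceLaws r]
  (J : Submodule k (RedIncAlg k r)) [IsMonomialRightIdeal k J]
  {rep : Quotient r → NonemptyInterval P}

theorem tcls_rep (hrep : ∀ α, Quotient.mk r (rep α) = α) (α : Quotient r) :
    tcls r (rep α).fst (rep α).snd = α :=
  (tcls_of_le (rep α).fst_le_snd).trans (hrep α)

theorem tcls_rep_ne (hrep : ∀ α, Quotient.mk r (rep α) = α) {α β : Quotient r} (h : α ≠ β) :
    tcls r (rep α).fst (rep α).snd ≠ tcls r (rep β).fst (rep β).snd := by
  rw [tcls_rep hrep, tcls_rep hrep]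
  exact h

theorem tcls_rep_mem (hrep : ∀ α, Quotient.mk r (rep α) = α) {α : Quotient r} (h : xi k α ∈ J) :
    tcls r (rep α).fst (rep α).snd ∈ monSet J := by
  rw [tcls_rep hrep]; exact h

theorem mk_fst_rep (hrep : ∀ α, Quotient.mk r (rep α) = α) (α : Quotient r) :
    (Quotient.mk _ (rep α).fst : Vtx r) = src r α := by
  conv_rhs => rw [← tcls_rep hrep α, src_tcls]

theorem mk_snd_rep (hrep : ∀ α, Quotient.mk r (rep α) = α) (α : Quotient r) :
    (Quotient.mk _ (rep α).snd : Vtx r) = tgt r α := by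
  conv_rhs => rw [← tcls_rep hrep α, tgt_tcls (rep α).fst_le_snd]

variable (rep) in
/-- The words of degree `j` of the flags in the interval that represents `α`. -/
def repWord (α : Quotient r) (j : ℤ) : (Finset P →₀ k) →ₗ[k] (List (Quotient r) →₀ k) :=
  faceWord k (monSet J) (rep α).fst (rep α).snd j

variable (rep) in
/-- The flags in the interval that represents `α` that belong to words. -/
def repFace (α : Quotient r) : (List (Quotient r) →₀ k) →ₗ[k] (Finset P →₀ k) :=
  wordFace k (monSet J) (rep α).fst (rep α).snd

variable (rep) in
/-- The chains of the sequential layers. -/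
def layerChains (α : Quotient r) (m n : ℤ) : Submodule k (Finset P →₀ k) :=
  Finsupp.supported k k {s |
    s ∈ ((orderComplex (restrictedInterval k J (rep α).fst (rep α).snd)).layer m).faces ∧
      (s.card : ℤ) - 1 = n}

theorem layerChains_eq (α : Quotient r) (m n : ℤ) : layerChains J rep α m n =
    Finsupp.supported k k {s |
      s ∈ ((flagComplex (monSet J) (rep α).fst (rep α).snd).layer m).faces ∧
        (s.card : ℤ) - 1 = n} := by
  rw [layerChains, restrictedInterval_eq, flagComplex]

theorem repWord_mem (hrep : ∀ α, Quotient.mk r (rep α) = α) {α : Quotient r} (hα : xi k α ∈ J)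
    {i : ℕ} {j n : ℤ} (hn : (i : ℤ) - 1 = n) {c : Finset P →₀ k}
    (hc : c ∈ layerChains J rep α (j - 1) n) :
    repWord J rep α j c ∈ Finsupp.supported k k (modWordsDeg J (src r α) (tgt r α) i j) := by
  rw [layerChains_eq] at hc
  have := faceWord_mem J (rep α).fst_le_snd (tcls_rep_mem J hrep hα) hn hc
  rwa [mk_fst_rep hrep, mk_snd_rep hrep] at this

theorem repWord_eq_zero (hrep : ∀ α, Quotient.mk r (rep α) = α) {α : Quotient r}
    (hα : xi k α ∈ J) {j n : ℤ} {c : Finset P →₀ k} (hc : c ∈ layerChains J rep α j n) :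
    repWord J rep α j c = 0 := by
  rw [layerChains_eq] at hc
  exact faceWord_eq_zero (rightClosed_monSet J) (fun _ => not_isId_of_mem) (rep α).fst_le_snd
    (tcls_rep_mem J hrep hα) j n hc

theorem barBd_repWord (hrep : ∀ α, Quotient.mk r (rep α) = α) {α : Quotient r}
    (hα : xi k α ∈ J) {j n : ℤ} {c : Finset P →₀ k} (hc : c ∈ layerChains J rep α (j - 1) n) :
    barBd k (monSet J) (repWord J rep α j c) = repWord J rep α j (setBd k c) := by
  rw [layerChains_eq] at hc
  exact barBd_faceWord (rightClosed_monSet J) (fun _ => not_isId_of_mem) (rep α).fst_le_snd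
    (tcls_rep_mem J hrep hα) j n hc

theorem repFace_repWord_sub_mem (hrep : ∀ α, Quotient.mk r (rep α) = α) {α : Quotient r}
    (hα : xi k α ∈ J) {j n : ℤ} {c : Finset P →₀ k} (hc : c ∈ layerChains J rep α (j - 1) n) :
    repFace J rep α (repWord J rep α j c) - c ∈ layerChains J rep α j n := by
  rw [layerChains_eq] at hc ⊢
  exact wordFace_faceWord_sub_mem (rightClosed_monSet J) (fun _ => not_isId_of_mem) (rep α).fst_le_snd
    (tcls_rep_mem J hrep hα) j n hc

theorem repFace_repWord_of_ne (hrep : ∀ α, Quotient.mk r (rep α) = α) {α β : Quotient r}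
    (h : α ≠ β) (j : ℤ) (c : Finset P →₀ k) : repFace J rep α (repWord J rep β j c) = 0 :=
  wordFace_faceWord_of_ne (rep α).fst_le_snd (rep β).fst_le_snd (tcls_rep_ne hrep h) j c

theorem setBd_mem_layerChains {α : Quotient r} {m n : ℤ} {c : Finset P →₀ k}
    (hc : c ∈ layerChains J rep α m n) : setBd k c ∈ layerChains J rep α m (n - 1) :=
  setBd_mem _ n hc

/-- The words are the words of the faces of the representing intervals. -/
theorem exists_face_of_mem_modWordsDeg (hrep : ∀ α, Quotient.mk r (rep α) = α) {v w : Vtx r}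
    {i : ℕ} {j n : ℤ} (hn : (i : ℤ) - 1 = n) {l : List (Quotient r)}
    (hl : l ∈ modWordsDeg J v w i j) : ∃ β, (xi k β ∈ J ∧ src r β = v ∧ tgt r β = w) ∧
      ∃ s, Finsupp.single s (1 : k) ∈ layerChains J rep β (j - 1) n ∧
        repWord J rep β j (Finsupp.single s 1) = Finsupp.single l 1 ∧
        repFace J rep β (Finsupp.single l 1) = Finsupp.single s (1 : k) := by
  classical
  obtain ⟨β, hβ, zs, hz, hi, rfl⟩ := exists_flag_of_mem_modWordsDeg J rep hrep hl
  refine ⟨β, hβ, zs.toFinset, ?_, ?_, wordFace_flagWord hz⟩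
  rw [layerChains_eq]
  refine single_mem_supported ⟨?_, ?_⟩
  · refine (toFinset_mem_layer_iff (rightClosed_monSet J) (fun _ => not_isId_of_mem)
      (rep β).fst_le_snd (tcls_rep_mem J hrep hβ.1) hz _).2 ?_
    rw [sub_add_cancel]
    exact hl.2.ge
  · rw [hz.card_toFinset, hi, hn]
  · exact (faceWord_toFinset j hz).trans (degWord_of_eq hl.2)

theorem repFace_mem (hrep : ∀ α, Quotient.mk r (rep α) = α) (α : Quotient r) {v w : Vtx r}
    {i : ℕ} {j n : ℤ} (hn : (i : ℤ) - 1 = n) {c : List (Quotient r) →₀ k}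
    (hc : c ∈ Finsupp.supported k k (modWordsDeg J v w i j)) :
    repFace J rep α c ∈ layerChains J rep α (j - 1) n := by
  refine map_mem_of_supported (fun l hl => ?_) hc
  obtain ⟨β, hβ, s, hs, h1, h2⟩ := exists_face_of_mem_modWordsDeg J hrep hn hl
  by_cases h : α = β
  · rw [h, h2]; exact hs
  · rw [← h1, repFace_repWord_of_ne J hrep h]; exact zero_mem _

/-- Passing from words to faces commutes with boundaries only modulo layer j: merges that raise the
degree are zero for words, while on the simplicial side they are faces of layer j. -/
theorem setBd_repFace_sub_mem (hrep : ∀ α, Quotient.mk r (rep α) = α) (α : Quotient r)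
    {v w : Vtx r} {i : ℕ} {j n : ℤ} (hn : (i : ℤ) - 1 = n) {c : List (Quotient r) →₀ k}
    (hc : c ∈ Finsupp.supported k k (modWordsDeg J v w i j)) :
    repFace J rep α (barBd k (monSet J) c) - setBd k (repFace J rep α c) ∈
      layerChains J rep α j (n - 1) := by
  refine map_mem_of_supported
    (f := repFace J rep α ∘ₗ barBd k (monSet J) - setBd k ∘ₗ repFace J rep α) (fun l hl => ?_) hc
  rw [LinearMap.sub_apply, LinearMap.comp_apply, LinearMap.comp_apply]
  obtain ⟨β, hβ, s, hs, h1, h2⟩ := exists_face_of_mem_modWordsDeg J hrep hn hl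
  have h3 := barBd_repWord J hrep hβ.1 hs
  rw [h1] at h3
  rw [h3]
  by_cases h : α = β
  · subst h
    rw [h2]
    exact repFace_repWord_sub_mem J hrep hβ.1 (setBd_mem_layerChains J hs)
  · rw [repFace_repWord_of_ne J hrep h, ← h1, repFace_repWord_of_ne J hrep h, map_zero, sub_zero]
    exact zero_mem _

theorem exists_sum_repWord_repFace (hrep : ∀ α, Quotient.mk r (rep α) = α) {v w : Vtx r}
    {i : ℕ} {j : ℤ} {c : List (Quotient r) →₀ k}
    (hc : c ∈ Finsupp.supported k k (modWordsDeg J v w i j)) :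
    ∃ F : Finset {α : Quotient r // xi k α ∈ J ∧ src r α = v ∧ tgt r α = w},
      ∑ α ∈ F, repWord J rep α.1 j (repFace J rep α.1 c) = c := by
  classical
  -- The index set may be infinite, but only finitely many classes occur in c. The claim is
  -- strengthened to all larger finite sets so that two such sets can be replaced by their union in
  -- the additive step.
  suffices H : ∃ F : Finset {α : Quotient r // xi k α ∈ J ∧ src r α = v ∧ tgt r α = w},
      ∀ F', F ⊆ F' → ∑ α ∈ F', repWord J rep α.1 j (repFace J rep α.1 c) = c from
    H.imp fun F hF => hF F subset_rfl
  refine supported_induction (motive := fun c =>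
    ∃ F : Finset {α : Quotient r // xi k α ∈ J ∧ src r α = v ∧ tgt r α = w},
      ∀ F', F ⊆ F' → ∑ α ∈ F', repWord J rep α.1 j (repFace J rep α.1 c) = c) hc
    (fun l hl => ?_) ?_ ?_ ?_
  · obtain ⟨β, hβ, s, hs, h1, h2⟩ := exists_face_of_mem_modWordsDeg J hrep rfl hl
    refine ⟨{⟨β, hβ⟩}, fun F' hF => ?_⟩
    rw [Finset.sum_eq_single_of_mem ⟨β, hβ⟩ (hF (Finset.mem_singleton_self _)), h2, h1]
    intro α _ hα
    rw [← h1, repFace_repWord_of_ne J hrep fun h => hα (Subtype.ext h), map_zero]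
  · exact ⟨∅, fun F' _ => by simp only [map_zero, Finset.sum_const_zero]⟩
  · rintro a b ⟨F, hF⟩ ⟨G, hG⟩
    refine ⟨F ∪ G, fun F' h => ?_⟩
    simp only [map_add, Finset.sum_add_distrib]
    rw [hF F' (Finset.union_subset_left h), hG F' (Finset.union_subset_right h)]
  · rintro c a ⟨F, hF⟩
    refine ⟨F, fun F' h => ?_⟩
    simp only [map_smul, ← Finset.smul_sum]
    rw [hF F' h]

theorem repWord_add_setBd (hrep : ∀ α, Quotient.mk r (rep α) = α) {α : Quotient r}
    (hα : xi k α ∈ J) {j n : ℤ} {a b : Finset P →₀ k} (ha : a ∈ layerChains J rep α j n)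
    (hb : b ∈ layerChains J rep α (j - 1) (n + 1)) :
    barBd k (monSet J) (repWord J rep α j b) = repWord J rep α j (a + setBd k b) := by
  rw [barBd_repWord J hrep hα hb, map_add, repWord_eq_zero J hrep hα ha, zero_add]

theorem setBd_repFace_mem (hrep : ∀ α, Quotient.mk r (rep α) = α) (α : Quotient r)
    {v w : Vtx r} {i : ℕ} {j n : ℤ} (hn : (i : ℤ) - 1 = n) {c : List (Quotient r) →₀ k}
    (hc : c ∈ Finsupp.supported k k (modWordsDeg J v w i j)) (h0 : barBd k (monSet J) c = 0) :
    setBd k (repFace J rep α c) ∈ layerChains J rep α j (n - 1) := by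
  have := setBd_repFace_sub_mem J hrep α hn hc
  rw [h0, map_zero, zero_sub] at this
  exact neg_mem_iff.1 this

theorem nonempty_words_equiv_directSum (hrep : ∀ α, Quotient.mk r (rep α) = α) (v w : Vtx r)
    (i : ℕ) (j : ℤ) :
    Nonempty (Subquotient (wordCycles J v w i j) (wordBoundaries J v w i j) ≃ₗ[k]
      ⨁ α : {α : Quotient r // xi k α ∈ J ∧ src r α = v ∧ tgt r α = w},
        RelHomology k
          ((orderComplex (restrictedInterval k J (rep α.1).fst (rep α.1).snd)).layer (j - 1))
          ((orderComplex (restrictedInterval k J (rep α.1).fst (rep α.1).snd)).layer j) (i - 1)) := by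
  refine nonempty_homology_equiv_directSum (U := FreeFin k P) (fun α => repWord J rep α.1 j)
    (fun α => repFace J rep α.1) ?_ ?_ ?_ ?_ ?_ ?_ ?_
  · rintro ⟨α, hα, rfl, rfl⟩ c ⟨h1, h2⟩
    exact ⟨repWord_mem J hrep hα rfl h1, LinearMap.mem_ker.2
      ((barBd_repWord J hrep hα h1).trans (repWord_eq_zero J hrep hα h2))⟩
  · rintro ⟨α, hα, rfl, rfl⟩ c hc
    obtain ⟨a, ha, _, ⟨b, hb, rfl⟩, rfl⟩ := Submodule.mem_sup.1 hc
    exact ⟨repWord J rep α j b, repWord_mem J hrep hα (by push_cast; ring) hb,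
      repWord_add_setBd J hrep hα ha hb⟩
  · rintro ⟨α, hα, rfl, rfl⟩ z ⟨h1, h2⟩
    exact ⟨repFace_mem J hrep α rfl h1, setBd_repFace_mem J hrep α rfl h1 h2⟩
  · rintro ⟨α, hα, rfl, rfl⟩ _ ⟨z, hz, rfl⟩
    -- A primitive z has words of i + 2 letters, that is, faces of dimension i = (i - 1) + 1. The
    -- faces of its boundary are the simplicial boundary of its faces plus a chain of layer j, hence
    -- a relative boundary.
    have h3 := setBd_repFace_sub_mem J hrep α (n := (i : ℤ) - 1 + 1) (by push_cast; ring) hz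
    rw [add_sub_cancel_right] at h3
    refine Submodule.mem_sup.2 ⟨_, h3, _, ⟨repFace J rep α z,
      repFace_mem J hrep α (by push_cast; ring) hz, rfl⟩, sub_add_cancel _ _⟩
  · rintro ⟨α, hα, rfl, rfl⟩ c ⟨h1, h2⟩
    exact Submodule.mem_sup_left (repFace_repWord_sub_mem J hrep hα h1)
  · exact fun α β h c => repFace_repWord_of_ne J hrep (fun hh => h (Subtype.ext hh)) j c
  · exact fun z hz => exists_sum_repWord_repFace J hrep hz.1

/-- The homology of the bar resolution in terms of the homology of sequential layers. -/
theorem nonempty_torDeg_barRes_equiv (hrep : ∀ α, Quotient.mk r (rep α) = α) (x y : Vtx r)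
    (i : ℕ) (j : ℤ) : Nonempty ((barRes k y).torDeg (idemDeg J x) i j ≃ₗ[k]
      ⨁ α : {α : Quotient r // xi k α ∈ J ∧ src r α = x ∧ tgt r α = y},
        RelHomology k
          ((orderComplex (restrictedInterval k J (rep α).fst (rep α).snd)).layer (j - 1))
          ((orderComplex (restrictedInterval k J (rep α).fst (rep α).snd)).layer j) (i - 1)) := by
  exact (nonempty_torDeg_equiv_words J x y i j).elim fun e =>
    (nonempty_words_equiv_directSum J hrep x y i j).map fun f => e.trans f

end WordDecomposition
end RedInc

/-! ### The theorem, for arbitrary graded resolutions and arbitrary lifts of the A_0-actions. -/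

theorem theorem3p1 {k : Type u} [Field k] {P : Type v} [PartialOrder P] [LocallyFiniteOrder P]
    (r : Setoid (NonemptyInterval P)) [IncidenceLaws r]
    (J : Submodule k (RedIncAlg k r)) [IsMonomialRightIdeal k J]
    (rep : Quotient r → NonemptyInterval P) (hrep : ∀ α, Quotient.mk r (rep α) = α)
    (F : GrRes k (ringDeg (augIdeal k r)) (A0Mod k r) (zeroDeg k (A0Mod k r)))
    (G : ∀ y : Vtx r, GrRes k (ringDeg (augIdeal k r)) (kMod k r y) (zeroDeg k (kMod k r y)))
    (i : ℕ) (j : ℤ) :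
    (∃ e : F.torDeg (grDeg (augIdeal k r) J) i j ≃ₗ[k]
        ⨁ q : Vtx r × Vtx r, (G q.2).torDeg (idemDeg J q.1) i j,
      ∀ (a b : A0 k r) (φ : F.Hom F (rightMul k r b))
        (ψ : ∀ y, (G y).Hom (G y) (rightMulK b y)) t q,
        e (GrRes.torDegMap (leftMul J a) (leftMul_deg J a) φ i j t) q =
          GrRes.torDegMap (leftMulIdem J a q.1) (leftMulIdem_deg J a q.1) (ψ q.2) i j (e t q)) ∧
    ∀ x y : Vtx r, Nonempty ((G y).torDeg (idemDeg J x) i j ≃ₗ[k]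
      ⨁ α : {α : Quotient r // xi k α ∈ J ∧ src r α = x ∧ tgt r α = y},
        RelHomology k
          ((orderComplex (restrictedInterval k J (rep α).fst (rep α).snd)).layer (j - 1))
          ((orderComplex (restrictedInterval k J (rep α).fst (rep α).snd)).layer j) (i - 1)) := by
  refine ⟨?_, ?_⟩
  · have := IncidenceLaws.finiteness (r := r)
    let _ : Fintype (Vtx r) := Fintype.ofFinite _
    have hR := iSup_ringDeg (augIdeal k r)
    -- The projections and inclusions are automatically graded, as all modules involved are
    -- concentrated in degree 0, so they lift to the given resolutions.
    have π : ∀ y : Vtx r, F.Hom (G y) (kProj y) := fun y =>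
      (GrRes.exists_hom hR (iSupIndep_zeroDeg _) F (G y) (kProj y) (zeroDeg_map _)).some
    have ι : ∀ y : Vtx r, (G y).Hom F (kIncl y) := fun y =>
      (GrRes.exists_hom hR (iSupIndep_zeroDeg _) (G y) F (kIncl y) (zeroDeg_map _)).some
    have key := GrRes.exists_torDeg_equiv_directSum (R := GrAlg k r)
      (degR := ringDeg (augIdeal k r)) (X := Vtx r) (Y := Vtx r)
      (N := A0Mod k r) (M := GrMod (augIdeal k r) J) (degM := grDeg (augIdeal k r) J)
      (K := fun y => kMod k r y) (prK := kProj) (inK := kIncl) (prL := idemProj J) (inL := idemIncl J)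
      (degK := fun y => zeroDeg k (kMod k r y)) (L := fun x => idemPart J x) (degL := idemDeg J)
      F G π ι sum_kIncl_kProj kProj_kIncl (fun _ _ h => kProj_kIncl_of_ne h) (idemProj_deg J)
      (idemIncl_deg J) (sum_idemIncl_idemProj J) (idemProj_idemIncl J)
      (fun _ _ h => idemProj_idemIncl_of_ne J h) i j
    refine key.imp fun e he a b φ ψ t q => ?_
    refine (he _ q).trans (Eq.trans ?_ (congrArg _ (he t q).symm))
    -- The components of e are induced by the projections, which commute with both A_0-actions. The
    -- lifts φ and ψ may be arbitrary because the maps on Tor do not depend on them.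
    exact GrRes.torDegMap_comm (idemProj_leftMul J a q.1) (kProj_rightMul b q.2) _ _ _ _ φ (π q.2) (π q.2)
      (ψ q.2) i j t
  · refine fun x y => (nonempty_torDeg_barRes_equiv J hrep x y i j).elim fun e => ?_
    -- The given resolution is exchanged for the bar resolution, on which the homology has been
    -- computed.
    exact (GrRes.nonempty_torDeg_equiv (iSup_ringDeg (augIdeal k r)) (iSupIndep_zeroDeg _) (G y)
      (barRes k y) (idemDeg J x) i j).map fun f => f.trans e
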